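/- Let $\Gamma\subset\mathrm{PSL}_2(\mathbb R)$ be a torsion-free lattice with cusps. For each cusp $\mathfrak a$ fix a scaling matrix $\sigma_{\mathfrak a}$, so that $\sigma_{\mathfrak a}\infty=\mathfrak a$ and $\sigma_{\mathfrak a}^{-1}\Gamma_{\mathfrak a}\sigma_{\mathfrak a}=\pm\begin{pmatrix}1&\mathbb Z\\0&1\end{pmatrix}$. Let $\chi:\Gamma\to\mathrm{GL}(V)$ be a representation on a finite-dimensional complex inner product space such that $\chi(\gamma)$ is unitary for every $\gamma\in\Gamma_{\mathfrak a}$ and every cusp $\mathfrak a$. Let $P_{\mathfrak a}$ be the orthogonal projection onto the space of $\chi(\Gamma_{\mathfrak a})$-fixed vectors, and $$E_{\mathfrak a}(z,s,\chi)=\sum_{\gamma\in\Gamma_{\mathfrak a}\backslash\Gamma}\operatorname{Im}(\sigma_{\mathfrak a}^{-1}\gamma z)^s\,\chi(\gamma^{-1})P_{\mathfrak a}.$$ For $g=\begin{pmatrix}a&b\\c&d\end{pmatrix}$ put $\mu(g)=a^2+b^2+c^2+d^2$. Then there is $\sigma_0>1$ with $\|\chi(\gamma)\|=O(\mu(\gamma)^{\sigma_0-1})$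 for $\gamma\in\Gamma$. For every such $\sigma_0>1$ and all cusps $\mathfrak a,\mathfrak b$ the series $E_{\mathfrak a}(z,s,\chi)$ converges absolutely for $\operatorname{Re}(s)>\sigma_0$ and $z\in\mathbb H$, and the following hold. (1) Suppose that $\mathfrak a=\mathfrak b$ or that $\mathfrak a,\mathfrak b$ are not $\Gamma$-equivalent. Let $\delta_{\mathfrak a\mathfrak b}$ be $1$ if $\mathfrak a=\mathfrak b$ and $0$ otherwise, and for $\operatorname{Re}(s)>\sigma_0$ let $$\varphi_{\mathfrak a\mathfrak b}(s)=\pi^{1/2}\frac{\Gamma(s-\frac12)}{\Gamma(s)}\,P_{\mathfrak b}\Big(\sum_{c>0}c^{-2s}\mathcal S_{\mathfrak a,\mathfrak b}(0,c,\chi)\Big)P_{\mathfrak a},\qquad \mathcal S_{\mathfrak a,\mathfrak b}(r,c,\chi)=\sum_{d\,(c)}e^{2\pi i rd/c}\,\chi(\sigma_{\mathfrak a}\omega_{c,d}\sigma_{\mathfrak b}^{-1})^{-1},$$ where $c>0$ and $d$ modulo $c$ run over the lower rows $(c,d)$ of elements of $\sigma_{\mathfrak a}^{-1}\Gamma\sigma_{\mathfrak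 b}$, and $\omega_{c,d}$ is one such element with lower row $(c,d)$; the sums over $d$ are finite and the series over $c$ converges absolutely. Let $e^{2\pi i\nu}$, $\nu\in N\subset[0,1)$, be the eigenvalues of $\chi(\gamma_{\mathfrak b})$, where $\gamma_{\mathfrak b}=\sigma_{\mathfrak b}\begin{pmatrix}1&1\\0&1\end{pmatrix}\sigma_{\mathfrak b}^{-1}$. Then for every $\beta$ with $$0<\beta<2\pi\min\big(\{1\}\cup\{\nu,\,1-\nu:\ \nu\in N,\ \nu\ne0\}\big)$$ and every $Y>0$ there is a function $C$, continuous on $\operatorname{Re}(s)>\sigma_0$, with $$\big\|E_{\mathfrak a}(\sigma_{\mathfrak b}z,s,\chi)-\delta_{\mathfrak a\mathfrak b}\,y^sP_{\mathfrak a}-\varphi_{\mathfrak a\mathfrak b}(s)\,y^{1-s}\big\|\le C(s)\,e^{-\beta y}$$ for all $s$ with $\operatorname{Re}(s)>\sigma_0$ and all $z\in\mathbb H$ with $y=\operatorname{Im} z\ge Y$. (2) There are constants $C_\sigma$ $(\sigma>\sigma_0)$ such that $\|E_{\mathfrak a}(\sigma_{\mathfrak b}z,s,\chi)\|\le C_\sigma\,(y^{\sigma}+y^{-\sigma})$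 for all $s$ with $\sigma=\operatorname{Re}(s)>\sigma_0$ and all $z\in\mathbb H$, $y=\operatorname{Im}z$. -/

import Mathlib

open scoped MatrixGroups UpperHalfPlane

noncomputable section

namespace TwistedEisenstein

/-- `SL(2, ℝ)` inside `GL(2, ℝ)`; Mathlib's `GL(2, ℝ)` acts on `ℝ ∪ {∞} = OnePoint ℝ`. -/
abbrev slToGL : SL(2, ℝ) →* GL (Fin 2) ℝ := Matrix.SpecialLinearGroup.toGL

/-- `a` is a cusp of `Γ`: a fixed point of a parabolic element of `Γ`. -/
def Cusp (Γ : Subgroup SL(2, ℝ)) (a : OnePoint ℝ) : Prop :=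
  IsCusp a (Γ.map slToGL)

/-- Subgroups of `PSL(2, ℝ)` are represented by their full preimages in `SL(2, ℝ)`, that is, by
the subgroups containing `-1`. This predicate says that `Γ` is (the preimage of) a torsion-free
non-cocompact lattice. -/
structure IsCuspidalLattice (Γ : Subgroup SL(2, ℝ)) : Prop where
  neg_one_mem : (-1 : SL(2, ℝ)) ∈ Γ
  discrete : DiscreteTopology Γ
  /-- There is a measurable set of representatives of `Γ \ ℍ` of finite area (`volume` on `ℍ` is
  the hyperbolic area `dx dy / y ^ 2`). -/
  finite_covolume : ∃ R : Set ℍ, MeasurableSet R ∧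
    (∀ z : ℍ, ∃! w : ℍ, w ∈ R ∧ ∃ γ ∈ Γ, γ • z = w) ∧ MeasureTheory.volume R < ⊤
  exists_cusp : ∃ a : OnePoint ℝ, Cusp Γ a
  /-- The image of `Γ` in `PSL(2, ℝ)` is torsion-free. -/
  torsion_free : ∀ γ ∈ Γ, ∀ n : ℕ, 0 < n → (γ ^ n = 1 ∨ γ ^ n = -1) → (γ = 1 ∨ γ = -1)

/-- The stabilizer `Γ_a` of a boundary point, as a subgroup of `Γ`. -/
def stab (Γ : Subgroup SL(2, ℝ)) (a : OnePoint ℝ) : Subgroup Γ :=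
  (MulAction.stabilizer (GL (Fin 2) ℝ) a).comap (slToGL.comp Γ.subtype)

/-- The matrix with rows `(1, t)` and `(0, 1)`. -/
def unip (t : ℝ) : SL(2, ℝ) := ⟨!![1, t; 0, 1], by simp [Matrix.det_fin_two]⟩

/-- `σ` is a scaling matrix for the boundary point `a`: `σ ∞ = a` and `σ⁻¹ Γ_a σ = ± n(ℤ)`. -/
structure IsScaling (Γ : Subgroup SL(2, ℝ)) (a : OnePoint ℝ) (σ : SL(2, ℝ)) : Prop where
  map_infty : slToGL σ • (OnePoint.infty : OnePoint ℝ) = a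
  conj_stab : ∀ g : SL(2, ℝ), (g ∈ Γ ∧ slToGL g • a = a) ↔
    ∃ k : ℤ, σ⁻¹ * g * σ = unip k ∨ σ⁻¹ * g * σ = -unip k

variable {V : Type*} [NormedAddCommGroup V] [InnerProductSpace ℂ V]

/-- `χ` is unitary at the cusps. -/
def UnitaryAtCusps {Γ : Subgroup SL(2, ℝ)} (χ : Γ →* (V →L[ℂ] V)) : Prop :=
  ∀ a, Cusp Γ a → ∀ γ ∈ stab Γ a, ∀ v w : V, inner ℂ (χ γ v) (χ γ w) = inner ℂ v w

/-- `μ(g)`: the sum of the squares of the entries of `g`. -/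
def mu (g : SL(2, ℝ)) : ℝ := g 0 0 ^ 2 + g 0 1 ^ 2 + g 1 0 ^ 2 + g 1 1 ^ 2

/-- `‖χ(γ)‖ = O(μ(γ) ^ (σ₀ - 1))` on `Γ`. -/
def GrowthBound {Γ : Subgroup SL(2, ℝ)} (χ : Γ →* (V →L[ℂ] V)) (σ₀ : ℝ) : Prop :=
  ∃ C : ℝ, ∀ γ : Γ, ‖χ γ‖ ≤ C * mu γ ^ (σ₀ - 1)

/-- The space `V ^ χ(Γ_a)` of vectors fixed by the stabilizer of `a`. -/
def fixedSpace {Γ : Subgroup SL(2, ℝ)} (χ : Γ →* (V →L[ℂ] V)) (a : OnePoint ℝ) :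
    Submodule ℂ V where
  carrier := {v | ∀ γ ∈ stab Γ a, χ γ v = v}
  add_mem' hv hw γ hγ := by rw [map_add, hv γ hγ, hw γ hγ]
  zero_mem' γ _ := map_zero _
  smul_mem' c v hv γ hγ := by rw [map_smul, hv γ hγ]

/-- The orthogonal projection `P_a` onto the space of `Γ_a`-fixed vectors. -/
def proj [FiniteDimensional ℂ V] {Γ : Subgroup SL(2, ℝ)} (χ : Γ →* (V →L[ℂ] V))
    (a : OnePoint ℝ) : V →L[ℂ] V :=
  (fixedSpace χ a).starProjection

/-- The term `Im(σ⁻¹ γ z) ^ s χ(γ⁻¹) P_a` of the Eisenstein series. If `σ` is a scaling matrix of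
the cusp `a`, it only depends on the coset `Γ_a γ`. -/
def eisTerm [FiniteDimensional ℂ V] {Γ : Subgroup SL(2, ℝ)} (χ : Γ →* (V →L[ℂ] V))
    (a : OnePoint ℝ) (σ : SL(2, ℝ)) (z : ℍ) (s : ℂ) (γ : Γ) : V →L[ℂ] V :=
  (((σ⁻¹ * (γ : SL(2, ℝ))) • z).im : ℂ) ^ s • (χ γ⁻¹ ∘L proj χ a)

/-- The coset space `Γ_a \ Γ`. -/
abbrev Cosets (Γ : Subgroup SL(2, ℝ)) (a : OnePoint ℝ) : Type :=
  Quotient (QuotientGroup.rightRel (stab Γ a))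

/-- The Eisenstein series `E_a(z, s, χ)`, with scaling matrix `σ` of the cusp `a`. -/
def eisenstein [FiniteDimensional ℂ V] {Γ : Subgroup SL(2, ℝ)} (χ : Γ →* (V →L[ℂ] V))
    (a : OnePoint ℝ) (σ : SL(2, ℝ)) (z : ℍ) (s : ℂ) : V →L[ℂ] V :=
  ∑' q : Cosets Γ a, eisTerm χ a σ z s q.out

/-- `e(x) = exp(2πix)`. -/
def e (x : ℝ) : ℂ := Complex.exp (2 * Real.pi * Complex.I * x)

/-- The set of `c > 0` such that `σa⁻¹ Γ σb` contains a matrix with lower left entry `c`. -/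
def moduli (Γ : Subgroup SL(2, ℝ)) (σa σb : SL(2, ℝ)) : Set ℝ :=
  {c | 0 < c ∧ ∃ γ : Γ, (σa⁻¹ * (γ : SL(2, ℝ)) * σb) 1 0 = c}

/-- The representatives `d ∈ [0, c)` modulo `c` such that `σa⁻¹ Γ σb` contains a matrix with lower
row `(c, d)`. -/
def residues (Γ : Subgroup SL(2, ℝ)) (σa σb : SL(2, ℝ)) (c : ℝ) : Set ℝ :=
  {d | (0 ≤ d ∧ d < c) ∧ ∃ γ : Γ, (σa⁻¹ * (γ : SL(2, ℝ)) * σb) 1 0 = c ∧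
    (σa⁻¹ * (γ : SL(2, ℝ)) * σb) 1 1 = d}

/-- An element `γ ∈ Γ` such that `ω_(c,d) = σa⁻¹ γ σb` has lower row `(c, d)`. -/
def omegaElt {Γ : Subgroup SL(2, ℝ)} {σa σb : SL(2, ℝ)} {c : ℝ}
    (d : residues Γ σa σb c) : Γ :=
  d.2.2.choose

/-- The Kloosterman sum `∑_{d mod c} e(r d / c) η(ω_(c,d)⁻¹)`, where `η(ω⁻¹) = χ(γ⁻¹)` for
`ω = σa⁻¹ γ σb`. -/
def kloosterman {Γ : Subgroup SL(2, ℝ)} (χ : Γ →* (V →L[ℂ] V)) (σa σb : SL(2, ℝ))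
    (r c : ℝ) : V →L[ℂ] V :=
  ∑ᶠ d : residues Γ σa σb c, e (r * d / c) • χ (omegaElt d)⁻¹

/-- The coefficient
`φ_ab(s) = π^(1/2) Γ(s - 1/2) / Γ(s) P_b (∑_{c > 0} c^(-2s) S_ab(0, c, χ)) P_a`. -/
def phi [FiniteDimensional ℂ V] {Γ : Subgroup SL(2, ℝ)} (χ : Γ →* (V →L[ℂ] V))
    (a b : OnePoint ℝ) (σa σb : SL(2, ℝ)) (s : ℂ) : V →L[ℂ] V :=
  ((Real.sqrt Real.pi : ℂ) * Complex.Gamma (s - 1 / 2) / Complex.Gamma s) •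
    (proj χ b ∘L (∑' c : moduli Γ σa σb, ((c : ℝ) : ℂ) ^ (-2 * s) • kloosterman χ σa σb 0 c) ∘L
      proj χ a)

open Classical in
/-- The term `δ_ab y ^ s P_a`. -/
def mainTerm [FiniteDimensional ℂ V] {Γ : Subgroup SL(2, ℝ)} (χ : Γ →* (V →L[ℂ] V))
    (a b : OnePoint ℝ) (y : ℝ) (s : ℂ) : V →L[ℂ] V :=
  if a = b then (y : ℂ) ^ s • proj χ a else 0

/-- `β < 2π |r|` for each of the nonzero `r ∈ ℝ` such that `e(r)` is equal to `1` or to an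
eigenvalue of `χ(γ_b)`, where `γ_b = σb n(1) σb⁻¹` generates `Γ_b` up to sign. In terms of the
eigenvalues `e(ν)`, `0 ≤ ν < 1`, the smallest of the `|r|` is the minimum of `1` and of all
`ν` and `1 - ν` with `ν ≠ 0`. -/
def DecayRate {Γ : Subgroup SL(2, ℝ)} (χ : Γ →* (V →L[ℂ] V)) (σb : SL(2, ℝ)) (β : ℝ) : Prop :=
  β < 2 * Real.pi ∧
  ∀ γ : Γ, (γ : SL(2, ℝ)) = σb * unip 1 * σb⁻¹ → ∀ ν : ℝ, 0 < ν → ν < 1 →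
    Module.End.HasEigenvalue (χ γ : V →ₗ[ℂ] V) (e ν) →
      β < 2 * Real.pi * ν ∧ β < 2 * Real.pi * (1 - ν)

end TwistedEisenstein

end

/-! Polynomial growth of χ. Reduction theory turns the growth of χ into a count of steps. Seen from
a point g of SL(2, ℝ), nontrivial elements of Γ that look close to 1 commute with each other
(`commute_of_dev_le`, the commutator argument of Zassenhaus and Margulis). By finite area and a
packing argument, the points from which no element other than ±1 looks small are bounded modulo Γ
(`exists_bound_of_thick`). Hyperbolic elements cannot be arbitrarily short (`exists_trace_gap`), and
there are finitely many cusps modulo Γ (`exists_finite_cusps`). So every g is within bounded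
distance of some ρ ∈ Γ, or near a cusp ρa with a in a fixed finite set. Any γ is a product of O(log
μ(γ)) matrices of bounded size (`hasLength_log`). Along this path, each change from ρ to ρ' costs a
bounded factor ‖χ(ρ⁻¹ρ')‖: either ρ⁻¹ρ' runs over a finite set, or it is determined up to the
stabilizer of a cusp, where χ is unitary (`exists_step_bound`). A constant to the power O(log μ(γ))
is a power of μ(γ).

Expansion at a cusp. By the Bruhat decomposition, the cosets Γ_a γ for which σ_a⁻¹γσ_b has c ≠ 0
correspond to a lower row (c, d) with 0 ≤ d < c and an integer n (`rowCoset`). At most one coset has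
c = 0, and it gives the main term. The other terms are y^s c^(-2s) |z + d/c + n|^(-2s) χ(γ_b)^(-n)
χ(ω⁻¹) P_a. After diagonalizing χ(γ_b), the sum over n is the Mellin transform of a theta function
with a character. Poisson summation splits off its zero frequency, a multiple of y^(1-2s) P_b, and
every other frequency r contributes O(exp(-2π|r|θy)) for each θ < 1, uniformly in x
(`exists_norm_tsum_kernel_sub_le`, `exists_norm_kernelDefect_le`). The zero frequencies add up to
φ_ab(s) y^(1-s).

Summation over rows. Shimizu's lemma makes the fractions d/c of distinct rows at least 1/(cc')
apart, so that O(X²) rows have c ≤ X (`card_lowerRow_le`). The growth of χ gives ‖χ(ω⁻¹)‖ =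
O(c^(2(σ₀-1))) (`exists_norm_omegaElt_inv_le`). Hence the rows are dominated by ∑ c^(-2(σ-σ₀+1)),
which converges for σ > σ₀. The growth bound (2) uses the same series with a crude estimate of the
sum over n. -/

noncomputable section

/-! ### Matrix norms, commutators, and small elements of a discrete group -/

namespace TwistedEisenstein

/-- The Hilbert–Schmidt (Frobenius) norm of a real `2 × 2` matrix. -/
def hs (M : Matrix (Fin 2) (Fin 2) ℝ) : ℝ :=
  √(M 0 0 ^ 2 + M 0 1 ^ 2 + M 1 0 ^ 2 + M 1 1 ^ 2)

section
attribute [local instance] Matrix.frobeniusNormedRing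

lemma hs_eq_norm (M : Matrix (Fin 2) (Fin 2) ℝ) : hs M = ‖M‖ := by
  rw [Matrix.frobenius_norm_def, hs, Real.sqrt_eq_rpow]
  simp [Fin.sum_univ_two]
  ring_nf

lemma hs_mul_le (M N : Matrix (Fin 2) (Fin 2) ℝ) : hs (M * N) ≤ hs M * hs N := by
  simp only [hs_eq_norm]; exact Matrix.frobenius_norm_mul M N

lemma hs_add_le (M N : Matrix (Fin 2) (Fin 2) ℝ) : hs (M + N) ≤ hs M + hs N := by
  simp only [hs_eq_norm]; exact norm_add_le M N

lemma hs_sub_le (M N : Matrix (Fin 2) (Fin 2) ℝ) : hs (M - N) ≤ hs M + hs N := by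
  simp only [hs_eq_norm]; exact norm_sub_le M N

lemma hs_eq_zero {M : Matrix (Fin 2) (Fin 2) ℝ} : hs M = 0 ↔ M = 0 := by
  simp only [hs_eq_norm]; exact norm_eq_zero
end

lemma hs_nonneg (M : Matrix (Fin 2) (Fin 2) ℝ) : 0 ≤ hs M := Real.sqrt_nonneg _

lemma hs_sq (M : Matrix (Fin 2) (Fin 2) ℝ) :
    hs M ^ 2 = M 0 0 ^ 2 + M 0 1 ^ 2 + M 1 0 ^ 2 + M 1 1 ^ 2 :=
  Real.sq_sqrt (by positivity)

lemma mu_eq_hs_sq (g : SL(2, ℝ)) : mu g = hs g.1 ^ 2 := (hs_sq _).symm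

lemma det_eq (g : SL(2, ℝ)) : g 0 0 * g 1 1 - g 0 1 * g 1 0 = 1 := by
  have := g.det_coe; rwa [Matrix.det_fin_two] at this

lemma mul_apply_two (g h : SL(2, ℝ)) (i j : Fin 2) :
    (g * h) i j = g i 0 * h 0 j + g i 1 * h 1 j := by
  simp [Matrix.SpecialLinearGroup.coe_mul, Matrix.mul_apply, Fin.sum_univ_two]

lemma inv_apply_two (g : SL(2, ℝ)) :
    g⁻¹ 0 0 = g 1 1 ∧ g⁻¹ 0 1 = -g 0 1 ∧ g⁻¹ 1 0 = -g 1 0 ∧ g⁻¹ 1 1 = g 0 0 := by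
  simp [Matrix.SpecialLinearGroup.coe_inv, Matrix.adjugate_fin_two]

lemma SL_ext {g h : SL(2, ℝ)} (h00 : g 0 0 = h 0 0) (h01 : g 0 1 = h 0 1) (h10 : g 1 0 = h 1 0)
    (h11 : g 1 1 = h 1 1) : g = h := by
  ext i j; fin_cases i <;> fin_cases j <;> assumption

lemma mu_mul_le (g h : SL(2, ℝ)) : mu (g * h) ≤ mu g * mu h := by
  simp only [mu_eq_hs_sq, ← mul_pow, Matrix.SpecialLinearGroup.coe_mul]
  exact pow_le_pow_left₀ (hs_nonneg _) (hs_mul_le _ _) 2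

lemma mu_inv (g : SL(2, ℝ)) : mu g⁻¹ = mu g := by
  obtain ⟨h1, h2, h3, h4⟩ := inv_apply_two g
  rw [mu, mu, h1, h2, h3, h4]; ring

lemma two_le_mu (g : SL(2, ℝ)) : 2 ≤ mu g := by
  have := det_eq g
  rw [mu]; nlinarith [sq_nonneg (g 0 0 - g 1 1), sq_nonneg (g 0 1 + g 1 0)]

lemma mu_nonneg (g : SL(2, ℝ)) : 0 ≤ mu g := by linarith [two_le_mu g]

lemma mu_one : mu 1 = 2 := by norm_num [mu]

lemma mu_mul_mul_le (g h k : SL(2, ℝ)) : mu (g * h * k) ≤ mu g * mu h * mu k :=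
  (mu_mul_le _ _).trans (mul_le_mul_of_nonneg_right (mu_mul_le _ _) (mu_nonneg _))

lemma hs_inv (g : SL(2, ℝ)) : hs g⁻¹.1 = hs g.1 := by
  have := mu_inv g
  rw [mu_eq_hs_sq, mu_eq_hs_sq] at this
  exact (sq_eq_sq₀ (hs_nonneg _) (hs_nonneg _)).1 this

/-- The Frobenius distance of `g` to the identity. -/
def dev (g : SL(2, ℝ)) : ℝ := hs (g.1 - 1)

lemma dev_nonneg (g : SL(2, ℝ)) : 0 ≤ dev g := hs_nonneg _

lemma dev_sq (g : SL(2, ℝ)) :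
    dev g ^ 2 = (g 0 0 - 1) ^ 2 + g 0 1 ^ 2 + g 1 0 ^ 2 + (g 1 1 - 1) ^ 2 := by
  simp [dev, hs_sq]

lemma dev_pos {g : SL(2, ℝ)} (hg : g ≠ 1) : 0 < dev g := by
  refine (dev_nonneg g).lt_of_ne' fun h ↦ hg ?_
  rw [dev, hs_eq_zero, sub_eq_zero] at h
  exact Subtype.ext h

lemma hs_le_of_dev (g : SL(2, ℝ)) (h : dev g ≤ 1 / 8) : hs g.1 ≤ 1.6 := by
  have h1 : hs g.1 ≤ hs (g.1 - 1) + hs 1 := by simpa using hs_add_le (g.1 - 1) 1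
  have h2 : hs (1 : Matrix (Fin 2) (Fin 2) ℝ) ≤ 1.42 := by
    rw [hs]; apply Real.sqrt_le_iff.2; norm_num
  rw [dev] at h
  linarith

lemma mu_le_of_dev (g : SL(2, ℝ)) (h : dev g ≤ 1 / 8) : mu g ≤ 3 := by
  have := hs_le_of_dev g h
  rw [mu_eq_hs_sq]
  nlinarith [hs_nonneg g.1]

lemma ne_neg_one_of_dev {g : SL(2, ℝ)} (h : dev g ≤ 1 / 8) : g ≠ -1 := by
  rintro rfl
  have := dev_sq (-1)
  simp at this
  nlinarith [dev_nonneg (-1)]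

/-- Commutators of elements near the identity are much nearer to the identity. -/
lemma dev_commutator_lt {A B : SL(2, ℝ)} (hA : dev A ≤ 1 / 8) (hB : dev B ≤ 1 / 8) (hA1 : A ≠ 1) :
    dev (A * B * A⁻¹ * B⁻¹) < dev A := by
  have hAinv : A.1 * A⁻¹.1 = 1 := by rw [← Matrix.SpecialLinearGroup.coe_mul]; simp
  have hBinv : B.1 * B⁻¹.1 = 1 := by rw [← Matrix.SpecialLinearGroup.coe_mul]; simp
  have key : (A * B * A⁻¹ * B⁻¹).1 - 1
      = ((A.1 - 1) * (B.1 - 1) - (B.1 - 1) * (A.1 - 1)) * (A⁻¹.1 * B⁻¹.1) := by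
    have e1 : ((A.1 - 1) * (B.1 - 1) - (B.1 - 1) * (A.1 - 1)) = A.1 * B.1 - B.1 * A.1 := by
      noncomm_ring
    have e2 : B.1 * A.1 * (A⁻¹.1 * B⁻¹.1) = 1 := by
      rw [Matrix.mul_assoc, ← Matrix.mul_assoc A.1, hAinv, Matrix.one_mul, hBinv]
    rw [e1, sub_mul, e2]
    simp [Matrix.SpecialLinearGroup.coe_mul, Matrix.mul_assoc]
  have h1 : hs ((A.1 - 1) * (B.1 - 1) - (B.1 - 1) * (A.1 - 1)) ≤ 2 * (dev A * dev B) := by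
    refine (hs_sub_le _ _).trans ?_
    have a1 := hs_mul_le (A.1 - 1) (B.1 - 1)
    have a2 := hs_mul_le (B.1 - 1) (A.1 - 1)
    rw [dev, dev]; linarith [mul_comm (hs (A.1 - 1)) (hs (B.1 - 1))]
  have h2 : hs (A⁻¹.1 * B⁻¹.1) ≤ 1.6 * 1.6 := by
    refine (hs_mul_le _ _).trans ?_
    rw [hs_inv, hs_inv]
    exact mul_le_mul (hs_le_of_dev A hA) (hs_le_of_dev B hB) (hs_nonneg _) (by norm_num)
  have h3 : dev (A * B * A⁻¹ * B⁻¹) ≤ 2 * (dev A * dev B) * (1.6 * 1.6) := by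
    rw [dev, key]
    exact (hs_mul_le _ _).trans (mul_le_mul h1 h2 (hs_nonneg _)
      (by have := dev_nonneg A; have := dev_nonneg B; positivity))
  have h4 := dev_pos hA1
  -- The contraction factor is 2 · 1.6² · dev B ≤ 5.12 / 8 < 1.
  nlinarith [dev_nonneg B]

/-- A matrix commuting with a nonscalar one has a proportional traceless part. -/
lemma exists_of_commute {M N : SL(2, ℝ)} (hMN : Commute M N) (h1 : M ≠ 1) (h2 : M ≠ -1) :
    ∃ t : ℝ, N 0 1 = t * M 0 1 ∧ N 1 0 = t * M 1 0 ∧ N 0 0 - N 1 1 = t * (M 0 0 - M 1 1) := by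
  have e : ∀ i j, (M * N) i j = (N * M) i j := fun i j ↦ by rw [hMN.eq]
  have e00 := e 0 0
  have e01 := e 0 1
  have e10 := e 1 0
  simp only [mul_apply_two] at e00 e01 e10
  by_cases hb : M 0 1 = 0
  · by_cases hc : M 1 0 = 0
    · have had : M 0 0 - M 1 1 ≠ 0 := by
        intro had
        have hd := det_eq M
        have had' : M 0 0 = M 1 1 := by linarith
        rw [hb, had'] at hd
        have : (M 1 1 - 1) * (M 1 1 + 1) = 0 := by linarith
        rcases mul_eq_zero.1 this with h | h
        · exact h1 (SL_ext (by simp; linarith) (by simp [hb]) (by simp [hc]) (by simp; linarith))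
        · exact h2 (SL_ext (by simp; linarith) (by simp [hb]) (by simp [hc]) (by simp; linarith))
      refine ⟨(N 0 0 - N 1 1) / (M 0 0 - M 1 1), ?_, ?_, by field_simp⟩
      · have : N 0 1 * (M 0 0 - M 1 1) = 0 := by rw [hb] at e01; linarith
        simp [hb, (mul_eq_zero.1 this).resolve_right had]
      · have : N 1 0 * (M 0 0 - M 1 1) = 0 := by rw [hc] at e10; linarith
        simp [hc, (mul_eq_zero.1 this).resolve_right had]
    · refine ⟨N 1 0 / M 1 0, ?_, by field_simp, ?_⟩ <;> field_simp <;> linarith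
  · refine ⟨N 0 1 / M 0 1, by field_simp, ?_, ?_⟩ <;> field_simp <;> linarith

/-- The centralizer of a nonscalar matrix M lies in the span of 1 and the traceless part of M, and
this span is commutative. -/
lemma commute_trans {M N P : SL(2, ℝ)} (h1 : M ≠ 1) (h2 : M ≠ -1) (hN : Commute M N)
    (hP : Commute M P) : Commute N P := by
  obtain ⟨t, a1, a2, a3⟩ := exists_of_commute hN h1 h2
  obtain ⟨u, b1, b2, b3⟩ := exists_of_commute hP h1 h2
  have a4 : N 0 0 = N 1 1 + t * (M 0 0 - M 1 1) := by linarith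
  have b4 : P 0 0 = P 1 1 + u * (M 0 0 - M 1 1) := by linarith
  change N * P = P * N
  apply SL_ext <;> simp only [mul_apply_two, a1, a2, b1, b2, a4, b4] <;> ring

/-- Sublevel sets of `mu` are compact and a discrete subgroup is closed. This is how discreteness
enters: it yields minimal elements and finite sets of representatives. -/
lemma finite_mu_le (Γ : Subgroup SL(2, ℝ)) [DiscreteTopology Γ] (R : ℝ) :
    {γ : SL(2, ℝ) | γ ∈ Γ ∧ mu γ ≤ R}.Finite := by
  have hK : IsCompact {g : SL(2, ℝ) | mu g ≤ R} := by
    let : SeminormedAddCommGroup (Matrix (Fin 2) (Fin 2) ℝ) := Matrix.seminormedAddCommGroup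
    have : ProperSpace (Matrix (Fin 2) (Fin 2) ℝ) := pi_properSpace
    have hc : IsCompact (Metric.closedBall (0 : Matrix (Fin 2) (Fin 2) ℝ) √R) :=
      ProperSpace.isCompact_closedBall _ _
    have := Matrix.SpecialLinearGroup.isClosedEmbedding_val.isCompact_preimage hc
    refine this.of_isClosed_subset (isClosed_le (by unfold mu; fun_prop) continuous_const) ?_
    intro (g : SL(2, ℝ)) hg
    replace hg : mu g ≤ R := hg
    rw [mu] at hg
    change g.1 ∈ Metric.closedBall (0 : Matrix (Fin 2) (Fin 2) ℝ) √R
    rw [mem_closedBall_zero_iff, Matrix.norm_le_iff (Real.sqrt_nonneg _)]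
    intro i j
    apply Real.le_sqrt_of_sq_le
    rw [Real.norm_eq_abs, sq_abs]
    fin_cases i <;> fin_cases j <;> simp only [Fin.zero_eta, Fin.mk_one, Fin.isValue] <;>
      nlinarith [sq_nonneg (g 0 0), sq_nonneg (g 0 1), sq_nonneg (g 1 0), sq_nonneg (g 1 1)]
  have hcl : IsClosed (Γ : Set SL(2, ℝ)) := Subgroup.isClosed_of_discrete
  have hc2 : IsCompact ((Γ : Set SL(2, ℝ)) ∩ {g | mu g ≤ R}) := hK.inter_left hcl
  have hd : IsDiscrete (Γ : Set SL(2, ℝ)) := isDiscrete_iff_discreteTopology.mpr ‹_›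
  exact hc2.finite (hd.mono Set.inter_subset_left)

lemma mu_conj_le (g h : SL(2, ℝ)) : mu (g * h * g⁻¹) ≤ mu g ^ 2 * mu h := by
  have := mu_mul_mul_le g h g⁻¹
  rw [mu_inv] at this
  linarith

lemma finite_conj_mu_le (Γ : Subgroup SL(2, ℝ)) [DiscreteTopology Γ] (g : SL(2, ℝ)) (R : ℝ) :
    {γ : SL(2, ℝ) | γ ∈ Γ ∧ mu (g⁻¹ * γ * g) ≤ R}.Finite := by
  refine (finite_mu_le Γ (mu g ^ 2 * R)).subset fun γ ⟨h1, h2⟩ ↦ ⟨h1, ?_⟩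
  have := mu_conj_le g (g⁻¹ * γ * g)
  rw [show g * (g⁻¹ * γ * g) * g⁻¹ = γ by group] at this
  exact this.trans (mul_le_mul_of_nonneg_left h2 (by positivity))

lemma conj_ne_one {g γ : SL(2, ℝ)} (h : γ ≠ 1) : g⁻¹ * γ * g ≠ 1 := by
  intro h'
  apply h
  have := congrArg (fun x ↦ g * x * g⁻¹) h'
  simpa [mul_assoc] using this

/-- In a discrete group, the nontrivial elements that are small as seen from `g` commute. -/
lemma commute_of_dev_le (Γ : Subgroup SL(2, ℝ)) [DiscreteTopology Γ] (g : SL(2, ℝ))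
    {γ₁ γ₂ : SL(2, ℝ)} (h₁ : γ₁ ∈ Γ) (h₂ : γ₂ ∈ Γ) (n₁ : γ₁ ≠ 1) (d₁ : dev (g⁻¹ * γ₁ * g) ≤ 1 / 8)
    (d₂ : dev (g⁻¹ * γ₂ * g) ≤ 1 / 8) : Commute γ₁ γ₂ := by
  let S : Set SL(2, ℝ) := {γ | γ ∈ Γ ∧ γ ≠ 1 ∧ dev (g⁻¹ * γ * g) ≤ 1 / 8}
  have hS : S.Finite := (finite_conj_mu_le Γ g 3).subset fun γ h ↦ ⟨h.1, mu_le_of_dev _ h.2.2⟩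
  -- The commutator of the smallest element γ₀ with any other small element is smaller still, hence
  -- trivial. So γ₀ commutes with both given elements, and these commute with each other because γ₀
  -- ≠ ±1.
  obtain ⟨γ₀, h₀, hmin⟩ := hS.exists_minimalFor (fun γ ↦ dev (g⁻¹ * γ * g)) S ⟨γ₁, h₁, n₁, d₁⟩
  have hcomm : ∀ γ ∈ Γ, dev (g⁻¹ * γ * g) ≤ 1 / 8 → Commute γ₀ γ := by
    intro γ hγ hd
    have hlt := dev_commutator_lt h₀.2.2 hd (conj_ne_one h₀.2.1)
    rw [show g⁻¹ * γ₀ * g * (g⁻¹ * γ * g) * (g⁻¹ * γ₀ * g)⁻¹ * (g⁻¹ * γ * g)⁻¹ =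
      g⁻¹ * (γ₀ * γ * γ₀⁻¹ * γ⁻¹) * g by group] at hlt
    by_contra hne
    have hmem : γ₀ * γ * γ₀⁻¹ * γ⁻¹ ∈ S := by
      refine ⟨Γ.mul_mem (Γ.mul_mem (Γ.mul_mem h₀.1 hγ) (Γ.inv_mem h₀.1)) (Γ.inv_mem hγ), ?_,
        hlt.le.trans h₀.2.2⟩
      intro h
      apply hne
      have := congrArg (fun x ↦ x * γ * γ₀) h
      simpa [mul_assoc, commute_iff_eq] using this
    exact absurd (hmin hmem hlt.le) (not_le.2 hlt)
  have hne : γ₀ ≠ -1 := by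
    rintro h
    apply ne_neg_one_of_dev h₀.2.2
    rw [h]; simp
  exact commute_trans h₀.2.1 hne (hcomm γ₁ h₁ d₁) (hcomm γ₂ h₂ d₂)

/-! ### Traces and centralizers -/

/-- The trace of an element of `SL(2, ℝ)`. -/
def tr (g : SL(2, ℝ)) : ℝ := g 0 0 + g 1 1

lemma tr_conj (g h : SL(2, ℝ)) : tr (g⁻¹ * h * g) = tr h := by
  obtain ⟨h1, h2, h3, h4⟩ := inv_apply_two g
  simp only [tr, mul_apply_two, h1, h2, h3, h4]
  linear_combination (h 0 0 + h 1 1) * det_eq g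

lemma tr_neg (g : SL(2, ℝ)) : tr (-g) = -tr g := by
  simp [tr]; ring

/-- Elements of trace at least `2` satisfy `dev g ^ 2 ≤ mu g - 2`. -/
lemma dev_sq_le (g : SL(2, ℝ)) (h : 2 ≤ tr g) : dev g ^ 2 ≤ mu g - 2 := by
  rw [dev_sq, mu]; rw [tr] at h; nlinarith

lemma tr_sq_le (g : SL(2, ℝ)) : tr g ^ 2 ≤ mu g + 2 := by
  have := det_eq g
  rw [tr, mu]; nlinarith [sq_nonneg (g 0 1 - g 1 0)]

lemma tr_sq_sub_four (g : SL(2, ℝ)) : tr g ^ 2 - 4 = (g 0 0 - g 1 1) ^ 2 + 4 * (g 0 1 * g 1 0) := by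
  rw [tr]; linear_combination 4 * det_eq g

lemma tr_sq_of_commute {M N : SL(2, ℝ)} {t : ℝ} (h1 : N 0 1 = t * M 0 1) (h2 : N 1 0 = t * M 1 0)
    (h3 : N 0 0 - N 1 1 = t * (M 0 0 - M 1 1)) : tr N ^ 2 - 4 = t ^ 2 * (tr M ^ 2 - 4) := by
  rw [tr_sq_sub_four, tr_sq_sub_four, h1, h2, h3]; ring

/-- In a centralizer the traceless parts are proportional, with ratio t satisfying t² = (tr N² - 4)
/ (tr M² - 4) ≤ 1. So only finitely many hyperbolic elements of a discrete centralizer have trace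
below a given one, and a minimal trace exists. -/
lemma mu_le_of_commute {M N : SL(2, ℝ)} (hMN : Commute M N) (hM : 2 < tr M) (hN : 2 < tr N)
    (hle : tr N ≤ tr M) : mu N ≤ mu M := by
  obtain ⟨t, h1, h2, h3⟩ := exists_of_commute hMN (by rintro rfl; norm_num [tr] at hM)
    (by rintro rfl; norm_num [tr] at hM)
  have h4 := tr_sq_of_commute h1 h2 h3
  have h5 : t ^ 2 ≤ 1 := by
    by_contra! h
    nlinarith [mul_pos (sub_pos.2 h) (show 0 < tr M ^ 2 - 4 by nlinarith)]
  have e : ∀ g : SL(2, ℝ), mu g = (tr g ^ 2 + (g 0 0 - g 1 1) ^ 2) / 2 + g 0 1 ^ 2 + g 1 0 ^ 2 := by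
    intro g; rw [tr, mu]; ring
  rw [e, e, h1, h2, h3]
  have a1 : tr N ^ 2 ≤ tr M ^ 2 := by nlinarith
  simp only [mul_pow]
  nlinarith [mul_le_mul_of_nonneg_right h5 (sq_nonneg (M 0 1)),
    mul_le_mul_of_nonneg_right h5 (sq_nonneg (M 1 0)),
    mul_le_mul_of_nonneg_right h5 (sq_nonneg (M 0 0 - M 1 1))]

end TwistedEisenstein
end

/-! ### Displacement on ℍ, and boundedness of the thick part -/

noncomputable section

namespace TwistedEisenstein

lemma smul_coe (g : SL(2, ℝ)) (z : ℍ) :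
    ((g • z : ℍ) : ℂ) = (g 0 0 * z + g 0 1) / (g 1 0 * z + g 1 1) := by
  rw [UpperHalfPlane.coe_specialLinearGroup_apply]; simp

lemma smul_im (g : SL(2, ℝ)) (z : ℍ) :
    (g • z).im = z.im / ((g 1 0 * z.re + g 1 1) ^ 2 + (g 1 0 * z.im) ^ 2) := by
  have := UpperHalfPlane.im_smul_eq_div_normSq (Matrix.SpecialLinearGroup.mapGL ℝ g) z
  rw [MulAction.compHom_smul_def, this]
  simp [UpperHalfPlane.denom, Complex.normSq_apply, sq]

lemma SL_neg_one_smul (z : ℍ) : (-1 : SL(2, ℝ)) • z = z := by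
  ext1; rw [smul_coe]; simp

/-- The hyperbolic distance of `g • i` to `i`. -/
lemma mu_eq_cosh (g : SL(2, ℝ)) : mu g = 2 * Real.cosh (dist (g • UpperHalfPlane.I) UpperHalfPlane.I) := by
  have hd := det_eq g
  have hpos : 0 < g 1 0 ^ 2 + g 1 1 ^ 2 := by
    by_contra! h
    have h1 : g 1 0 = 0 := by nlinarith [sq_nonneg (g 1 0), sq_nonneg (g 1 1)]
    have h2 : g 1 1 = 0 := by nlinarith [sq_nonneg (g 1 0), sq_nonneg (g 1 1)]
    simp [h1, h2] at hd
  have him : (g • UpperHalfPlane.I).im = 1 / (g 1 0 ^ 2 + g 1 1 ^ 2) := by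
    rw [smul_im]; simp [add_comm]
  have hre : (g • UpperHalfPlane.I).re
      = (g 0 0 * g 1 0 + g 0 1 * g 1 1) / (g 1 0 ^ 2 + g 1 1 ^ 2) := by
    rw [← UpperHalfPlane.coe_re, smul_coe, Complex.div_re]
    simp [Complex.normSq_apply]
    have hne : g 1 1 ^ 2 + g 1 0 ^ 2 ≠ 0 := by rw [add_comm]; exact hpos.ne'
    field_simp
    ring
  rw [UpperHalfPlane.cosh_dist, Complex.dist_eq_re_im, Real.sq_sqrt (by positivity)]
  simp only [UpperHalfPlane.coe_re, UpperHalfPlane.coe_im, him, hre, UpperHalfPlane.I_re,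
    UpperHalfPlane.I_im]
  rw [mu]
  field_simp
  have h1 : (g 0 0 * g 1 0 + g 0 1 * g 1 1) ^ 2 + 1
    = (g 0 0 ^ 2 + g 0 1 ^ 2) * (g 1 0 ^ 2 + g 1 1 ^ 2) := by
    linear_combination (-(g 0 0 * g 1 1 - g 0 1 * g 1 0) - 1) * hd
  linear_combination -h1

/-- Dictionary between sizes seen from a matrix and displacements of a point of ℍ. -/
lemma mu_conj_eq_cosh (z : ℍ) (γ : SL(2, ℝ)) :
    mu (z.toSL2R⁻¹ * γ * z.toSL2R) = 2 * Real.cosh (dist (γ • z) z) := by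
  rw [mu_eq_cosh, ← dist_smul z.toSL2R, ← mul_smul]
  simp [← mul_assoc, mul_smul]

/-- An element of a discrete torsion-free group is not elliptic. -/
lemma two_le_abs_tr {Γ : Subgroup SL(2, ℝ)} (hΓ : IsCuspidalLattice Γ) {γ : SL(2, ℝ)} (hγ : γ ∈ Γ) :
    2 ≤ |tr γ| := by
  have := hΓ.discrete
  by_contra! hlt
  have hell : (slToGL γ).IsElliptic := by
    change Matrix.discr _ < 0
    rw [Matrix.discr_fin_two, Matrix.trace_fin_two]
    simp only [Matrix.SpecialLinearGroup.coe_GL_coe_matrix, Matrix.SpecialLinearGroup.det_coe]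
    change tr γ ^ 2 - 4 * 1 < 0
    have := sq_lt_sq' (abs_lt.1 hlt).1 (abs_lt.1 hlt).2
    linarith
  obtain ⟨z, hz⟩ : ∃ z : ℍ, γ • z = z := by
    refine ⟨UpperHalfPlane.fixedPt _ hell, ?_⟩
    exact (UpperHalfPlane.gl_smul_eq_self_iff_eq_fixedPt (by simp) hell).2 rfl
  have hpow : ∀ n : ℕ, (γ ^ n) • z = z := by
    intro n
    induction n with
    | zero => simp
    | succ n ih => rw [pow_succ, mul_smul, hz, ih]
  -- All powers of γ fix z, so seen from z they have the minimal size 2. By discreteness two of them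
  -- coincide, and γ has finite order.
  have hfin := finite_conj_mu_le Γ z.toSL2R 2
  have hmaps : ∀ n : ℕ, γ ^ n ∈ {γ : SL(2, ℝ) | γ ∈ Γ ∧ mu (z.toSL2R⁻¹ * γ * z.toSL2R) ≤ 2} := by
    intro n
    refine ⟨Γ.pow_mem hγ n, ?_⟩
    rw [mu_conj_eq_cosh, hpow]; simp
  obtain ⟨m, n, hmn, he⟩ : ∃ m n : ℕ, m < n ∧ γ ^ m = γ ^ n := by
    have hninj : ¬ Function.Injective (fun n : ℕ ↦ γ ^ n) := fun hinj ↦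
      Set.infinite_of_injective_forall_mem hinj hmaps hfin
    simp only [Function.Injective, not_forall] at hninj
    obtain ⟨m, n, he, hne⟩ := hninj
    rcases lt_or_gt_of_ne hne with h | h
    · exact ⟨m, n, h, he⟩
    · exact ⟨n, m, h, he.symm⟩
  have h1 : γ ^ (n - m) = 1 := by
    rw [pow_sub _ hmn.le, ← he]; simp
  rcases hΓ.torsion_free γ hγ _ (Nat.sub_pos_of_lt hmn) (Or.inl h1) with h | h
  · rw [h] at hlt; norm_num [tr] at hlt
  · rw [h] at hlt; norm_num [tr] at hlt

lemma countable_of_discrete (Γ : Subgroup SL(2, ℝ)) [DiscreteTopology Γ] :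
    (Γ : Set SL(2, ℝ)).Countable := by
  refine (Set.countable_iUnion fun n : ℕ ↦ (finite_mu_le Γ n).countable).mono fun γ hγ ↦ ?_
  obtain ⟨n, hn⟩ := exists_nat_ge (mu γ)
  exact Set.mem_iUnion.2 ⟨n, hγ, hn⟩

open MeasureTheory in
lemma volume_smul_SL (g : SL(2, ℝ)) (s : Set ℍ) :
    volume ((fun z ↦ g • z) '' s) = volume s := by
  have := measure_smul (volume : Measure ℍ) (slToGL g) s
  rw [← this]
  rfl

open MeasureTheory in
/-- A measurable set that injects into `Γ \ ℍ` has at most the area of a fundamental set. -/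
lemma volume_le_of_injOn {Γ : Subgroup SL(2, ℝ)} [DiscreteTopology Γ] {R B : Set ℍ}
    (hRm : MeasurableSet R) (hR : ∀ z : ℍ, ∃! w : ℍ, w ∈ R ∧ ∃ γ ∈ Γ, γ • z = w)
    (hBm : MeasurableSet B) (hB : ∀ z ∈ B, ∀ γ ∈ Γ, γ • z ∈ B → γ • z = z) :
    volume B ≤ volume R := by
  obtain ⟨f, hf⟩ : ∃ f : ℕ → SL(2, ℝ), (Γ : Set SL(2, ℝ)) = Set.range f :=
    (countable_of_discrete Γ).exists_eq_range ⟨1, Γ.one_mem⟩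
  have hfΓ : ∀ n, f n ∈ Γ := fun n ↦ by
    have : f n ∈ (Γ : Set SL(2, ℝ)) := by rw [hf]; exact ⟨n, rfl⟩
    exact this
  have hcont : ∀ n, Measurable (fun z : ℍ ↦ f n • z) := fun n ↦ (continuous_const_smul (f n)).measurable
  -- The n-th piece of B is moved into R by the n-th element of Γ. The pieces are made disjoint;
  -- their images remain disjoint because two points of B in one orbit are equal.
  let D : ℕ → Set ℍ := fun n ↦ B ∩ (fun z ↦ f n • z) ⁻¹' R
  have hDm : ∀ n, MeasurableSet (D n) := fun n ↦ hBm.inter (hcont n hRm)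
  have hBD : B = ⋃ n, disjointed D n := by
    rw [iUnion_disjointed]
    refine Set.Subset.antisymm (fun z hz ↦ ?_) (Set.iUnion_subset fun n ↦ Set.inter_subset_left)
    obtain ⟨w, ⟨hw, γ, hγ, rfl⟩, -⟩ := hR z
    have : γ ∈ (Γ : Set SL(2, ℝ)) := hγ
    rw [hf] at this
    obtain ⟨n, rfl⟩ := this
    exact Set.mem_iUnion.2 ⟨n, hz, hw⟩
  have hdm : ∀ n, MeasurableSet (disjointed D n) := fun n ↦ MeasurableSet.disjointed hDm n
  have himm : ∀ n, MeasurableSet ((fun z ↦ f n • z) '' disjointed D n) := by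
    intro n
    have : (fun z : ℍ ↦ f n • z) '' disjointed D n = (fun z ↦ (f n)⁻¹ • z) ⁻¹' disjointed D n := by
      ext z; constructor
      · rintro ⟨w, hw, rfl⟩; simpa using hw
      · intro h; exact ⟨(f n)⁻¹ • z, h, by simp⟩
    rw [this]
    exact (continuous_const_smul (f n)⁻¹).measurable (hdm n)
  calc volume B = ∑' n, volume (disjointed D n) := by
        conv_lhs => rw [hBD]
        exact measure_iUnion (disjoint_disjointed D) hdm
    _ = ∑' n, volume ((fun z ↦ f n • z) '' disjointed D n) := by
        simp_rw [volume_smul_SL]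
    _ = volume (⋃ n, (fun z ↦ f n • z) '' disjointed D n) := by
        refine (measure_iUnion ?_ himm).symm
        intro m n hmn
        refine Set.disjoint_left.2 ?_
        rintro _ ⟨z, hz, rfl⟩ ⟨w, hw, he⟩
        have hz' := disjointed_subset D m hz
        have hw' := disjointed_subset D n hw
        have e1 : ((f n)⁻¹ * f m) • z = w := by
          rw [mul_smul]; simp only at he; rw [← he]; simp
        have e2 : w = z := by
          rw [← e1]
          exact hB z hz'.1 _ (Γ.mul_mem (Γ.inv_mem (hfΓ n)) (hfΓ m)) (by rw [e1]; exact hw'.1)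
        subst e2
        exact Set.disjoint_left.1 (disjoint_disjointed D hmn) hz hw
    _ ≤ volume R := by
        refine measure_mono (Set.iUnion_subset fun n ↦ ?_)
        rintro _ ⟨z, hz, rfl⟩
        exact (disjointed_subset D n hz).2

open MeasureTheory in
lemma volume_ball_eq (z : ℍ) (r : ℝ) :
    volume (Metric.ball z r) = volume (Metric.ball UpperHalfPlane.I r) := by
  rw [← volume_smul_SL z.toSL2R (Metric.ball UpperHalfPlane.I r)]
  congr 1
  have := Metric.smul_ball z.toSL2R UpperHalfPlane.I r
  rw [UpperHalfPlane.toSL2R_smul_I] at this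
  rw [← this]; rfl

open MeasureTheory in
lemma volume_ball_pos {r : ℝ} (hr : 0 < r) : 0 < volume (Metric.ball UpperHalfPlane.I r) := by
  rw [UpperHalfPlane.volume_eq_lintegral]
  have hopen : IsOpen ((↑) '' Metric.ball UpperHalfPlane.I r : Set ℂ) :=
    UpperHalfPlane.isOpenEmbedding_coe.isOpenMap _ Metric.isOpen_ball
  rw [setLIntegral_pos_iff (by fun_prop)]
  have hsub : ((↑) '' Metric.ball UpperHalfPlane.I r : Set ℂ) ⊆
      (Function.support fun z : ℂ ↦ (((1 / ‖z.im‖₊) ^ 2 : NNReal) : ENNReal)) := by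
    rintro _ ⟨w, -, rfl⟩
    simp [w.im_pos.ne']
  rw [Set.inter_eq_self_of_subset_right hsub]
  exact hopen.measure_pos _ ⟨_, UpperHalfPlane.I, Metric.mem_ball_self hr, rfl⟩

open MeasureTheory in
/-- The part of `Γ \ ℍ` where the injectivity radius is bounded below is bounded. -/
lemma exists_bound_of_thick {Γ : Subgroup SL(2, ℝ)} (hΓ : IsCuspidalLattice Γ) {η : ℝ} (hη : 0 < η) :
    ∃ R : ℝ, ∀ g : SL(2, ℝ), (∀ γ ∈ Γ, γ ≠ 1 → γ ≠ -1 → 2 + η ≤ mu (g⁻¹ * γ * g)) →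
      ∃ ρ ∈ Γ, mu (ρ⁻¹ * g) ≤ R := by
  have := hΓ.discrete
  obtain ⟨R, hRm, hR, hRfin⟩ := hΓ.finite_covolume
  -- With this r, an element of size at least 2 + η displaces the point by at least 2r.
  obtain ⟨r, hr, hrη⟩ : ∃ r : ℝ, 0 < r ∧ 2 * Real.cosh (2 * r) < 2 + η := by
    have hc : Filter.Tendsto (fun r : ℝ ↦ 2 * Real.cosh (2 * r)) (nhdsWithin 0 (Set.Ioi 0))
        (nhds 2) := by
      have : Continuous fun r : ℝ ↦ 2 * Real.cosh (2 * r) := by fun_prop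
      have h := (this.tendsto 0).mono_left (nhdsWithin_le_nhds (s := Set.Ioi 0))
      simpa using h
    obtain ⟨r, h1, h2⟩ := ((hc.eventually_lt_const (by linarith : (2 : ℝ) < 2 + η)).and
      self_mem_nhdsWithin).exists
    exact ⟨r, h2, h1⟩
  let Th : Set ℍ := {z | ∀ γ ∈ Γ, γ ≠ 1 → γ ≠ -1 → 2 * r ≤ dist (γ • z) z}
  -- Packings of the thick part modulo Γ. The balls of radius r about their points inject into Γ \
  -- ℍ, so the finite area bounds the number of points.
  let Pk : Finset ℍ → Prop := fun F ↦ (∀ z ∈ F, z ∈ Th) ∧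
    ∀ z ∈ F, ∀ w ∈ F, z ≠ w → ∀ γ ∈ Γ, 2 * r ≤ dist (γ • z) w
  set v := volume (Metric.ball UpperHalfPlane.I r) with hv
  have hvpos : 0 < v := volume_ball_pos hr
  have hpack : ∀ F, Pk F → (F.card : ENNReal) * v ≤ volume R := by
    intro F hF
    have hB : volume (⋃ z ∈ F, Metric.ball z r) = F.card * v := by
      rw [measure_biUnion_finset]
      · simp [volume_ball_eq, hv]
      · intro z hz w hw hzw
        refine Metric.ball_disjoint_ball ?_
        have := hF.2 z hz w hw hzw 1 Γ.one_mem
        rw [one_smul] at this; linarith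
      · exact fun z _ ↦ Metric.isOpen_ball.measurableSet
    rw [← hB]
    refine volume_le_of_injOn hRm hR (Finset.measurableSet_biUnion _
      fun z _ ↦ Metric.isOpen_ball.measurableSet) ?_
    intro p hp γ hγ hγp
    simp only [Set.mem_iUnion, exists_prop] at hp hγp
    obtain ⟨z, hz, hpz⟩ := hp
    obtain ⟨w, hw, hpw⟩ := hγp
    have hd : dist (γ • z) w < 2 * r := by
      have h1 : dist (γ • z) (γ • p) = dist z p := dist_smul _ _ _
      rw [Metric.mem_ball] at hpz hpw
      have := dist_triangle (γ • z) (γ • p) w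
      rw [h1, dist_comm z p] at this
      linarith
    have hzw : z = w := by
      by_contra h
      exact absurd (hF.2 z hz w hw h γ hγ) (not_le.2 hd)
    subst hzw
    by_cases h1 : γ = 1
    · rw [h1, one_smul]
    by_cases h2 : γ = -1
    · rw [h2, SL_neg_one_smul]
    exact absurd (hF.1 z hz γ hγ h1 h2) (not_le.2 hd)
  obtain ⟨N, hN⟩ : ∃ N : ℕ, ∀ F, Pk F → F.card ≤ N := by
    obtain ⟨N, hN⟩ := ENNReal.exists_nat_mul_gt hvpos.ne' hRfin.ne
    refine ⟨N, fun F hF ↦ ?_⟩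
    by_contra! h
    have h1 : (N : ENNReal) * v ≤ F.card * v := by gcongr
    exact absurd (hN.trans_le (h1.trans (hpack F hF))) (lt_irrefl _)
  obtain ⟨F, hF, hmax⟩ : ∃ F, Pk F ∧ ∀ F', Pk F' → F'.card ≤ F.card := by
    classical
    have hex : ∃ n, ∃ F, Pk F ∧ F.card = n := ⟨0, ∅, ⟨by simp, by simp⟩, rfl⟩
    have hb : ∀ n, (∃ F, Pk F ∧ F.card = n) → n ≤ N := by
      rintro _ ⟨F, hF, rfl⟩; exact hN F hF
    obtain ⟨F, hF, hc⟩ := Nat.findGreatest_spec (P := fun n ↦ ∃ F, Pk F ∧ F.card = n)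
      (hb _ hex.choose_spec) hex.choose_spec
    refine ⟨F, hF, fun F' hF' ↦ ?_⟩
    rw [hc]
    exact Nat.le_findGreatest (hN F' hF') ⟨F', hF', rfl⟩
  obtain ⟨D, hD⟩ : ∃ D : ℝ, ∀ w ∈ F, dist w UpperHalfPlane.I ≤ D := by
    obtain ⟨D, hD⟩ := (F.image fun w ↦ dist w UpperHalfPlane.I).bddAbove
    exact ⟨D, fun w hw ↦ hD (by simpa using ⟨w, hw, rfl⟩)⟩
  refine ⟨2 * Real.cosh (2 * r + D), fun g hg ↦ ?_⟩
  classical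
  set z := g • UpperHalfPlane.I with hz
  have hzTh : z ∈ Th := by
    intro γ hγ h1 h2
    have h := hg γ hγ h1 h2
    rw [mu_eq_cosh, ← dist_smul g, ← mul_smul] at h
    rw [show g * (g⁻¹ * γ * g) = γ * g by group, mul_smul, ← hz] at h
    by_contra! hlt
    have := Real.cosh_lt_cosh.2 (show |dist (γ • z) z| < |2 * r| by
      rw [abs_of_nonneg dist_nonneg, abs_of_pos (by linarith)]; exact hlt)
    linarith
  -- Otherwise z could be added to the packing F of maximal cardinality.
  obtain ⟨w, hw, γ, hγ, hd⟩ : ∃ w ∈ F, ∃ γ ∈ Γ, dist (γ • z) w < 2 * r := by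
    by_contra! hcon
    have hzF : z ∉ F := fun h ↦ by
      have := hcon z h 1 Γ.one_mem
      rw [one_smul, dist_self] at this; linarith
    have hP : Pk (insert z F) := by
      refine ⟨?_, ?_⟩
      · intro p hp
        rcases Finset.mem_insert.1 hp with rfl | hp
        · exact hzTh
        · exact hF.1 p hp
      · intro p hp q hq hpq γ hγ
        rcases Finset.mem_insert.1 hp with rfl | hp <;> rcases Finset.mem_insert.1 hq with rfl | hq
        · exact absurd rfl hpq
        · exact hcon q hq γ hγ
        · have := hcon p hp γ⁻¹ (Γ.inv_mem hγ)
          rw [← dist_smul γ, smul_inv_smul, dist_comm] at this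
          exact this
        · exact hF.2 p hp q hq hpq γ hγ
    have := hmax _ hP
    rw [Finset.card_insert_of_notMem hzF] at this
    omega
  refine ⟨γ⁻¹, Γ.inv_mem hγ, ?_⟩
  rw [inv_inv, mu_eq_cosh, mul_smul, ← hz]
  have h1 : dist (γ • z) UpperHalfPlane.I ≤ 2 * r + D :=
    (dist_triangle _ w _).trans (add_le_add hd.le (hD w hw))
  have := Real.cosh_le_cosh.2 (show |dist (γ • z) UpperHalfPlane.I| ≤ |2 * r + D| by
      rw [abs_of_nonneg dist_nonneg]; exact h1.trans (le_abs_self _))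
  linarith

end TwistedEisenstein
end

/-! ### Trace gap, finiteness of cusps, and the thick–cuspidal alternative -/

noncomputable section

namespace TwistedEisenstein

/-- As Γ has no elliptic elements, the obstruction to a bounded position can be given trace at least
2 by a change of sign, and then smallness of `mu - 2` is closeness to 1 itself. -/
lemma exists_bound_of_dev_ge {Γ : Subgroup SL(2, ℝ)} (hΓ : IsCuspidalLattice Γ) {ε : ℝ} (hε : 0 < ε) : ∃ R : ℝ, ∀ g : SL(2, ℝ),
      (∀ γ ∈ Γ, γ ≠ 1 → 2 ≤ tr γ → mu (g⁻¹ * γ * g) < 2 + ε ^ 2 → dev (g⁻¹ * γ * g) < ε → False) →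
      ∃ ρ ∈ Γ, mu (ρ⁻¹ * g) ≤ R := by
  obtain ⟨R, hR⟩ := exists_bound_of_thick hΓ (η := ε ^ 2) (by positivity)
  refine ⟨R, fun g hg ↦ hR g fun γ hγ h1 h2 ↦ ?_⟩
  by_contra! hlt
  have key : ∀ β ∈ Γ, β ≠ 1 → 2 ≤ tr β → mu (g⁻¹ * β * g) < 2 + ε ^ 2 → False := by
    intro β hβ hβ1 htr hmu
    refine hg β hβ hβ1 htr hmu ?_
    have := dev_sq_le (g⁻¹ * β * g) (by rwa [tr_conj])
    exact lt_of_pow_lt_pow_left₀ 2 hε.le (by linarith)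
  rcases le_abs.1 (two_le_abs_tr hΓ hγ) with h | h
  · exact key γ hγ h1 h hlt
  · refine key (-γ) ?_ (fun h' ↦ h2 (by rw [← h', neg_neg])) (by rwa [tr_neg]) ?_
    · rw [← neg_one_mul]; exact Γ.mul_mem hΓ.neg_one_mem hγ
    · simpa [mu] using hlt

/-- An element of `Γ` which is small somewhere, but there not much larger than any element of its
centralizer, is conjugate to an element of a fixed bounded set. -/
lemma exists_conj_bounded {Γ : Subgroup SL(2, ℝ)} (hΓ : IsCuspidalLattice Γ) {ε : ℝ} (hε : 0 < ε)
    (hε' : ε ≤ 1 / 8) : ∃ R : ℝ, ∀ h : SL(2, ℝ), ∀ γ ∈ Γ, γ ≠ 1 → dev (h⁻¹ * γ * h) ≤ 1 / 8 →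
      (∀ β ∈ Γ, β ≠ 1 → Commute γ β → 2 ≤ tr β → ε ≤ dev (h⁻¹ * β * h)) →
      ∃ ρ ∈ Γ, mu (ρ⁻¹ * γ * ρ) ≤ R := by
  have := hΓ.discrete
  obtain ⟨R, hR⟩ := exists_bound_of_dev_ge hΓ hε
  -- Any element that is ε-small from h commutes with γ, which `hmin` excludes; so h is in bounded
  -- position. Changing the viewpoint from h to ρ costs R², and 3 bounds `mu` where `dev ≤ 1 / 8`.
  refine ⟨R ^ 2 * 3, fun h γ hγ hγ1 hd hmin ↦ ?_⟩
  obtain ⟨ρ, hρ, hρR⟩ := hR h (fun β hβ hβ1 htr hmu hdev ↦ by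
    refine absurd (hmin β hβ hβ1 ?_ htr) (not_le.2 hdev)
    exact commute_of_dev_le Γ h hγ hβ hγ1 hd (hdev.le.trans hε'))
  refine ⟨ρ, hρ, ?_⟩
  have h1 := mu_conj_le (ρ⁻¹ * h) (h⁻¹ * γ * h)
  rw [show ρ⁻¹ * h * (h⁻¹ * γ * h) * (ρ⁻¹ * h)⁻¹ = ρ⁻¹ * γ * ρ by group] at h1
  have h2 := mu_le_of_dev _ hd
  refine h1.trans (mul_le_mul ?_ h2 (mu_nonneg _) (by positivity))
  exact pow_le_pow_left₀ (mu_nonneg _) hρR 2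

lemma one_apply_two : (1 : SL(2, ℝ)) 0 0 = 1 ∧ (1 : SL(2, ℝ)) 0 1 = 0 ∧ (1 : SL(2, ℝ)) 1 0 = 0 ∧
    (1 : SL(2, ℝ)) 1 1 = 1 := by simp

/-- A hyperbolic matrix is conjugate to an upper triangular one. -/
lemma exists_conj_triangular (A : SL(2, ℝ)) (hA : 2 < tr A) (ε : ℝ) :
    ∃ h : SL(2, ℝ), (h⁻¹ * A * h) 1 0 = 0 ∧ 1 < (h⁻¹ * A * h) 0 0 ∧ (h⁻¹ * A * h) 0 1 = ε := by
  set D := tr A ^ 2 - 4 with hD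
  have hDpos : 0 < D := by nlinarith
  set l := (tr A + √D) / 2 with hl
  have hsq : √D ^ 2 = D := Real.sq_sqrt hDpos.le
  have hl1 : 1 < l := by have := Real.sqrt_pos.2 hDpos; rw [hl]; linarith
  have hchar : l ^ 2 - tr A * l + 1 = 0 := by rw [hl]; linear_combination hsq / 4 + hD / 4
  obtain ⟨v, hv0, hv⟩ := Matrix.exists_mulVec_eq_zero_iff (M := A.1 - Matrix.scalar (Fin 2) l)|>.2 (by
    rw [Matrix.det_fin_two]
    simp
    rw [tr] at hchar
    linear_combination hchar + det_eq A)
  have hv1 := congrFun hv 0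
  have hv2 := congrFun hv 1
  simp [Matrix.mulVec, dotProduct, Fin.sum_univ_two] at hv1 hv2
  have hn : v 0 ^ 2 + v 1 ^ 2 ≠ 0 := by
    intro h
    apply hv0
    have h0 : v 0 = 0 := by nlinarith [sq_nonneg (v 0), sq_nonneg (v 1)]
    have h1 : v 1 = 0 := by nlinarith [sq_nonneg (v 0), sq_nonneg (v 1)]
    ext i; fin_cases i <;> assumption
  -- The first column is an eigenvector for l, and the second is orthogonal to it.
  let k : SL(2, ℝ) := ⟨!![v 0, -v 1 / (v 0 ^ 2 + v 1 ^ 2); v 1, v 0 / (v 0 ^ 2 + v 1 ^ 2)], by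
    rw [Matrix.det_fin_two_of]; field_simp; ring⟩
  obtain ⟨i1, i2, i3, i4⟩ := inv_apply_two k
  have k00 : k 0 0 = v 0 := rfl
  have k10 : k 1 0 = v 1 := rfl
  have hk10 : (k⁻¹ * A * k) 1 0 = 0 := by
    simp only [mul_apply_two, i3, i4, k00, k10]
    linear_combination v 0 * hv2 - v 1 * hv1
  have hk00 : (k⁻¹ * A * k) 0 0 = l := by
    have hd := det_eq k
    rw [k00, k10] at hd
    simp only [mul_apply_two, i1, i2, k00, k10]
    linear_combination k 1 1 * hv1 - k 0 1 * hv2 + l * hd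
  set B := k⁻¹ * A * k with hB
  have hB11 : l * B 1 1 = 1 := by
    have := det_eq B
    rw [hk10, hk00] at this; linarith
  have hne : l - B 1 1 ≠ 0 := by
    intro h
    have : B 1 1 = l := by linarith
    rw [this] at hB11; nlinarith
  -- Conjugation by n(s) adds s (l - l⁻¹) to the upper right entry, and l ≠ l⁻¹, so this entry can
  -- be prescribed.
  refine ⟨k * unip ((ε - B 0 1) / (l - B 1 1)), ?_⟩
  rw [show (k * unip ((ε - B 0 1) / (l - B 1 1)))⁻¹ * A * (k * unip ((ε - B 0 1) / (l - B 1 1))) =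
    (unip ((ε - B 0 1) / (l - B 1 1)))⁻¹ * B * unip ((ε - B 0 1) / (l - B 1 1)) by rw [hB]; group]
  set s := (ε - B 0 1) / (l - B 1 1) with hs
  have hs' : s * (l - B 1 1) = ε - B 0 1 := by rw [hs]; field_simp
  obtain ⟨j1, j2, j3, j4⟩ := inv_apply_two (unip s)
  have u00 : (unip s) 0 0 = 1 := rfl
  have u01 : (unip s) 0 1 = s := rfl
  have u10 : (unip s) 1 0 = 0 := rfl
  have u11 : (unip s) 1 1 = 1 := rfl
  simp only [mul_apply_two, j1, j2, j3, j4, u00, u01, u10, u11, hk10, hk00]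
  refine ⟨by ring, by linarith, by linear_combination hs'⟩

/-- The traces of the hyperbolic elements of `Γ` are bounded away from `2`. -/
lemma exists_trace_gap {Γ : Subgroup SL(2, ℝ)} (hΓ : IsCuspidalLattice Γ) :
    ∃ δ : ℝ, 0 < δ ∧ ∀ γ ∈ Γ, 2 < tr γ → 2 + δ ≤ tr γ := by
  have := hΓ.discrete
  obtain ⟨R, hR⟩ := exists_conj_bounded hΓ (ε := 1 / 16) (by norm_num) (by norm_num)
  -- A very short hyperbolic element produces one that is no longer and lies in a fixed finite set;
  -- the finitely many traces there give the gap.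
  have key : ∀ γ ∈ Γ, 2 < tr γ → tr γ < 2 + 1 / 512 →
      ∃ β ∈ Γ, 2 < tr β ∧ tr β ≤ tr γ ∧ mu β ≤ R := by
    intro γ hγ h2 h3
    have hγ1 : γ ≠ 1 := by rintro rfl; norm_num [tr] at h2
    have hγm : γ ≠ -1 := by rintro rfl; norm_num [tr] at h2
    let S : Set SL(2, ℝ) := {β | β ∈ Γ ∧ Commute γ β ∧ 2 < tr β ∧ tr β ≤ tr γ}
    have hS : S.Finite := (finite_mu_le Γ (mu γ)).subset fun β h ↦
      ⟨h.1, mu_le_of_commute h.2.1 h2 h.2.2.1 h.2.2.2⟩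
    obtain ⟨γ₁, ⟨hm, hc, ht, hle⟩, hmin⟩ := hS.exists_minimalFor tr S
      ⟨γ, hγ, Commute.refl γ, h2, le_rfl⟩
    have hγ1' : γ₁ ≠ 1 := by rintro rfl; norm_num [tr] at ht
    have hγm' : γ₁ ≠ -1 := by rintro rfl; norm_num [tr] at ht
    -- The point of view h is chosen so that γ₁ is small but not too small: a trace below 2 + 1/512
    -- puts the diagonal within 1/16 of 1, so `dev` is at most 1/8, while the off-diagonal entry
    -- keeps it at least 1/16.
    obtain ⟨h, e10, e00, e01⟩ := exists_conj_triangular γ₁ ht (1 / 16)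
    set A := h⁻¹ * γ₁ * h with hA
    have htrA : tr A = tr γ₁ := tr_conj _ _
    have hdA := det_eq A
    rw [e10] at hdA
    have htrA' : A 0 0 + A 1 1 = tr γ₁ := htrA
    have hdev : dev A ≤ 1 / 8 := by
      have h5 : A 0 0 ≤ 1 + 1 / 16 := by
        by_contra! hgt
        nlinarith
      have h6 : 1 - A 1 1 ≤ A 0 0 - 1 := by nlinarith
      have h7 : A 1 1 ≤ 1 := by nlinarith
      have := dev_sq A
      rw [e10, e01] at this
      have h8 : dev A ^ 2 ≤ (1 / 8) ^ 2 := by rw [this]; nlinarith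
      exact le_of_sq_le_sq h8 (by norm_num) 
    obtain ⟨ρ, hρ, hρR⟩ := hR h γ₁ hm hγ1' hdev (fun β hβ hβ1 hcβ htr ↦ by
      by_contra! hlt
      have hcA : Commute A (h⁻¹ * β * h) := by
        have := hcβ.eq
        change h⁻¹ * γ₁ * h * (h⁻¹ * β * h) = h⁻¹ * β * h * (h⁻¹ * γ₁ * h)
        rw [show h⁻¹ * γ₁ * h * (h⁻¹ * β * h) = h⁻¹ * (γ₁ * β) * h by group, this]; group
      have hA1 : A ≠ 1 := conj_ne_one hγ1'
      have hAm : A ≠ -1 := ne_neg_one_of_dev hdev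
      obtain ⟨t, t1, t2, t3⟩ := exists_of_commute hcA hA1 hAm
      have h9 := tr_sq_of_commute t1 t2 t3
      rw [htrA, tr_conj] at h9
      set B := h⁻¹ * β * h with hB
      -- Minimality of the trace of γ₁ in the centralizer gives t² ≥ 1. A commuting element of trace
      -- 2 has t = 0, hence is 1. The entry t/16 then keeps β at distance at least 1/16.
      have hcase : 1 ≤ t ^ 2 := by
        rcases htr.lt_or_eq with hgt | heq
        · have hle' : tr γ₁ ≤ tr β := by
            rcases le_total (tr β) (tr γ) with hh | hh
            · by_contra! hlt'
              exact absurd (hmin ⟨hβ, commute_trans hγ1' hγm' hc.symm hcβ, hgt, hh⟩ hlt'.le)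
                (not_le.2 hlt')
            · exact hle.trans hh
          by_contra! hlt'
          nlinarith [mul_pos (sub_pos.2 hlt') (show 0 < tr γ₁ ^ 2 - 4 by nlinarith)]
        · exfalso
          rw [← heq] at h9
          have ht0 : t = 0 := by
            have : t ^ 2 * (tr γ₁ ^ 2 - 4) = 0 := by linarith
            rcases mul_eq_zero.1 this with h | h
            · exact pow_eq_zero_iff two_ne_zero |>.1 h
            · nlinarith
          rw [ht0] at t1 t2 t3
          have hBtr : B 0 0 + B 1 1 = 2 := by rw [heq]; exact tr_conj _ _
          obtain ⟨o1, o2, o3, o4⟩ := one_apply_two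
          refine conj_ne_one (g := h) hβ1 (?_ : B = 1)
          refine SL_ext ?_ ?_ ?_ ?_ <;> simp only [o1, o2, o3, o4] <;> linarith
      have h10 := dev_sq B
      rw [t1, e01] at h10
      have h11 : dev B ^ 2 < (1 / 16) ^ 2 := pow_lt_pow_left₀ hlt (dev_nonneg _) two_ne_zero
      nlinarith [sq_nonneg (B 0 0 - 1), sq_nonneg (B 1 0), sq_nonneg (B 1 1 - 1)])
    refine ⟨ρ⁻¹ * γ₁ * ρ, Γ.mul_mem (Γ.mul_mem (Γ.inv_mem hρ) hm) hρ, ?_, ?_, hρR⟩ <;>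
      rw [tr_conj] <;> assumption
  let W : Set SL(2, ℝ) := {β | β ∈ Γ ∧ 2 < tr β ∧ mu β ≤ R}
  have hW : W.Finite := (finite_mu_le Γ R).subset fun β h ↦ ⟨h.1, h.2.2⟩
  rcases W.eq_empty_or_nonempty with hemp | hne
  · refine ⟨1 / 512, by norm_num, fun γ hγ h ↦ ?_⟩
    by_contra! hlt
    obtain ⟨β, hβ, h1, h2, h3⟩ := key γ hγ h hlt
    exact Set.notMem_empty β (hemp ▸ ⟨hβ, h1, h3⟩)
  · obtain ⟨w, hw, hmin⟩ := hW.exists_minimalFor tr W hne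
    refine ⟨min (1 / 512) (tr w - 2), lt_min (by norm_num) (by linarith [hw.2.1]), fun γ hγ h ↦ ?_⟩
    by_contra! hlt
    obtain ⟨β, hβ, h1, h2, h3⟩ := key γ hγ h
      (hlt.trans_le (by linarith [min_le_left (1 / 512) (tr w - 2)]))
    have h4 : tr w ≤ tr β := by
      rcases le_total (tr w) (tr β) with hh | hh
      · exact hh
      · exact hmin ⟨hβ, h1, h3⟩ hh
    linarith [min_le_right (1 / 512) (tr w - 2)]

/-- The nontrivial unipotent elements of `Γ`. -/
def unipotents (Γ : Subgroup SL(2, ℝ)) : Set SL(2, ℝ) := {γ | γ ∈ Γ ∧ γ ≠ 1 ∧ tr γ = 2}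

/-- The fixed point of a parabolic matrix. -/
def fixPt (γ : SL(2, ℝ)) : OnePoint ℝ := (slToGL γ).parabolicFixedPoint

lemma isParabolic_of_tr {γ : SL(2, ℝ)} (h1 : γ ≠ 1) (h2 : tr γ = 2) : (slToGL γ).IsParabolic := by
  refine ⟨?_, ?_⟩
  · rintro ⟨a, ha⟩
    have e : ∀ i j, Matrix.scalar (Fin 2) a i j = γ i j := fun i j ↦ by rw [ha]; rfl
    have e00 := e 0 0
    have e01 := e 0 1
    have e10 := e 1 0
    have e11 := e 1 1
    simp at e00 e01 e10 e11
    rw [tr, ← e00, ← e11] at h2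
    apply h1
    refine SL_ext ?_ ?_ ?_ ?_ <;> simp <;> linarith
  · rw [Matrix.discr_fin_two, Matrix.trace_fin_two]
    simp only [Matrix.SpecialLinearGroup.coe_GL_coe_matrix, Matrix.SpecialLinearGroup.det_coe]
    change tr γ ^ 2 - 4 * 1 = 0
    rw [h2]; norm_num

lemma smul_eq_self_iff_fixPt {γ : SL(2, ℝ)} (h1 : γ ≠ 1) (h2 : tr γ = 2) {c : OnePoint ℝ} :
    slToGL γ • c = c ↔ c = fixPt γ :=
  (isParabolic_of_tr h1 h2).smul_eq_self_iff

lemma smul_fixPt {γ : SL(2, ℝ)} (h1 : γ ≠ 1) (h2 : tr γ = 2) : slToGL γ • fixPt γ = fixPt γ :=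
  (smul_eq_self_iff_fixPt h1 h2).2 rfl

lemma smul_fixPt_of_commute {γ δ : SL(2, ℝ)} (h1 : γ ≠ 1) (h2 : tr γ = 2) (h : Commute γ δ) :
    slToGL δ • fixPt γ = fixPt γ := by
  rw [← smul_eq_self_iff_fixPt h1 h2, ← mul_smul, ← map_mul, h.eq, map_mul, mul_smul,
    smul_fixPt h1 h2]

lemma conj_mem_unipotents {Γ : Subgroup SL(2, ℝ)} {γ ρ : SL(2, ℝ)} (h : γ ∈ unipotents Γ)
    (hρ : ρ ∈ Γ) : ρ⁻¹ * γ * ρ ∈ unipotents Γ :=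
  ⟨Γ.mul_mem (Γ.mul_mem (Γ.inv_mem hρ) h.1) hρ, conj_ne_one h.2.1, by rw [tr_conj, h.2.2]⟩

lemma smul_fixPt_conj {γ ρ : SL(2, ℝ)} (h1 : γ ≠ 1) (h2 : tr γ = 2) :
    slToGL ρ • fixPt (ρ⁻¹ * γ * ρ) = fixPt γ := by
  have h := smul_fixPt (γ := ρ⁻¹ * γ * ρ) (conj_ne_one h1) (by rw [tr_conj, h2])
  rw [← smul_eq_self_iff_fixPt h1 h2, ← mul_smul, ← map_mul]
  conv_rhs => rw [← h]
  rw [← mul_smul, ← map_mul]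
  congr 2; group

lemma cusp_fixPt {Γ : Subgroup SL(2, ℝ)} {γ : SL(2, ℝ)} (h : γ ∈ unipotents Γ) :
    Cusp Γ (fixPt γ) :=
  ⟨slToGL γ, Subgroup.mem_map_of_mem _ h.1, isParabolic_of_tr h.2.1 h.2.2, smul_fixPt h.2.1 h.2.2⟩

lemma unip_apply (t : ℝ) : unip t 0 0 = 1 ∧ unip t 0 1 = t ∧ unip t 1 0 = 0 ∧ unip t 1 1 = 1 :=
  ⟨rfl, rfl, rfl, rfl⟩

lemma unip_add (s t : ℝ) : unip (s + t) = unip s * unip t := by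
  obtain ⟨a1, a2, a3, a4⟩ := unip_apply s
  obtain ⟨b1, b2, b3, b4⟩ := unip_apply t
  obtain ⟨c1, c2, c3, c4⟩ := unip_apply (s + t)
  refine SL_ext ?_ ?_ ?_ ?_ <;> simp only [mul_apply_two, *] <;> ring

lemma unip_zero : unip 0 = 1 := by
  obtain ⟨a1, a2, a3, a4⟩ := unip_apply 0
  refine SL_ext ?_ ?_ ?_ ?_ <;> simp [*]

lemma unip_inv (t : ℝ) : (unip t)⁻¹ = unip (-t) := by
  rw [inv_eq_iff_mul_eq_one, ← unip_add, add_neg_cancel, unip_zero]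

/-- Diagonal matrices of determinant one. -/
def diagSL (t : ℝ) (ht : t ≠ 0) : SL(2, ℝ) := ⟨!![t, 0; 0, t⁻¹], by simp [ht]⟩

lemma diagSL_conj_unip (t : ℝ) (ht : t ≠ 0) (k : ℝ) :
    (diagSL t ht)⁻¹ * unip k * diagSL t ht = unip (k / t ^ 2) := by
  obtain ⟨a1, a2, a3, a4⟩ := inv_apply_two (diagSL t ht)
  obtain ⟨b1, b2, b3, b4⟩ := unip_apply k
  obtain ⟨c1, c2, c3, c4⟩ := unip_apply (k / t ^ 2)
  have d1 : (diagSL t ht) 0 0 = t := rfl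
  have d2 : (diagSL t ht) 0 1 = 0 := rfl
  have d3 : (diagSL t ht) 1 0 = 0 := rfl
  have d4 : (diagSL t ht) 1 1 = t⁻¹ := rfl
  refine SL_ext ?_ ?_ ?_ ?_ <;> simp only [mul_apply_two, *] <;> field_simp <;> ring

lemma dev_unip_sq (t : ℝ) : dev (unip t) ^ 2 = t ^ 2 := by
  obtain ⟨b1, b2, b3, b4⟩ := unip_apply t
  rw [dev_sq, b1, b2, b3, b4]; ring

lemma tr_unip (t : ℝ) : tr (unip t) = 2 := by
  obtain ⟨b1, b2, b3, b4⟩ := unip_apply t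
  rw [tr, b1, b4]; norm_num

lemma IsScaling.unip_mem {Γ : Subgroup SL(2, ℝ)} {a : OnePoint ℝ} {σ : SL(2, ℝ)}
    (h : IsScaling Γ a σ) (k : ℤ) :
    σ * unip k * σ⁻¹ ∈ Γ ∧ slToGL (σ * unip k * σ⁻¹) • a = a :=
  (h.conj_stab _).2 ⟨k, Or.inl (by group)⟩

/-- Up to the action of `Γ`, there are only finitely many cusps. -/
lemma exists_finite_cusps {Γ : Subgroup SL(2, ℝ)} (hΓ : IsCuspidalLattice Γ)
    {σ : OnePoint ℝ → SL(2, ℝ)} (hσ : ∀ a, Cusp Γ a → IsScaling Γ a (σ a)) :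
    ∃ R : ℝ, ∀ γ ∈ unipotents Γ, ∃ ρ ∈ Γ, ∃ w ∈ unipotents Γ, mu w ≤ R ∧
      fixPt γ = slToGL ρ • fixPt w := by
  obtain ⟨R, hR⟩ := exists_conj_bounded hΓ (ε := 1 / 16) (by norm_num) (by norm_num)
  refine ⟨R, fun γ hγ ↦ ?_⟩
  have hsc := hσ _ (cusp_fixPt hγ)
  set a := fixPt γ with ha
  set γ₁ := σ a * unip 1 * (σ a)⁻¹ with hγ₁
  obtain ⟨hm, hfix⟩ := hsc.unip_mem 1
  rw [Int.cast_one, ← hγ₁] at hm hfix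
  have htr : tr γ₁ = 2 := by
    have := tr_conj (σ a)⁻¹ (unip 1)
    rw [inv_inv, tr_unip] at this; exact this
  -- Seen from σ diag(4, 1/4), the generator is n(1/16). Elements commuting with it fix the same
  -- cusp; those of trace at least 2 become n(k/16), so none but 1 is closer than 1/16.
  have hconj : ∀ t, (σ a * diagSL 4 (by norm_num))⁻¹ * (σ a * unip t * (σ a)⁻¹) *
      (σ a * diagSL 4 (by norm_num)) = unip (t / 16) := by
    intro t
    rw [show t / 16 = t / 4 ^ 2 by norm_num, ← diagSL_conj_unip 4 (by norm_num)]; group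
  have hdev : dev ((σ a * diagSL 4 (by norm_num))⁻¹ * γ₁ * (σ a * diagSL 4 (by norm_num))) ≤ 1 / 8 := by
    rw [hγ₁, hconj]
    refine le_of_sq_le_sq ?_ (by norm_num)
    rw [dev_unip_sq]; norm_num
  have hne : γ₁ ≠ 1 := by
    intro h
    have h1 := hconj 1
    rw [← hγ₁, h] at h1
    have h2 := dev_unip_sq (1 / 16)
    rw [← h1] at h2
    norm_num [dev_sq] at h2
  have hfa : a = fixPt γ₁ := (smul_eq_self_iff_fixPt hne htr).1 hfix
  obtain ⟨ρ, hρ, hρR⟩ := hR (σ a * diagSL 4 (by norm_num)) γ₁ hm hne hdev (fun β hβ hβ1 hc hβtr ↦ by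
    have h1 : slToGL β • a = a := by rw [hfa]; exact smul_fixPt_of_commute hne htr hc
    obtain ⟨k, hk⟩ := (hsc.conj_stab β).1 ⟨hβ, h1⟩
    have hk' : (σ a)⁻¹ * β * σ a = unip k := by
      refine hk.resolve_right fun h ↦ ?_
      have h3 := tr_conj (σ a) β
      rw [h, tr_neg, tr_unip] at h3
      linarith
    have hβe : β = σ a * unip k * (σ a)⁻¹ := by rw [← hk']; group
    have hk0 : k ≠ 0 := by
      rintro rfl
      apply hβ1
      rw [hβe, Int.cast_zero, unip_zero]; group
    have hk1 : (1 : ℝ) ≤ (k : ℝ) ^ 2 := by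
      have : (1 : ℤ) ≤ k ^ 2 := by have := sq_pos_of_ne_zero hk0; omega
      exact_mod_cast this
    rw [hβe, hconj]
    refine le_of_sq_le_sq ?_ (dev_nonneg _)
    rw [dev_unip_sq]
    nlinarith)
  exact ⟨ρ, hρ, _, conj_mem_unipotents ⟨hm, hne, htr⟩ hρ, hρR, by rw [smul_fixPt_conj hne htr, hfa]⟩

/-- The complement of a bounded part of `Γ \ SL(2, ℝ)` is covered by cuspidal neighbourhoods. -/
lemma exists_thick_or_cuspidal {Γ : Subgroup SL(2, ℝ)} (hΓ : IsCuspidalLattice Γ) :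
    ∃ ε₀ : ℝ, 0 < ε₀ ∧ ∀ ε : ℝ, 0 < ε → ε ≤ ε₀ → ∃ R : ℝ, ∀ g : SL(2, ℝ),
      (∃ ρ ∈ Γ, mu (ρ⁻¹ * g) ≤ R) ∨ ∃ γ ∈ unipotents Γ, dev (g⁻¹ * γ * g) < ε := by
  obtain ⟨δ, hδ, hgap⟩ := exists_trace_gap hΓ
  refine ⟨min (1 / 8) (min 1 δ), by positivity, fun ε hε hle ↦ ?_⟩
  have h1 : ε ≤ 1 / 8 := hle.trans (min_le_left _ _)
  have h2 : ε ≤ δ := hle.trans ((min_le_right _ _).trans (min_le_right _ _))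
  obtain ⟨R, hR⟩ := exists_bound_of_dev_ge hΓ hε
  refine ⟨R, fun g ↦ ?_⟩
  by_contra! hcon
  obtain ⟨hc1, hc2⟩ := hcon
  obtain ⟨ρ, hρ, hρR⟩ := hR g (fun γ hγ hγ1 htr hmu hdev ↦ by
    refine absurd (hc2 γ ⟨hγ, hγ1, ?_⟩) (not_le.2 hdev)
    -- A trace of at least 2 + δ is incompatible with tr² ≤ mu + 2 < 4 + ε² and ε ≤ δ.
    by_contra hne
    have h3 := hgap γ hγ (lt_of_le_of_ne htr (Ne.symm hne))
    have h4 := tr_sq_le (g⁻¹ * γ * g)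
    rw [tr_conj] at h4
    nlinarith)
  exact absurd hρR (not_le.2 (hc1 ρ hρ))

end TwistedEisenstein
end

/-! ### Logarithmic word length in SL(2, ℝ) -/

noncomputable section

namespace TwistedEisenstein

lemma diagSL_apply (t : ℝ) (ht : t ≠ 0) : diagSL t ht 0 0 = t ∧ diagSL t ht 0 1 = 0 ∧
    diagSL t ht 1 0 = 0 ∧ diagSL t ht 1 1 = t⁻¹ := ⟨rfl, rfl, rfl, rfl⟩

lemma diagSL_exp_pow (x : ℝ) (n : ℕ) :
    diagSL (Real.exp x) (Real.exp_ne_zero x) ^ n = diagSL (Real.exp (n * x)) (Real.exp_ne_zero _) := by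
  induction n with
  | zero =>
    obtain ⟨a1, a2, a3, a4⟩ := diagSL_apply (Real.exp ((0 : ℕ) * x)) (Real.exp_ne_zero _)
    refine SL_ext ?_ ?_ ?_ ?_ <;> simp only [a1, a2, a3, a4, pow_zero, one_apply_two] <;> simp
  | succ n ih =>
    rw [pow_succ, ih]
    obtain ⟨a1, a2, a3, a4⟩ := diagSL_apply (Real.exp ((n + 1 : ℕ) * x)) (Real.exp_ne_zero _)
    obtain ⟨b1, b2, b3, b4⟩ := diagSL_apply (Real.exp (n * x)) (Real.exp_ne_zero _)
    obtain ⟨c1, c2, c3, c4⟩ := diagSL_apply (Real.exp x) (Real.exp_ne_zero _)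
    have e : Real.exp ((n + 1 : ℕ) * x) = Real.exp (n * x) * Real.exp x := by
      rw [← Real.exp_add]; push_cast; ring_nf
    refine SL_ext ?_ ?_ ?_ ?_ <;> simp only [mul_apply_two, a1, a2, a3, a4, b1, b2, b3, b4,
      c1, c2, c3, c4] <;> (try rw [e]) <;> (try rw [mul_inv]) <;> ring

/-- `g` is a product of at most `n` matrices of bounded size. -/
def HasLength (g : SL(2, ℝ)) (n : ℝ) : Prop :=
  ∃ l : List SL(2, ℝ), (∀ d ∈ l, mu d ≤ 10) ∧ l.prod = g ∧ (l.length : ℝ) ≤ n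

lemma HasLength.mul {g h : SL(2, ℝ)} {m n : ℝ} (hg : HasLength g m) (hh : HasLength h n) :
    HasLength (g * h) (m + n) := by
  obtain ⟨l, l1, l2, l3⟩ := hg
  obtain ⟨k, k1, k2, k3⟩ := hh
  refine ⟨l ++ k, ?_, by rw [List.prod_append, l2, k2], by rw [List.length_append]; push_cast; linarith⟩
  intro d hd
  rcases List.mem_append.1 hd with h | h
  · exact l1 d h
  · exact k1 d h

lemma HasLength.mono {g : SL(2, ℝ)} {m n : ℝ} (hg : HasLength g m) (h : m ≤ n) : HasLength g n := by
  obtain ⟨l, l1, l2, l3⟩ := hg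
  exact ⟨l, l1, l2, l3.trans h⟩

lemma hasLength_one {g : SL(2, ℝ)} (h : mu g ≤ 10) : HasLength g 1 :=
  ⟨[g], by simpa using h, by simp, by simp⟩

/-- An n-th root of the matrix with n ≥ |log t| has entries at most e, which keeps `mu` below 10. -/
lemma hasLength_diagSL {t : ℝ} (ht : 0 < t) : HasLength (diagSL t ht.ne') (|Real.log t| + 2) := by
  set n := ⌈|Real.log t|⌉₊ + 1 with hn
  have hn0 : (0 : ℝ) < n := by rw [hn]; positivity
  have hle : |Real.log t| ≤ n := by
    rw [hn]; push_cast; linarith [Nat.le_ceil |Real.log t|]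
  set x := Real.log t / n with hx
  have hx1 : |x| ≤ 1 := by
    rw [hx, abs_div, abs_of_pos hn0, div_le_one hn0]; exact hle
  refine ⟨List.replicate n (diagSL (Real.exp x) (Real.exp_ne_zero x)), ?_, ?_, ?_⟩
  · intro d hd
    rw [List.eq_of_mem_replicate hd, mu]
    obtain ⟨a1, a2, a3, a4⟩ := diagSL_apply (Real.exp x) (Real.exp_ne_zero x)
    rw [a1, a2, a3, a4, ← Real.exp_neg]
    have h1 : Real.exp x ≤ Real.exp 1 := Real.exp_le_exp.2 (abs_le.1 hx1).2
    have h2 : Real.exp (-x) ≤ Real.exp 1 := Real.exp_le_exp.2 (by linarith [(abs_le.1 hx1).1])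
    have h3 : Real.exp x * Real.exp (-x) = 1 := by rw [← Real.exp_add]; simp
    have h4 := Real.exp_one_lt_d9
    have h5 : 0 < Real.exp x := Real.exp_pos x
    have h6 : 0 < Real.exp (-x) := Real.exp_pos _
    have h7 : (Real.exp 1 - Real.exp x) * (Real.exp 1 - Real.exp (-x)) ≥ 0 :=
      mul_nonneg (by linarith) (by linarith)
    rcases le_total x 0 with hh | hh
    · have : Real.exp x ≤ 1 := Real.exp_le_one_iff.2 hh
      nlinarith
    · have : Real.exp (-x) ≤ 1 := Real.exp_le_one_iff.2 (by linarith)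
      nlinarith
  · rw [List.prod_replicate, diagSL_exp_pow]
    have : (n : ℝ) * x = Real.log t := by rw [hx]; field_simp
    congr 1
    rw [this, Real.exp_log ht]
  · rw [List.length_replicate, hn]
    push_cast
    linarith [Nat.ceil_lt_add_one (abs_nonneg (Real.log t))]

lemma diagSL_inv (t : ℝ) (ht : t ≠ 0) : (diagSL t ht)⁻¹ = diagSL t⁻¹ (inv_ne_zero ht) := by
  obtain ⟨a1, a2, a3, a4⟩ := inv_apply_two (diagSL t ht)
  obtain ⟨b1, b2, b3, b4⟩ := diagSL_apply t ht
  obtain ⟨c1, c2, c3, c4⟩ := diagSL_apply t⁻¹ (inv_ne_zero ht)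
  refine SL_ext ?_ ?_ ?_ ?_ <;> simp only [a1, a2, a3, a4, b1, b2, b3, b4, c1, c2, c3, c4] <;> simp

/-- Unipotents are logarithmically distorted: conjugation by diag(t, 1/t) with t² = 1 + |x| brings
n(x) to bounded size. -/
lemma hasLength_unip (x : ℝ) : HasLength (unip x) (Real.log (1 + |x|) + 5) := by
  have hp : 0 < 1 + |x| := by positivity
  set t := √(1 + |x|) with ht
  have ht0 : 0 < t := Real.sqrt_pos.2 hp
  have hsq : t ^ 2 = 1 + |x| := Real.sq_sqrt hp.le
  have e : unip x = diagSL t ht0.ne' * unip (x / t ^ 2) * diagSL t⁻¹ (inv_pos.2 ht0).ne' := by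
    rw [← diagSL_conj_unip t ht0.ne', ← diagSL_inv t ht0.ne']; group
  have hlog : |Real.log t| = Real.log (1 + |x|) / 2 := by
    rw [ht, Real.log_sqrt hp.le, abs_of_nonneg]
    have := Real.log_nonneg (show (1 : ℝ) ≤ 1 + |x| by linarith [abs_nonneg x])
    linarith
  have hlog' : |Real.log t⁻¹| = Real.log (1 + |x|) / 2 := by rw [Real.log_inv, abs_neg, hlog]
  have hmid : HasLength (unip (x / t ^ 2)) 1 := by
    refine hasLength_one ?_
    obtain ⟨b1, b2, b3, b4⟩ := unip_apply (x / t ^ 2)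
    rw [mu, b1, b2, b3, b4, hsq]
    have h1 : |x / (1 + |x|)| ≤ 1 := by
      rw [abs_div, abs_of_pos hp, div_le_one hp]; linarith
    have h2 : (x / (1 + |x|)) ^ 2 ≤ 1 := by rw [sq_le_one_iff_abs_le_one]; exact h1
    linarith
  rw [e]
  refine (((hasLength_diagSL ht0).mul hmid).mul (hasLength_diagSL (inv_pos.2 ht0))).mono ?_
  rw [hlog, hlog']; linarith

/-- The word length is at most logarithmic in the size. -/
lemma hasLength_log (g : SL(2, ℝ)) : HasLength g (3 * Real.log (mu g) + 8) := by
  set z := g • UpperHalfPlane.I with hz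
  have hy := z.im_pos
  have hmu : mu z.toSL2R = mu g := by rw [mu_eq_cosh, mu_eq_cosh, UpperHalfPlane.toSL2R_smul_I]
  have hsq : √z.im ^ 2 = z.im := Real.sq_sqrt hy.le
  have hs0 : 0 < √z.im := Real.sqrt_pos.2 hy
  have e00 : z.toSL2R 0 0 = √z.im := by rw [UpperHalfPlane.coe_toSL2R]; rfl
  have e01 : z.toSL2R 0 1 = z.re / √z.im := by rw [UpperHalfPlane.coe_toSL2R]; rfl
  have e10 : z.toSL2R 1 0 = 0 := by rw [UpperHalfPlane.coe_toSL2R]; rfl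
  have e11 : z.toSL2R 1 1 = 1 / √z.im := by rw [UpperHalfPlane.coe_toSL2R]; rfl
  have hmu2 : mu g = z.im + z.re ^ 2 / z.im + 1 / z.im := by
    rw [← hmu, mu, e00, e01, e10, e11, div_pow, div_pow, hsq]; ring
  have hm2 := two_le_mu g
  have hy1 : z.im ≤ mu g := by rw [hmu2]; have : 0 ≤ z.re ^ 2 / z.im + 1 / z.im := by positivity
                               linarith
  have hy2 : 1 / z.im ≤ mu g := by rw [hmu2]; have : 0 ≤ z.im + z.re ^ 2 / z.im := by positivity
                                   linarith
  have hx : |z.re| ≤ mu g := by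
    have h1 : z.re ^ 2 / z.im ≤ mu g := by
      rw [hmu2]; have : 0 ≤ z.im + 1 / z.im := by positivity
      linarith
    rw [div_le_iff₀ hy] at h1
    exact abs_le_of_sq_le_sq (by nlinarith) (by linarith)
  have hL : 0 ≤ Real.log (mu g) := Real.log_nonneg (by linarith)
  have hlogy : |Real.log √z.im| ≤ Real.log (mu g) := by
    have h1 : Real.log z.im ≤ Real.log (mu g) := Real.log_le_log hy hy1
    have h2 : -Real.log z.im ≤ Real.log (mu g) := by
      rw [← Real.log_inv, ← one_div]; exact Real.log_le_log (by positivity) hy2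
    rw [Real.log_sqrt hy.le, abs_le]
    constructor <;> linarith
  have hlogx : Real.log (1 + |z.re|) ≤ 2 * Real.log (mu g) := by
    rw [← Real.log_rpow (by linarith)]
    refine Real.log_le_log (by positivity) ?_
    rw [Real.rpow_two]; nlinarith
  have eκ : mu (z.toSL2R⁻¹ * g) ≤ 10 := by
    rw [mu_eq_cosh, mul_smul, ← hz]
    conv_lhs => rw [← UpperHalfPlane.toSL2R_smul_I z]
    rw [UpperHalfPlane.toSL2R_smul_I, inv_smul_eq_iff.2 (UpperHalfPlane.toSL2R_smul_I z).symm]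
    norm_num
  -- Iwasawa decomposition: the last factor fixes i.
  have e : g = unip z.re * diagSL √z.im hs0.ne' * (z.toSL2R⁻¹ * g) := by
    have : z.toSL2R = unip z.re * diagSL √z.im hs0.ne' := by
      obtain ⟨b1, b2, b3, b4⟩ := unip_apply z.re
      obtain ⟨c1, c2, c3, c4⟩ := diagSL_apply √z.im hs0.ne'
      refine SL_ext ?_ ?_ ?_ ?_ <;> simp only [mul_apply_two, b1, b2, b3, b4, c1, c2, c3, c4,
        e00, e01, e10, e11] <;> field_simp <;> ring
    rw [← this]; group
  rw [e]
  refine (((hasLength_unip z.re).mul (hasLength_diagSL hs0)).mul (hasLength_one eκ)).mono ?_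
  rw [← e]; linarith

/-! ### Polynomial growth of representations that are unitary at the cusps -/

section
variable {V : Type*} [NormedAddCommGroup V] [InnerProductSpace ℂ V] {Γ : Subgroup SL(2, ℝ)}
  {χ : Γ →* (V →L[ℂ] V)}

lemma mem_stab {a : OnePoint ℝ} {γ : Γ} : γ ∈ stab Γ a ↔ slToGL (γ : SL(2, ℝ)) • a = a := Iff.rfl

lemma norm_apply_of_mem_stab (hχ : UnitaryAtCusps χ) {a : OnePoint ℝ} (ha : Cusp Γ a) {γ : Γ}
    (hγ : γ ∈ stab Γ a) (v : V) : ‖χ γ v‖ = ‖v‖ := by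
  rw [@norm_eq_sqrt_re_inner ℂ, @norm_eq_sqrt_re_inner ℂ, hχ a ha γ hγ]

lemma norm_le_one_of_mem_stab (hχ : UnitaryAtCusps χ) {a : OnePoint ℝ} (ha : Cusp Γ a) {γ : Γ}
    (hγ : γ ∈ stab Γ a) : ‖χ γ‖ ≤ 1 :=
  ContinuousLinearMap.opNorm_le_bound _ zero_le_one fun v ↦ by
    rw [norm_apply_of_mem_stab hχ ha hγ, one_mul]

lemma norm_map_mul_le (γ δ : Γ) : ‖χ (γ * δ)‖ ≤ ‖χ γ‖ * ‖χ δ‖ := by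
  rw [map_mul]; exact norm_mul_le _ _

lemma exists_norm_bound_of_mu (χ : Γ →* (V →L[ℂ] V)) [DiscreteTopology Γ] (R : ℝ) :
    ∃ M : ℝ, ∀ γ : Γ, mu γ ≤ R → ‖χ γ‖ ≤ M := by
  have hfin : {γ : Γ | mu γ ≤ R}.Finite := by
    refine Set.Finite.of_finite_image (f := Subtype.val) ((finite_mu_le Γ R).subset ?_)
      Subtype.val_injective.injOn
    rintro _ ⟨γ, hγ, rfl⟩
    exact ⟨γ.2, hγ⟩
  obtain ⟨M, hM⟩ := (hfin.image fun γ ↦ ‖χ γ‖).bddAbove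
  exact ⟨M, fun γ hγ ↦ hM ⟨γ, hγ, rfl⟩⟩

/-- For each pair of cusps one connecting element is chosen; any other one differs from it by the
stabilizer, where χ has norm at most 1. -/
lemma exists_norm_bound_of_map (hχ : UnitaryAtCusps χ) {S : Set (OnePoint ℝ)}
    (hS : S.Finite) (hSc : ∀ a ∈ S, Cusp Γ a) :
    ∃ M : ℝ, ∀ ρ : Γ, ∀ a ∈ S, slToGL (ρ : SL(2, ℝ)) • a ∈ S → ‖χ ρ‖ ≤ M := by
  classical
  let f : OnePoint ℝ × OnePoint ℝ → ℝ := fun p ↦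
    if h : ∃ ρ : Γ, slToGL (ρ : SL(2, ℝ)) • p.1 = p.2 then ‖χ h.choose‖ else 0
  obtain ⟨M, hM⟩ := ((hS.prod hS).image f).bddAbove
  refine ⟨M, fun ρ a ha hb ↦ ?_⟩
  have hex : ∃ ρ' : Γ, slToGL (ρ' : SL(2, ℝ)) • a = slToGL (ρ : SL(2, ℝ)) • a := ⟨ρ, rfl⟩
  have h1 : ‖χ hex.choose‖ ≤ M := by
    refine hM ⟨(a, slToGL (ρ : SL(2, ℝ)) • a), ⟨ha, hb⟩, ?_⟩
    simp only [f]
    rw [dif_pos hex]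
  have hst : hex.choose⁻¹ * ρ ∈ stab Γ a := by
    rw [mem_stab]
    push_cast
    rw [map_mul, mul_smul, map_inv, inv_smul_eq_iff]
    exact hex.choose_spec.symm
  calc ‖χ ρ‖ = ‖χ (hex.choose * (hex.choose⁻¹ * ρ))‖ := by rw [mul_inv_cancel_left]
    _ ≤ ‖χ hex.choose‖ * ‖χ (hex.choose⁻¹ * ρ)‖ := norm_map_mul_le _ _
    _ ≤ ‖χ hex.choose‖ * 1 := by
        gcongr; exact norm_le_one_of_mem_stab hχ (hSc a ha) hst
    _ ≤ M := by rw [mul_one]; exact h1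

lemma dev_conj_le (g d : SL(2, ℝ)) : dev (d⁻¹ * g * d) ≤ mu d * dev g := by
  have h1 : (d⁻¹ * g * d).1 - 1 = d⁻¹.1 * (g.1 - 1) * d.1 := by
    have : d⁻¹.1 * d.1 = 1 := by rw [← Matrix.SpecialLinearGroup.coe_mul]; simp
    rw [Matrix.mul_sub, Matrix.sub_mul, Matrix.mul_one, this]
    simp [Matrix.SpecialLinearGroup.coe_mul]
  rw [dev, h1]
  refine (hs_mul_le _ _).trans ?_
  have h2 := mul_le_mul_of_nonneg_right (hs_mul_le d⁻¹.1 (g.1 - 1)) (hs_nonneg d.1)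
  rw [hs_inv] at h2
  rw [mu_eq_hs_sq, dev]
  linarith [h2]

/-- The position of `g` relative to its `Γ`-translates: `ρ⁻¹ g` is bounded, or it is in a
neighbourhood of a cusp in `W`. -/
def Near (Γ : Subgroup SL(2, ℝ)) (ε R : ℝ) (W : Set (OnePoint ℝ)) (g ρ : SL(2, ℝ)) : Prop :=
  mu (ρ⁻¹ * g) ≤ R ∨ ∃ γ ∈ unipotents Γ, dev (g⁻¹ * γ * g) < ε ∧ ∃ a ∈ W, fixPt γ = slToGL ρ • a

/-- The data of reduction theory for `Γ`, with a bound for `χ` between neighbouring domains. -/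
lemma exists_step_bound (hΓ : IsCuspidalLattice Γ) (hχ : UnitaryAtCusps χ)
    {σ : OnePoint ℝ → SL(2, ℝ)} (hσ : ∀ a, Cusp Γ a → IsScaling Γ a (σ a)) :
    ∃ (P : SL(2, ℝ) → Γ → Prop) (M : ℝ), (∀ g, ∃ ρ, P g ρ) ∧
      (∀ g ρ (γ : Γ), P g ρ → P (γ * g) (γ * ρ)) ∧
      ∀ g ρ d ρ', mu d ≤ 10 → P g ρ → P (g * d) ρ' → ‖χ (ρ⁻¹ * ρ')‖ ≤ M := by
  have := hΓ.discrete
  obtain ⟨R₁, hR₁⟩ := exists_finite_cusps hΓ hσ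
  obtain ⟨ε₀, hε₀, hthin⟩ := exists_thick_or_cuspidal hΓ
  -- A step d has mu d ≤ 10, so an element at distance below 1/80 seen from g * d is still within
  -- 1/8 seen from g, where small elements commute.
  set ε := min ε₀ (1 / 80) with hε
  obtain ⟨R, hR⟩ := hthin ε (by positivity) (min_le_left _ _)
  have hε80 : ε ≤ 1 / 80 := min_le_right _ _
  set R₂ := max R₁ (300 * R ^ 2) with hR₂
  set W : Set (OnePoint ℝ) := fixPt '' {w | w ∈ unipotents Γ ∧ mu w ≤ R₂} with hW
  have hWfin : W.Finite := ((finite_mu_le Γ R₂).subset fun w hw ↦ ⟨hw.1.1, hw.2⟩).image _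
  have hWc : ∀ a ∈ W, Cusp Γ a := by
    rintro _ ⟨w, hw, rfl⟩; exact cusp_fixPt hw.1
  obtain ⟨M₁, hM₁⟩ := exists_norm_bound_of_mu χ (R * 10 * R)
  obtain ⟨M₂, hM₂⟩ := exists_norm_bound_of_map hχ hWfin hWc
  -- This makes W large enough: a unipotent small at a point in bounded position is conjugate to one
  -- of bounded size, so that its fixed point, translated, is in W.
  have hcore : ∀ (k A : SL(2, ℝ)), mu k ≤ R * 10 → dev A < ε → mu (k * A * k⁻¹) ≤ R₂ := by
    intro k A hk hA
    have h1 := mu_le_of_dev A (by linarith)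
    refine (mu_conj_le k A).trans (le_trans ?_ (le_max_right _ _))
    have h2 : mu k ^ 2 ≤ (R * 10) ^ 2 := pow_le_pow_left₀ (mu_nonneg _) hk 2
    calc mu k ^ 2 * mu A ≤ (R * 10) ^ 2 * 3 := mul_le_mul h2 h1 (mu_nonneg _) (by positivity)
      _ = 300 * R ^ 2 := by ring
  refine ⟨fun g ρ ↦ Near Γ ε R W g ρ, max M₁ M₂, ?_, ?_, ?_⟩
  · intro g
    rcases hR g with ⟨ρ, hρ, h⟩ | ⟨γ, hγ, h⟩
    · exact ⟨⟨ρ, hρ⟩, Or.inl h⟩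
    · obtain ⟨ρ, hρ, w, hw, hwR, he⟩ := hR₁ γ hγ
      exact ⟨⟨ρ, hρ⟩, Or.inr ⟨γ, hγ, h, _, ⟨w, ⟨hw, hwR.trans (le_max_left _ _)⟩, rfl⟩, he⟩⟩
  · rintro g ρ γ (h | ⟨u, hu, hd, a, ha, he⟩)
    · left
      rw [Subgroup.coe_mul, show (γ * ρ : SL(2, ℝ))⁻¹ * (γ * g) = (ρ : SL(2, ℝ))⁻¹ * g by group]
      exact h
    · right
      have hu' := conj_mem_unipotents hu (Γ.inv_mem γ.2)
      refine ⟨_, hu', ?_, a, ha, ?_⟩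
      · convert hd using 2; group
      · have := smul_fixPt_conj (γ := (γ : SL(2, ℝ))⁻¹⁻¹ * u * (γ : SL(2, ℝ))⁻¹) (ρ := γ) hu'.2.1 hu'.2.2
        rw [← this, Subgroup.coe_mul, map_mul, mul_smul, ← he]
        congr 2; group
  · rintro g ρ d ρ' hd h h'
    -- If both positions are bounded, so is ρ⁻¹ρ'. If one is bounded and the other cuspidal, ρ⁻¹ρ'
    -- connects two cusps in W by `hcore`. If both are cuspidal, the two small unipotents commute,
    -- hence fix the same cusp, and ρ⁻¹ρ' connects a' to a.
    rcases h with h | ⟨u, hu, hud, a, ha, he⟩ <;> rcases h' with h' | ⟨u', hu', hud', a', ha', he'⟩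
    · refine le_trans (hM₁ _ ?_) (le_max_left _ _)
      push_cast
      rw [show (ρ : SL(2, ℝ))⁻¹ * ρ' = ((ρ : SL(2, ℝ))⁻¹ * g) * d * ((ρ' : SL(2, ℝ))⁻¹ * (g * d))⁻¹ by group]
      refine (mu_mul_mul_le _ _ _).trans ?_
      rw [mu_inv]
      have := mu_nonneg ((ρ : SL(2, ℝ))⁻¹ * g)
      have := mu_nonneg d
      have := mu_nonneg ((ρ' : SL(2, ℝ))⁻¹ * (g * d))
      have : 0 ≤ R := by linarith
      gcongr
    · refine le_trans (hM₂ _ a' ha' ⟨_, ⟨conj_mem_unipotents hu' ρ.2, ?_⟩, ?_⟩) (le_max_right _ _)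
      · have h1 := hcore ((ρ : SL(2, ℝ))⁻¹ * g * d) _ ((mu_mul_le _ _).trans
          (mul_le_mul h hd (mu_nonneg _) ((mu_nonneg _).trans h))) hud'
        convert h1 using 2; group
      · have := smul_fixPt_conj (ρ := (ρ : SL(2, ℝ))) hu'.2.1 hu'.2.2
        push_cast
        rw [map_mul, mul_smul, ← he', map_inv, eq_inv_smul_iff, this]
    · refine le_trans (hM₂ (ρ⁻¹ * ρ') (slToGL ((ρ' : SL(2, ℝ))⁻¹ * ρ) • a)
        ⟨_, ⟨conj_mem_unipotents hu ρ'.2, ?_⟩, ?_⟩ ?_) (le_max_right _ _)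
      · have h1 := hcore ((ρ' : SL(2, ℝ))⁻¹ * (g * d) * d⁻¹) _ ((mu_mul_le _ _).trans
          (mul_le_mul h' (by rwa [mu_inv]) (mu_nonneg _) ((mu_nonneg _).trans h'))) hud
        convert h1 using 2; group
      · have := smul_fixPt_conj (ρ := (ρ' : SL(2, ℝ))) hu.2.1 hu.2.2
        rw [map_mul, mul_smul, ← he, map_inv, eq_inv_smul_iff, this]
      · rw [← mul_smul, ← map_mul]
        push_cast
        rw [show ((ρ : SL(2, ℝ))⁻¹ * ρ' * ((ρ' : SL(2, ℝ))⁻¹ * ρ)) = 1 by group]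
        simpa using ha
    · refine le_trans (hM₂ _ a' ha' ?_) (le_max_right _ _)
      have h1 : dev (g⁻¹ * u' * g) ≤ 1 / 8 := by
        have := dev_conj_le ((g * d)⁻¹ * u' * (g * d)) d⁻¹
        rw [mu_inv, show d⁻¹⁻¹ * ((g * d)⁻¹ * u' * (g * d)) * d⁻¹ = g⁻¹ * u' * g by group] at this
        nlinarith [dev_nonneg ((g * d)⁻¹ * u' * (g * d)), mu_nonneg d]
      have h2 : dev (g⁻¹ * u * g) ≤ 1 / 8 := by linarith
      have hc := commute_of_dev_le Γ g hu.1 hu'.1 hu.2.1 h2 h1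
      have h3 : fixPt u = fixPt u' :=
        (smul_eq_self_iff_fixPt hu'.2.1 hu'.2.2).1 (smul_fixPt_of_commute hu.2.1 hu.2.2 hc)
      have h4 : slToGL ((ρ⁻¹ * ρ' : Γ) : SL(2, ℝ)) • a' = a := by
        push_cast
        rw [map_mul, mul_smul, ← he', ← h3, he, map_inv, inv_smul_smul]
      rw [h4]; exact ha

/-- A representation of a lattice that is unitary at the cusps has polynomial growth. -/
theorem exists_growthBound (hΓ : IsCuspidalLattice Γ) (hχ : UnitaryAtCusps χ)
    {σ : OnePoint ℝ → SL(2, ℝ)} (hσ : ∀ a, Cusp Γ a → IsScaling Γ a (σ a)) :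
    ∃ σ₀ : ℝ, 1 < σ₀ ∧ GrowthBound χ σ₀ := by
  obtain ⟨P, M', hex, htrans, hstep'⟩ := exists_step_bound hΓ hχ hσ
  set M := max M' 1 with hM
  have hM1 : 1 ≤ M := le_max_right _ _
  have hstep : ∀ g ρ d ρ', mu d ≤ 10 → P g ρ → P (g * d) ρ' → ‖χ (ρ⁻¹ * ρ')‖ ≤ M :=
    fun g ρ d ρ' h1 h2 h3 ↦ (hstep' g ρ d ρ' h1 h2 h3).trans (le_max_left _ _)
  -- The additional factor M comes from the empty word: ρ and ρ' may be different choices at the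
  -- same point.
  have hchain : ∀ (l : List SL(2, ℝ)), (∀ d ∈ l, mu d ≤ 10) → ∀ g ρ ρ', P g ρ → P (g * l.prod) ρ' →
      ‖χ (ρ⁻¹ * ρ')‖ ≤ M ^ (l.length + 1) := by
    intro l
    induction l with
    | nil =>
      intro _ g ρ ρ' h h'
      have := hstep g ρ 1 ρ' (by rw [mu_one]; norm_num) h (by simpa using h')
      simpa using this
    | cons d l ih =>
      intro hl g ρ ρ' h h'
      obtain ⟨ρ'', h''⟩ := hex (g * d)
      have h1 := hstep g ρ d ρ'' (hl d (by simp)) h h''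
      have h2 := ih (fun e he ↦ hl e (by simp [he])) (g * d) ρ'' ρ' h''
        (by simpa [mul_assoc] using h')
      calc ‖χ (ρ⁻¹ * ρ')‖ = ‖χ (ρ⁻¹ * ρ'' * (ρ''⁻¹ * ρ'))‖ := by congr 2; group
        _ ≤ ‖χ (ρ⁻¹ * ρ'')‖ * ‖χ (ρ''⁻¹ * ρ')‖ := norm_map_mul_le _ _
        _ ≤ M * M ^ (l.length + 1) := by gcongr
        _ = M ^ ((d :: l).length + 1) := by rw [List.length_cons]; ring
  obtain ⟨ρ₀, hρ₀⟩ := hex 1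
  have hlogM : 0 ≤ Real.log M := Real.log_nonneg hM1
  -- M^(3 log μ) = μ^(3 log M), and 9 is the additive constant 8 of the word length plus the
  -- additional step. The summand 2 keeps σ₀ > 1 when M = 1.
  refine ⟨2 + 3 * Real.log M, by linarith, ‖χ ρ₀‖ * (M ^ (9 : ℝ)) * ‖χ ρ₀⁻¹‖, fun γ ↦ ?_⟩
  obtain ⟨l, hl, hprod, hlen⟩ := hasLength_log (γ : SL(2, ℝ))
  have hm2 := two_le_mu (γ : SL(2, ℝ))
  have h1 := hchain l hl 1 ρ₀ (γ * ρ₀) hρ₀ (by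
    rw [one_mul, hprod]; simpa using htrans 1 ρ₀ γ hρ₀)
  have h2 : M ^ (l.length + 1) ≤ M ^ (9 : ℝ) * mu γ ^ (2 + 3 * Real.log M - 1) := by
    rw [← Real.rpow_natCast]
    calc M ^ ((l.length + 1 : ℕ) : ℝ) ≤ M ^ (9 + 3 * Real.log (mu γ)) := by
          apply Real.rpow_le_rpow_of_exponent_le hM1; push_cast; linarith
      _ = M ^ (9 : ℝ) * mu γ ^ (3 * Real.log M) := by
          rw [Real.rpow_add (by linarith)]
          congr 1
          rw [Real.rpow_def_of_pos (by linarith), Real.rpow_def_of_pos (by linarith)]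
          ring_nf
      _ ≤ _ := by
          gcongr
          · linarith
          · linarith
  calc ‖χ γ‖ = ‖χ (ρ₀ * (ρ₀⁻¹ * (γ * ρ₀)) * ρ₀⁻¹)‖ := by congr 2; group
    _ ≤ ‖χ ρ₀‖ * ‖χ (ρ₀⁻¹ * (γ * ρ₀))‖ * ‖χ ρ₀⁻¹‖ :=
        (norm_map_mul_le _ _).trans (mul_le_mul_of_nonneg_right (norm_map_mul_le _ _) (norm_nonneg _))
    _ ≤ ‖χ ρ₀‖ * (M ^ (9 : ℝ) * mu γ ^ (2 + 3 * Real.log M - 1)) * ‖χ ρ₀⁻¹‖ := by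
        gcongr; exact h1.trans h2
    _ = _ := by ring

end

end TwistedEisenstein
end

/-! ### Sums over integer translates and the theta function with a character -/

noncomputable section

namespace TwistedEisenstein

lemma kernel_pos (x : ℝ) {A : ℝ} (hA : 0 < A) (n : ℤ) : 0 < (x + n) ^ 2 + A := by positivity

/-- For |u| ≤ 1/2 and n ≠ 0 one has |u + n| ≥ |n|/2, which gives a bound uniform in u. At n = 0 the
last term is only used to be nonnegative. -/
lemma kernel_le (u : ℝ) (hu : |u| ≤ 1 / 2) {A σ : ℝ} (hA : 0 < A) (hσ : 0 < σ) (n : ℤ) :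
    ((u + n) ^ 2 + A) ^ (-σ) ≤ (if n = 0 then A ^ (-σ) else 0) + 4 ^ σ * |(n : ℝ)| ^ (-(2 * σ)) := by
  by_cases hn : n = 0
  · subst hn
    simp only [Int.cast_zero, add_zero, if_true, abs_zero]
    have h1 : (u ^ 2 + A) ^ (-σ) ≤ A ^ (-σ) :=
      Real.rpow_le_rpow_of_nonpos hA (by nlinarith [sq_nonneg u]) (by linarith)
    have h2 : 0 ≤ (4 : ℝ) ^ σ * (0 : ℝ) ^ (-(2 * σ)) := by positivity
    linarith
  · rw [if_neg hn, zero_add]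
    have hn1 : (1 : ℝ) ≤ |(n : ℝ)| := by exact_mod_cast Int.one_le_abs hn
    have h0 : (n : ℝ) ^ 2 / 4 ≤ (u + n) ^ 2 + A := by
      have h1 : |(n : ℝ)| - 1 / 2 ≤ |u + n| := by
        have := abs_sub_abs_le_abs_sub (n : ℝ) (-u)
        rw [abs_neg, sub_neg_eq_add, add_comm (n : ℝ)] at this
        linarith
      have h2 : |(n : ℝ)| / 2 ≤ |u + n| := by linarith
      have h3 := mul_self_le_mul_self (by positivity) h2
      rw [abs_mul_abs_self] at h3
      have h4 : |(n : ℝ)| / 2 * (|(n : ℝ)| / 2) = (n : ℝ) ^ 2 / 4 := by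
        rw [← sq_abs (n : ℝ)]; ring
      nlinarith
    have hpos : (0 : ℝ) < (n : ℝ) ^ 2 / 4 := by positivity
    refine (Real.rpow_le_rpow_of_nonpos hpos h0 (by linarith)).trans (le_of_eq ?_)
    rw [← sq_abs (n : ℝ), Real.div_rpow (by positivity) (by norm_num),
      ← Real.rpow_natCast |(n : ℝ)| 2, ← Real.rpow_mul (abs_nonneg _), Real.rpow_neg (by norm_num : (0 : ℝ) ≤ 4),
      div_inv_eq_mul, mul_comm]
    congr 2
    push_cast; ring

lemma kernel_bound_summable {A σ : ℝ} (hσ : 1 / 2 < σ) :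
    Summable fun n : ℤ ↦ (if n = 0 then A ^ (-σ) else 0) + 4 ^ σ * |(n : ℝ)| ^ (-(2 * σ)) :=
  (summable_of_ne_finset_zero (s := {0}) (by intro n hn; simp at hn; simp [hn])).add
    ((Real.summable_abs_int_rpow (by linarith)).mul_left _)

lemma kernel_summable_and_le {σ : ℝ} (hσ : 1 / 2 < σ) {A : ℝ} (hA : 0 < A) (x : ℝ) :
    Summable (fun n : ℤ ↦ ((x + n) ^ 2 + A) ^ (-σ)) ∧ ∑' n : ℤ, ((x + n) ^ 2 + A) ^ (-σ) ≤
      A ^ (-σ) + 4 ^ σ * ∑' n : ℤ, |(n : ℝ)| ^ (-(2 * σ)) := by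
  set u := x - round x with hu
  have hu2 : |u| ≤ 1 / 2 := abs_sub_round x
  have e : (fun n : ℤ ↦ ((x + n) ^ 2 + A) ^ (-σ)) =
      (fun n : ℤ ↦ ((u + n) ^ 2 + A) ^ (-σ)) ∘ (Equiv.addRight (round x)) := by
    ext n
    simp only [Function.comp, Equiv.coe_addRight, Int.cast_add, hu]
    congr 2; ring
  have hle := kernel_le u hu2 hA (by linarith : 0 < σ)
  have hsum := kernel_bound_summable (A := A) hσ
  have hs : Summable (fun n : ℤ ↦ ((u + n) ^ 2 + A) ^ (-σ)) :=
    Summable.of_nonneg_of_le (fun n ↦ (Real.rpow_pos_of_pos (kernel_pos u hA n) _).le) hle hsum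
  rw [e]
  refine ⟨(Equiv.summable_iff _).2 hs, ?_⟩
  have : ∑' n : ℤ, ((fun n : ℤ ↦ ((u + n) ^ 2 + A) ^ (-σ)) ∘ (Equiv.addRight (round x))) n
      = ∑' n : ℤ, ((u + n) ^ 2 + A) ^ (-σ) :=
    (Equiv.addRight (round x)).tsum_eq (fun n : ℤ ↦ ((u + n) ^ 2 + A) ^ (-σ))
  rw [this]
  refine (hs.tsum_le_tsum hle hsum).trans (le_of_eq ?_)
  rw [Summable.tsum_add (summable_of_ne_finset_zero (s := {0}) (by intro n hn; simp at hn; simp [hn]))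
    ((Real.summable_abs_int_rpow (by linarith)).mul_left _), tsum_ite_eq, tsum_mul_left]

lemma norm_e (x : ℝ) : ‖e x‖ = 1 := by
  rw [e, show 2 * Real.pi * Complex.I * x = ((2 * Real.pi * x : ℝ) : ℂ) * Complex.I by push_cast; ring,
    Complex.norm_exp_ofReal_mul_I]

lemma e_ne_zero (x : ℝ) : e x ≠ 0 := Complex.exp_ne_zero _

lemma exp_neg_le_inv {u : ℝ} (hu : 0 < u) : Real.exp (-u) ≤ 1 / u := by
  rw [Real.exp_neg, ← one_div]
  exact one_div_le_one_div_of_le hu (by linarith [Real.add_one_le_exp u])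

lemma summable_gaussian {t A : ℝ} (ht : 0 < t) (hA : 0 < A) (x : ℝ) :
    Summable fun n : ℤ ↦ Real.exp (-(((x + n) ^ 2 + A) * t)) := by
  have h := (kernel_summable_and_le (σ := 1) (by norm_num) hA x).1.mul_left (1 / t)
  refine Summable.of_nonneg_of_le (fun n ↦ (Real.exp_pos _).le) (fun n ↦ ?_) h
  have hp := kernel_pos x hA n
  refine (exp_neg_le_inv (by positivity)).trans (le_of_eq ?_)
  rw [Real.rpow_neg_one]; field_simp

/-- The dual theta terms. -/
def dualTerm (ν x t : ℝ) (m : ℤ) : ℂ :=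
  (Real.exp (-(Real.pi ^ 2 * (m + ν) ^ 2 / t)) : ℂ) * e ((m + ν) * x)

lemma norm_dualTerm (ν x t : ℝ) (m : ℤ) :
    ‖dualTerm ν x t m‖ = Real.exp (-(Real.pi ^ 2 * (m + ν) ^ 2 / t)) := by
  rw [dualTerm, norm_mul, norm_e, mul_one, Complex.norm_real, Real.norm_of_nonneg (Real.exp_pos _).le]

lemma summable_dualTerm (ν x : ℝ) {t : ℝ} (ht : 0 < t) : Summable (dualTerm ν x t) := by
  refine Summable.of_norm ?_
  simp_rw [norm_dualTerm]
  have h := (summable_gaussian (t := Real.pi ^ 2 / t) (by positivity) one_pos ν).mul_left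
    (Real.exp (Real.pi ^ 2 / t))
  refine h.congr fun m ↦ ?_
  rw [← Real.exp_add]; congr 1; ring

/-- The transformation formula of the theta function with character `n ↦ e(-nν)`. -/
lemma hasSum_theta (ν x y : ℝ) (hy : 0 < y) {t : ℝ} (ht : 0 < t) :
    HasSum (fun n : ℤ ↦ e (-(n * ν)) * (Real.exp (-((x + n) ^ 2 + y ^ 2) * t) : ℂ))
      ((Real.exp (-(y ^ 2 * t)) * √(Real.pi / t) : ℝ) * ∑' m : ℤ, dualTerm ν x t m) := by
  have hs : Summable (fun n : ℤ ↦ e (-(n * ν)) * (Real.exp (-((x + n) ^ 2 + y ^ 2) * t) : ℂ)) := by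
    refine Summable.of_norm ?_
    refine (summable_gaussian ht (by positivity : 0 < y ^ 2) x).congr fun n ↦ ?_
    rw [norm_mul, norm_e, one_mul, Complex.norm_real, Real.norm_of_nonneg (Real.exp_pos _).le, neg_mul]
  convert hs.hasSum using 1
  have hpi := Real.pi_pos
  have hpiC : (Real.pi : ℂ) ≠ 0 := by exact_mod_cast hpi.ne'
  have htC : (t : ℂ) ≠ 0 := by exact_mod_cast ht.ne'
  -- Poisson summation. The linear coefficient carries the translation x and the character ν;
  -- dually, ν shifts the frequencies to m + ν and x becomes the phase e((m + ν)x).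
  have key := Complex.tsum_exp_neg_quadratic (a := ((t / Real.pi : ℝ) : ℂ))
    (by rw [Complex.ofReal_re]; positivity) (-(t * x / Real.pi) - Complex.I * ν)
  have hI : Complex.I ^ 2 = -1 := Complex.I_sq
  have hL : ∀ n : ℤ, e (-(n * ν)) * (Real.exp (-((x + n) ^ 2 + y ^ 2) * t) : ℂ) =
      (Real.exp (-(x ^ 2 + y ^ 2) * t) : ℂ) *
        Complex.exp (-Real.pi * ((t / Real.pi : ℝ) : ℂ) * n ^ 2 +
          2 * Real.pi * (-(t * x / Real.pi) - Complex.I * ν) * n) := by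
    intro n
    rw [e, Complex.ofReal_exp, Complex.ofReal_exp, ← Complex.exp_add, ← Complex.exp_add]
    congr 1
    push_cast
    field_simp
    ring
  have hR : ∀ n : ℤ, (Real.exp (-(x ^ 2 + y ^ 2) * t) : ℂ) *
      Complex.exp (-Real.pi / ((t / Real.pi : ℝ) : ℂ) *
        (n + Complex.I * (-(t * x / Real.pi) - Complex.I * ν)) ^ 2) =
      (Real.exp (-(y ^ 2 * t)) : ℂ) * dualTerm ν x t n := by
    intro n
    rw [dualTerm, e, Complex.ofReal_exp, Complex.ofReal_exp, Complex.ofReal_exp, ← Complex.exp_add,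
      ← Complex.exp_add, ← Complex.exp_add]
    congr 1
    push_cast
    have : (n : ℂ) + Complex.I * (-(t * x / Real.pi) - Complex.I * ν) =
        (n + ν) - Complex.I * (t * x / Real.pi) := by linear_combination (-ν : ℂ) * hI
    rw [this]
    field_simp
    linear_combination (-t ^ 2 * x ^ 2) * hI
  have hroot : 1 / ((t / Real.pi : ℝ) : ℂ) ^ (1 / 2 : ℂ) = (√(Real.pi / t) : ℝ) := by
    rw [show (1 / 2 : ℂ) = ((1 / 2 : ℝ) : ℂ) by push_cast; rfl, ← Complex.ofReal_cpow (by positivity),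
      ← Real.sqrt_eq_rpow, ← Complex.ofReal_one, ← Complex.ofReal_div]
    congr 1
    rw [one_div, ← Real.sqrt_inv, inv_div]
  simp_rw [hL]
  rw [tsum_mul_left, key, hroot]
  have hRs := tsum_congr (L := .unconditional ℤ) hR
  rw [tsum_mul_left, tsum_mul_left] at hRs
  rw [mul_left_comm, hRs, Complex.ofReal_mul]
  ring

lemma summable_inv_sq (ν : ℝ) : Summable fun m : ℤ ↦ 1 / ((m : ℝ) + ν) ^ 2 := by
  refine ((Real.summable_one_div_int_add_rpow ν 2).2 (by norm_num)).congr fun m ↦ ?_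
  rw [Real.rpow_two, sq_abs]

/-- The nonzero frequencies of the theta function, at height `y`, decay exponentially. -/
lemma exp_mul_exp_le {r r₀ θ Y y t : ℝ} (hr₀ : 0 < r₀) (hr : r₀ ≤ |r|) (hθ : 0 < θ) (hθ1 : θ < 1)
    (hY : 0 < Y) (hy : Y ≤ y) (ht : 0 < t) :
    Real.exp (-(y ^ 2 * t)) * Real.exp (-(Real.pi ^ 2 * r ^ 2 / t)) ≤
      Real.exp (-(2 * Real.pi * r₀ * θ) * y) * Real.exp (-(((1 - θ) * Y ^ 2) * t)) *
        (t * ((1 / ((1 - θ) * Real.pi ^ 2)) * (1 / r ^ 2))) := by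
  have hpi := Real.pi_pos
  have hr0 : 0 < |r| := hr₀.trans_le hr
  have hr2 : 0 < r ^ 2 := by rw [← sq_abs]; positivity
  have h1θ : 0 < 1 - θ := by linarith
  have hu : 0 < (1 - θ) * (Real.pi ^ 2 * r ^ 2 / t) := by positivity
  -- By the inequality of arithmetic and geometric means, the total exponent y²t + π²r²/t is at
  -- least 2πr₀y. Its share θ gives the decay in y; the share 1 - θ gives decay in t and a factor
  -- t/r², summable over the frequencies.
  have h1 := exp_neg_le_inv hu
  have h2 : 2 * Real.pi * r₀ * y ≤ y ^ 2 * t + Real.pi ^ 2 * r ^ 2 / t := by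
    have hy0 : 0 < y := hY.trans_le hy
    have h3 : 2 * Real.pi * r₀ * y ≤ 2 * Real.pi * |r| * y := by gcongr
    have h4 : y ^ 2 * t + Real.pi ^ 2 * r ^ 2 / t - 2 * Real.pi * |r| * y
        = (y * t - Real.pi * |r|) ^ 2 / t := by
      rw [← sq_abs r]; field_simp; ring
    have h5 : 0 ≤ (y * t - Real.pi * |r|) ^ 2 / t := by positivity
    linarith
  have h6 : Y ^ 2 ≤ y ^ 2 := by gcongr
  calc Real.exp (-(y ^ 2 * t)) * Real.exp (-(Real.pi ^ 2 * r ^ 2 / t))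
      ≤ Real.exp (-(2 * Real.pi * r₀ * θ) * y) * Real.exp (-(((1 - θ) * Y ^ 2) * t)) *
        Real.exp (-((1 - θ) * (Real.pi ^ 2 * r ^ 2 / t))) := by
        rw [← Real.exp_add, ← Real.exp_add, ← Real.exp_add]
        apply Real.exp_le_exp.2
        have h7 := mul_le_mul_of_nonneg_left h2 hθ.le
        have h8 : (1 - θ) * Y ^ 2 * t ≤ (1 - θ) * y ^ 2 * t := by gcongr
        linarith
    _ ≤ _ := by
        gcongr
        refine h1.trans (le_of_eq ?_)
        field_simp

/-- The contribution of the zero frequency, if there is one. -/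
def zeroFreq (ν : ℝ) : ℂ := if ν = 0 then 1 else 0

/-- The bound separates y from t: the decay in y stands in front, and the rest can be integrated
against a power of t on (0, ∞). -/
lemma norm_theta_sub_le {ν r₀ θ Y : ℝ} (hν : 0 ≤ ν) (hν1 : ν < 1) (hr₀ : 0 < r₀)
    (hr : ∀ m : ℤ, (m : ℝ) + ν ≠ 0 → r₀ ≤ |(m : ℝ) + ν|) (hθ : 0 < θ) (hθ1 : θ < 1) (hY : 0 < Y)
    {x y t : ℝ} (hy : Y ≤ y) (ht : 0 < t) :
    ‖((Real.exp (-(y ^ 2 * t)) * √(Real.pi / t) : ℝ) * ∑' m : ℤ, dualTerm ν x t m) -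
        zeroFreq ν * (Real.exp (-(y ^ 2 * t)) * √(Real.pi / t) : ℝ)‖ ≤
      Real.exp (-(2 * Real.pi * r₀ * θ) * y) * (√(Real.pi / t) *
        (Real.exp (-(((1 - θ) * Y ^ 2) * t)) *
        (t * ((1 / ((1 - θ) * Real.pi ^ 2)) * ∑' m : ℤ, (1 / ((m : ℝ) + ν) ^ 2))))) := by
  classical
  have hs := summable_dualTerm ν x ht
  have h0 : ∀ m : ℤ, (m : ℝ) + ν = 0 ↔ m = 0 ∧ ν = 0 := by
    intro m
    constructor
    · intro h
      have h1 : (m : ℝ) ≤ 0 := by linarith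
      have h2 : (-1 : ℝ) < m := by linarith
      have h3 : m ≤ 0 := by exact_mod_cast h1
      have h4 : -1 < m := by exact_mod_cast h2
      have h5 : m = 0 := by omega
      subst h5
      simpa using h
    · rintro ⟨rfl, rfl⟩; simp
  have hsplit : ∑' m : ℤ, dualTerm ν x t m = zeroFreq ν +
      ∑' m : ℤ, if (m : ℝ) + ν = 0 then 0 else dualTerm ν x t m := by
    by_cases hν0 : ν = 0
    · rw [hs.tsum_eq_add_tsum_ite 0]
      congr 1
      · simp [dualTerm, zeroFreq, hν0, e]
      · exact tsum_congr fun m ↦ by simp [hν0]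
    · rw [zeroFreq, if_neg hν0, zero_add]
      exact tsum_congr fun m ↦ by rw [if_neg]; rw [h0]; tauto
  rw [hsplit, mul_add, mul_comm (zeroFreq ν), add_sub_cancel_left, norm_mul, Complex.norm_real,
    Real.norm_of_nonneg (by positivity)]
  set K := 1 / ((1 - θ) * Real.pi ^ 2) with hK
  have hterm : ∀ m : ℤ, Real.exp (-(y ^ 2 * t)) * ‖if (m : ℝ) + ν = 0 then 0 else dualTerm ν x t m‖ ≤
      Real.exp (-(2 * Real.pi * r₀ * θ) * y) * Real.exp (-(((1 - θ) * Y ^ 2) * t)) *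
        (t * (K * (1 / ((m : ℝ) + ν) ^ 2))) := by
    intro m
    split_ifs with h
    · rw [h]; simp
    · rw [norm_dualTerm]
      exact exp_mul_exp_le hr₀ (hr m h) hθ hθ1 hY hy ht
  have hsb : Summable fun m : ℤ ↦
      Real.exp (-(2 * Real.pi * r₀ * θ) * y) * Real.exp (-(((1 - θ) * Y ^ 2) * t)) *
        (t * (K * (1 / ((m : ℝ) + ν) ^ 2))) :=
    (((summable_inv_sq ν).mul_left _).mul_left _).mul_left _
  have hsn : Summable fun m : ℤ ↦
      Real.exp (-(y ^ 2 * t)) * ‖if (m : ℝ) + ν = 0 then 0 else dualTerm ν x t m‖ :=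
    Summable.of_nonneg_of_le (fun m ↦ by positivity) hterm hsb
  have hsn' : Summable fun m : ℤ ↦ ‖if (m : ℝ) + ν = 0 then 0 else dualTerm ν x t m‖ :=
    (summable_mul_left_iff (Real.exp_pos _).ne').1 hsn
  calc Real.exp (-(y ^ 2 * t)) * √(Real.pi / t) *
      ‖∑' m : ℤ, if (m : ℝ) + ν = 0 then 0 else dualTerm ν x t m‖
      ≤ Real.exp (-(y ^ 2 * t)) * √(Real.pi / t) *
        ∑' m : ℤ, ‖if (m : ℝ) + ν = 0 then 0 else dualTerm ν x t m‖ := by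
        gcongr; exact norm_tsum_le_tsum_norm hsn'
    _ = √(Real.pi / t) * ∑' m : ℤ,
        Real.exp (-(y ^ 2 * t)) * ‖if (m : ℝ) + ν = 0 then 0 else dualTerm ν x t m‖ := by
        rw [tsum_mul_left]; ring
    _ ≤ √(Real.pi / t) * ∑' m : ℤ,
        Real.exp (-(2 * Real.pi * r₀ * θ) * y) * Real.exp (-(((1 - θ) * Y ^ 2) * t)) *
        (t * (K * (1 / ((m : ℝ) + ν) ^ 2))) := by
        exact mul_le_mul_of_nonneg_left (hsn.tsum_le_tsum hterm hsb) (Real.sqrt_nonneg _)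
    _ = _ := by
        rw [tsum_mul_left, tsum_mul_left, tsum_mul_left]; ring

end TwistedEisenstein
end

/-! ### Mellin transform of the theta function -/

noncomputable section

namespace TwistedEisenstein

open MeasureTheory Set

/-- The integral of a nonintegrable function is 0 by convention, but the Gamma integral is positive.
-/
lemma integrableOn_rpow_mul_exp {a c : ℝ} (ha : 0 < a) (hc : 0 < c) :
    IntegrableOn (fun t : ℝ ↦ t ^ (a - 1) * Real.exp (-(c * t))) (Ioi 0) := by
  by_contra h
  have h1 := Real.integral_rpow_mul_exp_neg_mul_Ioi ha hc
  rw [integral_undef h] at h1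
  have := Real.Gamma_pos_of_pos ha
  have : 0 < (1 / c) ^ a * Real.Gamma a := by positivity
  linarith

lemma sqrt_pi_div {t : ℝ} (ht : 0 < t) : √(Real.pi / t) = √Real.pi * t ^ (-(1 / 2) : ℝ) := by
  rw [Real.sqrt_div Real.pi_pos.le, Real.rpow_neg ht.le, ← Real.sqrt_eq_rpow, div_eq_mul_inv]

lemma zeroFreq_integrand {s : ℂ} {y t : ℝ} (ht : 0 < t) :
    (t : ℂ) ^ (s - 1) * (Real.exp (-(y ^ 2 * t)) * √(Real.pi / t) : ℝ) =
      (√Real.pi : ℂ) * ((t : ℂ) ^ (s - 1 / 2 - 1) * Complex.exp (-((y ^ 2 : ℝ) * t))) := by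
  have htC : (t : ℂ) ≠ 0 := by exact_mod_cast ht.ne'
  rw [sqrt_pi_div ht, show s - 1 / 2 - 1 = (s - 1) + ((-(1 / 2) : ℝ) : ℂ) by push_cast; ring,
    Complex.cpow_add _ _ htC, Complex.ofReal_mul, Complex.ofReal_mul, Complex.ofReal_cpow ht.le,
    Complex.ofReal_exp]
  push_cast
  ring

lemma integral_zeroFreq {s : ℂ} (hs : 1 / 2 < s.re) {y : ℝ} (hy : 0 < y) :
    ∫ t in Ioi (0 : ℝ), (t : ℂ) ^ (s - 1) * (Real.exp (-(y ^ 2 * t)) * √(Real.pi / t) : ℝ) =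
      (y : ℂ) ^ (1 - 2 * s) * ((√Real.pi : ℂ) * Complex.Gamma (s - 1 / 2)) := by
  rw [setIntegral_congr_fun measurableSet_Ioi fun t ht ↦ zeroFreq_integrand (s := s) (y := y) ht,
    integral_const_mul, Complex.integral_cpow_mul_exp_neg_mul_Ioi (by
      simp only [Complex.sub_re, Complex.div_ofNat_re, Complex.one_re]; linarith)
      (by positivity)]
  have : (1 / ((y ^ 2 : ℝ) : ℂ)) ^ (s - 1 / 2) = (y : ℂ) ^ (1 - 2 * s) := by
    have hy0 : (y : ℂ) ≠ 0 := by exact_mod_cast hy.ne'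
    have h1 : (1 / ((y ^ 2 : ℝ) : ℂ)) = ((1 / y ^ 2 : ℝ) : ℂ) := by push_cast; rfl
    rw [h1, Complex.cpow_def_of_ne_zero (by exact_mod_cast (by positivity)),
      Complex.cpow_def_of_ne_zero hy0, ← Complex.ofReal_log hy.le,
      ← Complex.ofReal_log (by positivity), one_div, Real.log_inv, Real.log_pow]
    congr 1
    push_cast
    ring
  rw [this]; ring

/-- The sum over integer translates of `|z| ^ (-2s)`, twisted by the character `n ↦ e(-nν)`, is
equal to its zero frequency up to an exponentially small error. -/
theorem exists_norm_tsum_kernel_sub_le {ν r₀ β Y : ℝ} (hν : 0 ≤ ν) (hν1 : ν < 1)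
    (hr : ∀ m : ℤ, (m : ℝ) + ν ≠ 0 → r₀ ≤ |(m : ℝ) + ν|) (hβ : 0 < β)
    (hβr : β < 2 * Real.pi * r₀) (hY : 0 < Y) :
    ∃ C : ℂ → ℝ, ContinuousOn C {s | 1 < s.re} ∧ (∀ s : ℂ, 1 < s.re → ∀ x y : ℝ, Y ≤ y →
      ‖∑' n : ℤ, (((x + n) ^ 2 + y ^ 2 : ℝ) : ℂ) ^ (-s) * e (-(n * ν)) -
        zeroFreq ν * ((y : ℂ) ^ (1 - 2 * s) *
          ((√Real.pi : ℂ) * Complex.Gamma (s - 1 / 2) / Complex.Gamma s))‖ ≤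
        C s * Real.exp (-β * y)) := by
  have hpi := Real.pi_pos
  have hr₀ : 0 < r₀ := by
    by_contra! h
    nlinarith
  set θ := β / (2 * Real.pi * r₀) with hθ
  have hθ0 : 0 < θ := by positivity
  have hθ1 : θ < 1 := by rw [hθ, div_lt_one (by positivity)]; exact hβr
  have hθβ : 2 * Real.pi * r₀ * θ = β := by rw [hθ]; field_simp
  set c := (1 - θ) * Y ^ 2 with hc
  have hc0 : 0 < c := mul_pos (by linarith) (by positivity)
  set K := (1 / ((1 - θ) * Real.pi ^ 2)) * ∑' m : ℤ, (1 / ((m : ℝ) + ν) ^ 2) with hK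
  refine ⟨fun s ↦ √Real.pi * K * ((1 / c) ^ (s.re + 1 / 2) * Real.Gamma (s.re + 1 / 2)) /
    ‖Complex.Gamma s‖, ?_, ?_⟩
  · intro s hs
    replace hs : 1 < s.re := hs
    apply ContinuousAt.continuousWithinAt
    have h1 : ContinuousAt Complex.Gamma s := by
      refine (Complex.differentiableAt_Gamma s fun m h ↦ ?_).continuousAt
      rw [h] at hs; simp at hs; linarith [(Nat.cast_nonneg m : (0 : ℝ) ≤ m)]
    have h2 : ContinuousAt (fun s : ℂ ↦ Real.Gamma (s.re + 1 / 2)) s := by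
      have h3 : ContinuousAt Real.Gamma (s.re + 1 / 2) :=
        (Real.differentiableAt_Gamma fun m ↦ by
          have := (Nat.cast_nonneg m : (0 : ℝ) ≤ m); intro h; linarith).continuousAt
      exact ContinuousAt.comp (f := fun s : ℂ ↦ s.re + 1 / 2) h3 (by fun_prop)
    have h4 : ‖Complex.Gamma s‖ ≠ 0 :=
      norm_ne_zero_iff.2 (Complex.Gamma_ne_zero_of_re_pos (by linarith))
    have h5 : ContinuousAt (fun s : ℂ ↦ (1 / c) ^ (s.re + 1 / 2)) s :=
      ContinuousAt.rpow continuousAt_const (by fun_prop) (Or.inl (by positivity))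
    exact ((continuousAt_const.mul (h5.mul h2)).div h1.norm h4)
  · intro s hs x y hy
    have hy0 : 0 < y := hY.trans_le hy
    have hΓ : Complex.Gamma s ≠ 0 := Complex.Gamma_ne_zero_of_re_pos (by linarith)
    set F : ℝ → ℂ := fun t ↦
      (Real.exp (-(y ^ 2 * t)) * √(Real.pi / t) : ℝ) * ∑' m : ℤ, dualTerm ν x t m with hF
    set Z : ℝ → ℂ := fun t ↦ ((Real.exp (-(y ^ 2 * t)) * √(Real.pi / t) : ℝ) : ℂ) with hZ
    have hkp : ∀ n : ℤ, 0 < (x + n) ^ 2 + y ^ 2 := fun n ↦ kernel_pos x (by positivity) n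
    -- Termwise, Γ(s) p^(-s) is the Mellin transform of exp(-pt) with p = (x + n)² + y².
    have hmel := hasSum_mellin (a := fun n : ℤ ↦ e (-(n * ν))) (p := fun n : ℤ ↦ (x + n) ^ 2 + y ^ 2)
      (F := F) (s := s) (fun n ↦ Or.inr (hkp n)) (by linarith)
      (fun t ht ↦ hasSum_theta ν x y hy0 ht) (by
        refine (kernel_summable_and_le (σ := s.re) (by linarith) (by positivity : 0 < y ^ 2) x).1.congr
          fun n ↦ ?_
        rw [norm_e, Real.rpow_neg (hkp n).le, one_div])
    have hsum : ∑' n : ℤ, (((x + n) ^ 2 + y ^ 2 : ℝ) : ℂ) ^ (-s) * e (-(n * ν)) =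
        mellin F s / Complex.Gamma s := by
      rw [← hmel.tsum_eq, ← tsum_div_const]
      refine tsum_congr fun n ↦ ?_
      rw [Complex.cpow_neg]
      field_simp
    -- The powers t^(σ-1), t^(-1/2) from the theta factor and t from the frequency bound combine to
    -- a Gamma integral at σ + 1/2.
    have hbd : ∀ t ∈ Ioi (0 : ℝ), ‖(t : ℂ) ^ (s - 1) • (F t - zeroFreq ν * Z t)‖ ≤
        Real.exp (-β * y) * (√Real.pi * K) *
          (t ^ (s.re + 1 / 2 - 1) * Real.exp (-(c * t))) := by
      intro t ht
      replace ht : 0 < t := ht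
      have h1 := norm_theta_sub_le hν hν1 hr₀ hr hθ0 hθ1 hY (x := x) hy ht
      rw [hθβ] at h1
      rw [norm_smul, Complex.norm_cpow_eq_rpow_re_of_pos ht, Complex.sub_re, Complex.one_re]
      refine (mul_le_mul_of_nonneg_left h1 (by positivity)).trans (le_of_eq ?_)
      have h2 : t ^ (s.re + 1 / 2 - 1) = t ^ (s.re - 1) * (t ^ (-(1 / 2) : ℝ) * t) := by
        conv_rhs => rw [← Real.rpow_add_one ht.ne', ← Real.rpow_add ht]
        congr 1; ring
      rw [h2, sqrt_pi_div ht, ← hc, hK]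
      ring
    have hbi : IntegrableOn (fun t : ℝ ↦ Real.exp (-β * y) * (√Real.pi * K) *
        (t ^ (s.re + 1 / 2 - 1) * Real.exp (-(c * t)))) (Ioi 0) :=
      (integrableOn_rpow_mul_exp (by linarith) hc0).const_mul _
    have hZi : IntegrableOn (fun t : ℝ ↦ (t : ℂ) ^ (s - 1) * Z t) (Ioi 0) := by
      by_contra h
      have h1 := integral_zeroFreq (s := s) (by linarith) hy0
      rw [integral_undef h] at h1
      have h2 : Complex.Gamma (s - 1 / 2) ≠ 0 := Complex.Gamma_ne_zero_of_re_pos (by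
        simp only [Complex.sub_re, Complex.div_ofNat_re, Complex.one_re]; linarith)
      have h3 : (y : ℂ) ^ (1 - 2 * s) ≠ 0 := by
        rw [Complex.cpow_ne_zero_iff]; left; exact_mod_cast hy0.ne'
      have h4 : (√Real.pi : ℂ) ≠ 0 := by exact_mod_cast (Real.sqrt_pos.2 hpi).ne'
      exact mul_ne_zero h3 (mul_ne_zero h4 h2) h1.symm
    have hcpow : AEStronglyMeasurable (fun t : ℝ ↦ (t : ℂ) ^ (s - 1)) (volume.restrict (Ioi 0)) := by
      refine ContinuousOn.aestronglyMeasurable (fun t ht ↦ ?_) measurableSet_Ioi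
      exact (Complex.continuousAt_ofReal_cpow_const _ _ (Or.inr (ne_of_gt ht))).continuousWithinAt
    have hFm : AEStronglyMeasurable F (volume.restrict (Ioi 0)) := by
      refine aestronglyMeasurable_of_tendsto_ae (Filter.atTop : Filter (Finset ℤ))
        (f := fun S t ↦ ∑ n ∈ S, e (-(n * ν)) * (Real.exp (-((x + n) ^ 2 + y ^ 2) * t) : ℂ)) (fun S ↦ ?_) ?_
      · exact Continuous.aestronglyMeasurable (by fun_prop)
      · refine (ae_restrict_iff' measurableSet_Ioi).2 (Filter.Eventually.of_forall fun t ht ↦ ?_)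
        exact hasSum_theta ν x y hy0 ht
    have hZm : AEStronglyMeasurable Z (volume.restrict (Ioi 0)) := by
      refine Measurable.aestronglyMeasurable ?_
      exact Complex.measurable_ofReal.comp (by fun_prop)
    have hHi : IntegrableOn (fun t : ℝ ↦ (t : ℂ) ^ (s - 1) • (F t - zeroFreq ν * Z t)) (Ioi 0) := by
      refine Integrable.mono' hbi (hcpow.smul (hFm.sub (hZm.const_mul _))) ?_
      exact (ae_restrict_iff' measurableSet_Ioi).2 (Filter.Eventually.of_forall hbd)
    have hmain : mellin F s = (∫ t in Ioi (0 : ℝ), (t : ℂ) ^ (s - 1) • (F t - zeroFreq ν * Z t)) +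
        zeroFreq ν * ((y : ℂ) ^ (1 - 2 * s) * ((√Real.pi : ℂ) * Complex.Gamma (s - 1 / 2))) := by
      rw [← integral_zeroFreq (by linarith) hy0, ← integral_const_mul, ← integral_add hHi
        (hZi.const_mul _), mellin]
      refine integral_congr_ae (Filter.Eventually.of_forall fun t ↦ ?_)
      simp only [smul_eq_mul, hZ]
      ring
    rw [hsum, hmain, show ∀ I z g g' G : ℂ, (I + z * (g * g')) / G - z * (g * (g' / G)) = I / G by
      intros; ring, norm_div, div_mul_eq_mul_div]
    have hi : ‖∫ t in Ioi (0 : ℝ), (t : ℂ) ^ (s - 1) • (F t - zeroFreq ν * Z t)‖ ≤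
        Real.exp (-β * y) * (√Real.pi * K) *
          ((1 / c) ^ (s.re + 1 / 2) * Real.Gamma (s.re + 1 / 2)) := by
      rw [← Real.integral_rpow_mul_exp_neg_mul_Ioi (by linarith) hc0, ← integral_const_mul]
      exact norm_integral_le_of_norm_le hbi
        ((ae_restrict_iff' measurableSet_Ioi).2 (Filter.Eventually.of_forall hbd))
    gcongr
    exact hi.trans (le_of_eq (by ring))

end TwistedEisenstein
end

/-! ### Sums twisted by the powers of a unitary operator -/

noncomputable section

namespace TwistedEisenstein

variable {V : Type*} [NormedAddCommGroup V] [InnerProductSpace ℂ V]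

variable {G : Type*} [Group G] {χ : G →* (V →L[ℂ] V)} {γ : G}

lemma map_zpow_apply_of_eigen {μ : ℂ} (hμ : μ ≠ 0) {v : V} (hv : χ γ v = μ • v) (n : ℤ) :
    χ (γ ^ n) v = μ ^ n • v := by
  have h1 : ∀ n : ℕ, χ (γ ^ n) v = μ ^ n • v := fun n ↦ by
    induction n with
    | zero => simp
    | succ n ih => rw [pow_succ', map_mul, mul_apply_eq_comp, ih, map_smul, hv, smul_smul, pow_succ]
  cases n with
  | ofNat n => simpa using h1 n
  | negSucc n =>
    have h2 : χ (γ ^ (n + 1))⁻¹ (χ (γ ^ (n + 1)) v) = v := by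
      rw [← mul_apply_eq_comp, ← map_mul]; simp
    rw [h1, map_smul] at h2
    rw [zpow_negSucc, zpow_negSucc]
    rw [eq_inv_smul_iff₀ (pow_ne_zero _ hμ)]
    exact h2

lemma norm_map_zpow_le (hu : ∀ v w : V, inner ℂ (χ γ v) (χ γ w) = inner ℂ v w) (n : ℤ) :
    ‖χ (γ ^ n)‖ ≤ 1 := by
  have h0 : ∀ v, ‖χ γ v‖ = ‖v‖ := fun v ↦ by
    rw [@norm_eq_sqrt_re_inner ℂ, @norm_eq_sqrt_re_inner ℂ, hu]
  have h1 : ∀ n : ℕ, ∀ v, ‖χ (γ ^ n) v‖ = ‖v‖ := fun n ↦ by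
    induction n with
    | zero => simp
    | succ n ih => intro v; rw [pow_succ', map_mul, mul_apply_eq_comp, h0, ih]
  refine ContinuousLinearMap.opNorm_le_bound _ zero_le_one fun v ↦ ?_
  rw [one_mul]
  cases n with
  | ofNat n => simpa using (h1 n v).le
  | negSucc n =>
    rw [zpow_negSucc, ← h1 (n + 1) (χ (γ ^ (n + 1))⁻¹ v), ← mul_apply_eq_comp, ← map_mul]
    simp

lemma summable_kernel_smul (hu : ∀ v w : V, inner ℂ (χ γ v) (χ γ w) = inner ℂ v w) {s : ℂ}
    (hs : 1 / 2 < s.re) (x : ℝ) {y : ℝ} (hy : 0 < y) :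
    Summable fun n : ℤ ↦ ‖(((x + n) ^ 2 + y ^ 2 : ℝ) : ℂ) ^ (-s) • χ (γ ^ (-n))‖ := by
  refine Summable.of_nonneg_of_le (fun n ↦ norm_nonneg _) (fun n ↦ ?_)
    (kernel_summable_and_le hs (by positivity : 0 < y ^ 2) x).1
  rw [norm_smul, Complex.norm_cpow_eq_rpow_re_of_pos (kernel_pos x (by positivity) n), Complex.neg_re]
  exact mul_le_of_le_one_right (Real.rpow_nonneg (kernel_pos x (by positivity) n).le _)
    (norm_map_zpow_le hu _)

variable [FiniteDimensional ℂ V]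

/-- An isometry maps an invariant subspace onto itself by dimension, so the orthogonal complement is
invariant as well. -/
lemma isSemisimple_of_inner {T : V →L[ℂ] V} (hT : ∀ v w : V, inner ℂ (T v) (T w) = inner ℂ v w) :
    Module.End.IsSemisimple (T : V →ₗ[ℂ] V) := by
  rw [Module.End.isSemisimple_iff]
  intro p hp
  refine ⟨pᗮ, ?_, Submodule.isCompl_orthogonal p⟩
  rw [Module.End.mem_invtSubmodule] at hp ⊢
  intro v hv
  rw [Submodule.mem_comap, Submodule.mem_orthogonal]
  intro w hw
  have hinj : Function.Injective (T : V →ₗ[ℂ] V) := by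
    rw [← LinearMap.ker_eq_bot, LinearMap.ker_eq_bot']
    intro m hm
    have h1 : T m = 0 := hm
    rw [← inner_self_eq_zero (𝕜 := ℂ), ← hT, h1, inner_zero_left]
  have hle : p.map (T : V →ₗ[ℂ] V) ≤ p := Submodule.map_le_iff_le_comap.2 hp
  have heq : p.map (T : V →ₗ[ℂ] V) = p := Submodule.eq_of_le_of_finrank_eq hle
    (LinearEquiv.finrank_eq (p.equivMapOfInjective _ hinj)).symm
  rw [← heq] at hw
  obtain ⟨w', hw', rfl⟩ := hw
  exact (hT w' v).trans ((Submodule.mem_orthogonal _ _).1 hv w' hw')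

lemma exists_e_eq {μ : ℂ} (hμ : ‖μ‖ = 1) : ∃ ν : ℝ, 0 ≤ ν ∧ ν < 1 ∧ μ = e ν := by
  refine ⟨Int.fract (μ.arg / (2 * Real.pi)), Int.fract_nonneg _, Int.fract_lt_one _, ?_⟩
  have h1 : μ = Complex.exp (μ.arg * Complex.I) := by
    conv_lhs => rw [← Complex.norm_mul_exp_arg_mul_I μ, hμ]
    simp
  conv_lhs => rw [h1]
  rw [e, Complex.exp_eq_exp_iff_exists_int]
  refine ⟨⌊μ.arg / (2 * Real.pi)⌋, ?_⟩
  rw [Int.fract]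
  have : (Real.pi : ℂ) ≠ 0 := by exact_mod_cast Real.pi_ne_zero
  push_cast
  field_simp
  ring

lemma e_neg_mul (ν : ℝ) (n : ℤ) : e (-(n * ν)) = e ν ^ (-n) := by
  rw [e, e, ← Complex.exp_int_mul]
  congr 1
  push_cast
  ring

lemma e_ne_one {ν : ℝ} (h0 : 0 < ν) (h1 : ν < 1) : e ν ≠ 1 := by
  rw [e, Ne, Complex.exp_eq_one_iff]
  rintro ⟨n, hn⟩
  have hpi : (2 * Real.pi * Complex.I : ℂ) ≠ 0 := Complex.two_pi_I_ne_zero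
  have h2 : (ν : ℂ) = n := by
    refine mul_left_cancel₀ hpi ?_
    rw [hn]; ring
  have h3 : ν = n := by exact_mod_cast h2
  rw [h3] at h0 h1
  have h4 : (0 : ℤ) < n := by exact_mod_cast h0
  have h5 : n < (1 : ℤ) := by exact_mod_cast h1
  omega

lemma opNorm_le_sum_stdOrthonormalBasis (D : V →L[ℂ] V) :
    ‖D‖ ≤ ∑ i, ‖D (stdOrthonormalBasis ℂ V i)‖ := by
  refine D.opNorm_le_bound (by positivity) fun v ↦ ?_
  conv_lhs => rw [← (stdOrthonormalBasis ℂ V).sum_repr v]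
  rw [map_sum, Finset.sum_mul]
  refine norm_sum_le_of_le _ fun i _ ↦ ?_
  rw [map_smul, norm_smul, mul_comm]
  gcongr
  have := norm_inner_le_norm (𝕜 := ℂ) (stdOrthonormalBasis ℂ V i) v
  rwa [OrthonormalBasis.norm_eq_one, one_mul, ← OrthonormalBasis.repr_apply_apply] at this

/-- The difference between the twisted sum of `|z| ^ (-2s)` over integer translates and its zero
frequency. -/
def kernelDefect (χ : G →* (V →L[ℂ] V)) (γ : G) (F : Submodule ℂ V) (s : ℂ) (x y : ℝ) : V →L[ℂ] V :=
  ∑' n : ℤ, (((x + n) ^ 2 + y ^ 2 : ℝ) : ℂ) ^ (-s) • χ (γ ^ (-n)) -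
    ((y : ℂ) ^ (1 - 2 * s) * ((√Real.pi : ℂ) * Complex.Gamma (s - 1 / 2) / Complex.Gamma s)) •
      F.starProjection

lemma kernelDefect_apply (hu : ∀ v w : V, inner ℂ (χ γ v) (χ γ w) = inner ℂ v w)
    (F : Submodule ℂ V) {s : ℂ} (hs : 1 < s.re) (x : ℝ) {y : ℝ} (hy : 0 < y) (v : V) :
    kernelDefect χ γ F s x y v =
      ∑' n : ℤ, (((x + n) ^ 2 + y ^ 2 : ℝ) : ℂ) ^ (-s) • χ (γ ^ (-n)) v -
        ((y : ℂ) ^ (1 - 2 * s) * ((√Real.pi : ℂ) * Complex.Gamma (s - 1 / 2) / Complex.Gamma s)) •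
          F.starProjection v := by
  have := FiniteDimensional.complete ℂ V
  have h1 := (summable_kernel_smul hu (s := s) (by linarith) x hy).of_norm
  have h2 : (∑' n : ℤ, (((x + n) ^ 2 + y ^ 2 : ℝ) : ℂ) ^ (-s) • χ (γ ^ (-n))) v =
      ∑' n : ℤ, ((((x + n) ^ 2 + y ^ 2 : ℝ) : ℂ) ^ (-s) • χ (γ ^ (-n))) v :=
    (ContinuousLinearMap.apply ℂ V v).map_tsum h1
  rw [kernelDefect, sub_apply, h2]
  rfl

/-- Eigenvectors with eigenvalue different from 1 are orthogonal to the fixed vectors. Thus the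
projection acts as the indicator of a zero frequency. -/
lemma starProjection_apply_of_eigen (hu : ∀ v w : V, inner ℂ (χ γ v) (χ γ w) = inner ℂ v w)
    {F : Submodule ℂ V} (hF : ∀ v, v ∈ F ↔ χ γ v = v) {ν : ℝ} (hν0 : 0 ≤ ν) (hν1 : ν < 1) {v : V}
    (hv : χ γ v = e ν • v) : F.starProjection v = zeroFreq ν • v := by
  rw [zeroFreq]
  split_ifs with h
  · rw [one_smul]
    refine Submodule.starProjection_eq_self_iff.2 ((hF v).2 ?_)
    rw [hv, h]; simp [e]
  · rw [zero_smul]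
    have h2 := e_ne_one (lt_of_le_of_ne hν0 (Ne.symm h)) hν1
    change v ∈ (F.starProjection : V →ₗ[ℂ] V).ker
    rw [Submodule.ker_starProjection, Submodule.mem_orthogonal]
    intro w hw
    have h3 := hu w v
    rw [(hF w).1 hw, hv, inner_smul_right] at h3
    have h4 : (e ν - 1) * inner ℂ w v = 0 := by rw [sub_mul, h3, one_mul, sub_self]
    exact (mul_eq_zero.1 h4).resolve_left (sub_ne_zero.2 h2)

/-- The nonzero frequencies m + ν have absolute value at least 1 if ν = 0, and at least min(ν, 1 -
ν) otherwise. -/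
lemma exists_dist_int_bound {ν β : ℝ} (hν0 : 0 ≤ ν) (hβ1 : β < 2 * Real.pi)
    (h : 0 < ν → β < 2 * Real.pi * ν ∧ β < 2 * Real.pi * (1 - ν)) :
    ∃ r₀ : ℝ, (∀ m : ℤ, (m : ℝ) + ν ≠ 0 → r₀ ≤ |(m : ℝ) + ν|) ∧ β < 2 * Real.pi * r₀ := by
  rcases hν0.eq_or_lt with rfl | h0
  · refine ⟨1, fun m hm ↦ ?_, by linarith⟩
    rw [add_zero] at hm ⊢
    have : (1 : ℤ) ≤ |m| := Int.one_le_abs (by exact_mod_cast hm)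
    exact_mod_cast this
  · obtain ⟨h1, h2⟩ := h h0
    refine ⟨min ν (1 - ν), fun m _ ↦ ?_, ?_⟩
    · rcases le_or_gt 0 m with hm | hm
      · have hm' : (0 : ℝ) ≤ m := by exact_mod_cast hm
        exact (min_le_left _ _).trans ((by linarith : ν ≤ m + ν).trans (le_abs_self _))
      · have hm' : (m : ℝ) ≤ -1 := by exact_mod_cast (by omega : m ≤ -1)
        exact (min_le_right _ _).trans ((by linarith : 1 - ν ≤ -(m + ν)).trans (neg_le_abs _))
    · rcases min_cases ν (1 - ν) with h3 | h3 <;> rw [h3.1] <;> assumption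

lemma exists_norm_kernelDefect_apply_le_of_eigen
    (hu : ∀ v w : V, inner ℂ (χ γ v) (χ γ w) = inner ℂ v w) {F : Submodule ℂ V}
    (hF : ∀ v, v ∈ F ↔ χ γ v = v) {ν β Y : ℝ} (hν0 : 0 ≤ ν) (hν1 : ν < 1) (hβ : 0 < β)
    (hβ1 : β < 2 * Real.pi) (h : 0 < ν → β < 2 * Real.pi * ν ∧ β < 2 * Real.pi * (1 - ν))
    (hY : 0 < Y) {v : V} (hv : χ γ v = e ν • v) :
    ∃ C : ℂ → ℝ, ContinuousOn C {s | 1 < s.re} ∧ ∀ s : ℂ, 1 < s.re → ∀ x y : ℝ, Y ≤ y →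
      ‖kernelDefect χ γ F s x y v‖ ≤ C s * Real.exp (-β * y) := by
  obtain ⟨r₀, hr, hβr⟩ := exists_dist_int_bound hν0 hβ1 h
  obtain ⟨C, hC, hC'⟩ := exists_norm_tsum_kernel_sub_le hν0 hν1 hr hβ hβr hY
  refine ⟨fun s ↦ C s * ‖v‖, hC.mul continuousOn_const, fun s hs x y hy ↦ ?_⟩
  have hy0 := hY.trans_le hy
  have hs' : Summable fun n : ℤ ↦ (((x + n) ^ 2 + y ^ 2 : ℝ) : ℂ) ^ (-s) * e (-(n * ν)) := by
    refine Summable.of_norm ((kernel_summable_and_le (σ := s.re) (by linarith)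
      (by positivity : 0 < y ^ 2) x).1.congr fun n ↦ ?_)
    rw [norm_mul, norm_e, Complex.norm_cpow_eq_rpow_re_of_pos (kernel_pos x (by positivity) n),
      Complex.neg_re, mul_one]
  have h1 : ∀ n : ℤ, (((x + n) ^ 2 + y ^ 2 : ℝ) : ℂ) ^ (-s) • χ (γ ^ (-n)) v =
      ((((x + n) ^ 2 + y ^ 2 : ℝ) : ℂ) ^ (-s) * e (-(n * ν))) • v := fun n ↦ by
    rw [map_zpow_apply_of_eigen (e_ne_zero ν) hv (-n), ← e_neg_mul, smul_smul]
  rw [kernelDefect_apply hu F hs x hy0, starProjection_apply_of_eigen hu hF hν0 hν1 hv, smul_smul,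
    tsum_congr h1, hs'.tsum_smul_const, ← sub_smul, norm_smul, mul_right_comm (C s),
    mul_comm _ (zeroFreq ν)]
  exact mul_le_mul_of_nonneg_right (hC' s hs x y hy) (norm_nonneg _)

/-- The sum over integer translates of `|z| ^ (-2s)`, twisted by the powers of a unitary operator,
is equal to a multiple of the projection onto the fixed vectors up to an exponentially small
error. -/
theorem exists_norm_kernelDefect_le
    (hu : ∀ v w : V, inner ℂ (χ γ v) (χ γ w) = inner ℂ v w) {F : Submodule ℂ V}
    (hF : ∀ v, v ∈ F ↔ χ γ v = v) {β Y : ℝ} (hβ : 0 < β) (hβ1 : β < 2 * Real.pi)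
    (hβν : ∀ ν : ℝ, 0 < ν → ν < 1 → Module.End.HasEigenvalue (χ γ : V →ₗ[ℂ] V) (e ν) →
      β < 2 * Real.pi * ν ∧ β < 2 * Real.pi * (1 - ν)) (hY : 0 < Y) :
    ∃ C : ℂ → ℝ, ContinuousOn C {s | 1 < s.re} ∧ ∀ s : ℂ, 1 < s.re → ∀ x y : ℝ, Y ≤ y →
      ‖kernelDefect χ γ F s x y‖ ≤ C s * Real.exp (-β * y) := by
  -- The vectors that satisfy the estimate with some constant form a subspace. It contains all
  -- eigenvectors, which span; an orthonormal basis then gives the operator norm.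
  let W : Submodule ℂ V :=
    { carrier := {v | ∃ C : ℂ → ℝ, ContinuousOn C {s | 1 < s.re} ∧ ∀ s : ℂ, 1 < s.re → ∀ x y : ℝ,
        Y ≤ y → ‖kernelDefect χ γ F s x y v‖ ≤ C s * Real.exp (-β * y)}
      add_mem' := by
        rintro v w ⟨C, hC, hC'⟩ ⟨C₁, hC₁, hC₁'⟩
        refine ⟨fun s ↦ C s + C₁ s, hC.add hC₁, fun s hs x y hy ↦ ?_⟩
        rw [map_add, add_mul]
        exact (norm_add_le _ _).trans (add_le_add (hC' s hs x y hy) (hC₁' s hs x y hy))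
      zero_mem' := ⟨fun _ ↦ 0, continuousOn_const, fun s hs x y hy ↦ by simp⟩
      smul_mem' := by
        rintro c v ⟨C, hC, hC'⟩
        refine ⟨fun s ↦ ‖c‖ * C s, continuousOn_const.mul hC, fun s hs x y hy ↦ ?_⟩
        rw [map_smul, norm_smul, mul_assoc]
        exact mul_le_mul_of_nonneg_left (hC' s hs x y hy) (norm_nonneg _) }
  have heig : ∀ μ : ℂ, Module.End.eigenspace (χ γ : V →ₗ[ℂ] V) μ ≤ W := by
    intro μ v hv
    by_cases hv0 : v = 0
    · rw [hv0]; exact W.zero_mem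
    have hev : Module.End.HasEigenvalue (χ γ : V →ₗ[ℂ] V) μ :=
      Module.End.hasEigenvalue_of_hasEigenvector ⟨hv, hv0⟩
    have hv' : χ γ v = μ • v := Module.End.mem_eigenspace_iff.1 hv
    have hn : ‖μ‖ = 1 := by
      have h0 : ‖χ γ v‖ = ‖v‖ := by
        rw [@norm_eq_sqrt_re_inner ℂ, @norm_eq_sqrt_re_inner ℂ, hu]
      rw [hv', norm_smul] at h0
      exact (mul_eq_right₀ (norm_ne_zero_iff.2 hv0)).1 h0
    obtain ⟨ν, hν0, hν1, rfl⟩ := exists_e_eq hn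
    exact exists_norm_kernelDefect_apply_le_of_eigen hu hF hν0 hν1 hβ hβ1
      (fun h ↦ hβν ν h hν1 hev) hY hv'
  have htop : W = ⊤ := by
    rw [eq_top_iff, ← (isSemisimple_of_inner hu).iSup_eigenspace_eq_top]
    exact iSup_le heig
  have hall : ∀ v, v ∈ W := fun v ↦ htop ▸ Submodule.mem_top
  choose C hC hC' using fun i ↦ hall (stdOrthonormalBasis ℂ V i)
  refine ⟨fun s ↦ ∑ i, C i s, continuousOn_finsetSum _ fun i _ ↦ hC i, fun s hs x y hy ↦ ?_⟩
  refine (opNorm_le_sum_stdOrthonormalBasis _).trans ?_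
  rw [Finset.sum_mul]
  exact Finset.sum_le_sum fun i _ ↦ hC' i s hs x y hy

end TwistedEisenstein
end

/-! ### Lower rows: Shimizu's lemma, separation, and counting -/

noncomputable section

namespace TwistedEisenstein

section Rows

variable {Γ : Subgroup SL(2, ℝ)} {a b : OnePoint ℝ} {σ σa σb : SL(2, ℝ)}

lemma conj_unip_one_apply (h : SL(2, ℝ)) :
    (h * unip 1 * h⁻¹) 0 0 = 1 - h 0 0 * h 1 0 ∧ (h * unip 1 * h⁻¹) 0 1 = h 0 0 ^ 2 ∧
      (h * unip 1 * h⁻¹) 1 0 = -h 1 0 ^ 2 ∧ (h * unip 1 * h⁻¹) 1 1 = 1 + h 0 0 * h 1 0 := by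
  obtain ⟨a1, a2, a3, a4⟩ := inv_apply_two h
  obtain ⟨b1, b2, b3, b4⟩ := unip_apply 1
  have hd := det_eq h
  simp only [mul_apply_two, a1, a2, a3, a4, b1, b2, b3, b4]
  refine ⟨?_, ?_, ?_, ?_⟩ <;> linarith

/-- Shimizu's lemma. -/
lemma IsScaling.one_le_abs [DiscreteTopology Γ] (h : IsScaling Γ a σ) {γ : SL(2, ℝ)} (hγ : γ ∈ Γ)
    (hc : (σ⁻¹ * γ * σ) 1 0 ≠ 0) : 1 ≤ |(σ⁻¹ * γ * σ) 1 0| := by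
  by_contra! hlt
  set g := σ⁻¹ * γ * σ with hg
  set c := |g 1 0| with hcdef
  have hc0 : 0 < c := abs_pos.2 hc
  -- A bound for the upper left entry that the iteration k ↦ k n(1) k⁻¹ preserves, because 1 + A c ≤
  -- A.
  set A := max |g 0 0| (1 / (1 - c)) with hA
  have hA0 : 0 ≤ A := (abs_nonneg _).trans (le_max_left _ _)
  have hA1 : 1 + A * c ≤ A := by
    have h1 : 1 / (1 - c) ≤ A := le_max_right _ _
    rw [div_le_iff₀ (by linarith)] at h1
    linarith
  set R := max (mu g) ((1 + A) ^ 2 + (A ^ 2) ^ 2 + 1 + (1 + A) ^ 2) with hR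
  set S := {δ : SL(2, ℝ) | δ ∈ Γ ∧ mu (σ⁻¹ * δ * σ) ≤ R ∧ |(σ⁻¹ * δ * σ) 0 0| ≤ A ∧
    (σ⁻¹ * δ * σ) 1 0 ≠ 0 ∧ |(σ⁻¹ * δ * σ) 1 0| ≤ c} with hS
  have hfin : S.Finite := (finite_conj_mu_le Γ σ R).subset fun δ hδ ↦ ⟨hδ.1, hδ.2.1⟩
  have hne : S.Nonempty := ⟨γ, hγ, le_max_left _ _, le_max_left _ _, hc, le_rfl⟩
  -- The iteration squares the lower left entry in absolute value and stays in the finite set S,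
  -- which contradicts minimality when that entry is below 1.
  obtain ⟨δ, ⟨hδ, -, hδA, hδ0, hδc⟩, hmin⟩ :=
    Set.exists_min_image S (fun δ ↦ |(σ⁻¹ * δ * σ) 1 0|) hfin hne
  set k := σ⁻¹ * δ * σ with hk
  have hk0 : 0 < |k 1 0| := abs_pos.2 hδ0
  obtain ⟨a1, a2, a3, a4⟩ := conj_unip_one_apply k
  have hnew : σ⁻¹ * (δ * (σ * unip 1 * σ⁻¹) * δ⁻¹) * σ = k * unip 1 * k⁻¹ := by
    rw [hk]; group
  have hp : |k 0 0 * k 1 0| ≤ A * c := by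
    rw [abs_mul]; exact mul_le_mul hδA hδc (abs_nonneg _) hA0
  have hp' : |k 0 0 * k 1 0| ≤ A := by nlinarith
  have hsq : |k 1 0| ^ 2 < |k 1 0| := by nlinarith
  have hmem : δ * (σ * unip 1 * σ⁻¹) * δ⁻¹ ∈ S := by
    refine ⟨Γ.mul_mem (Γ.mul_mem hδ (by simpa using (h.unip_mem 1).1)) (Γ.inv_mem hδ), ?_⟩
    rw [hnew, a1, a3]
    refine ⟨le_max_of_le_right ?_, ?_, ?_, ?_⟩
    · rw [mu, a1, a2, a3, a4]
      have h1 : (1 - k 0 0 * k 1 0) ^ 2 ≤ (1 + A) ^ 2 := by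
        nlinarith [abs_le.1 hp']
      have h2 : (1 + k 0 0 * k 1 0) ^ 2 ≤ (1 + A) ^ 2 := by
        nlinarith [abs_le.1 hp']
      have h3 : (k 0 0 ^ 2) ^ 2 ≤ (A ^ 2) ^ 2 :=
        pow_le_pow_left₀ (sq_nonneg _) (sq_le_sq.2 (hδA.trans (le_abs_self A))) 2
      have h4 : (-k 1 0 ^ 2) ^ 2 ≤ 1 := by
        have h5 : k 1 0 ^ 2 ≤ 1 := by rw [← sq_abs]; nlinarith
        nlinarith [sq_nonneg (k 1 0)]
      linarith
    · have := abs_sub (1 : ℝ) (k 0 0 * k 1 0)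
      rw [abs_one] at this
      linarith
    · exact neg_ne_zero.2 (pow_ne_zero _ hδ0)
    · rw [abs_neg, abs_pow]; linarith
  have := hmin _ hmem
  rw [hnew, a3, abs_neg, abs_pow] at this
  linarith

lemma IsScaling.smul_eq_of_lower_eq_zero (h : IsScaling Γ a σ) {γ : SL(2, ℝ)}
    (hc : (σ⁻¹ * γ * σ) 1 0 = 0) : slToGL γ • a = a := by
  have h1 : slToGL (σ⁻¹ * γ * σ) • (OnePoint.infty : OnePoint ℝ) = OnePoint.infty := by
    rw [OnePoint.smul_infty_eq_self_iff]; exact hc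
  rw [map_mul, map_mul, mul_smul, mul_smul, h.map_infty, map_inv, inv_smul_eq_iff, h.map_infty] at h1
  exact h1

lemma IsScaling.exists_unip (h : IsScaling Γ a σ) {γ : Γ} (hγ : γ ∈ stab Γ a) :
    ∃ k : ℤ, σ⁻¹ * (γ : SL(2, ℝ)) * σ = unip k ∨ σ⁻¹ * (γ : SL(2, ℝ)) * σ = -unip k :=
  (h.conj_stab _).1 ⟨γ.2, hγ⟩

/-- The determinant of two lower rows is itself a lower left entry in σ_a⁻¹Γσ_a, so Shimizu's lemma
applies to it: it is zero or at least 1 in absolute value. -/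
lemma lower_mul_inv (γ δ : SL(2, ℝ)) (σa σb : SL(2, ℝ)) :
    (σa⁻¹ * (γ * δ⁻¹) * σa) 1 0 = (σa⁻¹ * γ * σb) 1 0 * (σa⁻¹ * δ * σb) 1 1 -
      (σa⁻¹ * γ * σb) 1 1 * (σa⁻¹ * δ * σb) 1 0 := by
  rw [show σa⁻¹ * (γ * δ⁻¹) * σa = (σa⁻¹ * γ * σb) * (σa⁻¹ * δ * σb)⁻¹ by group, mul_apply_two]
  obtain ⟨a1, a2, a3, a4⟩ := inv_apply_two (σa⁻¹ * δ * σb)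
  rw [a1, a3]; ring

lemma neg_apply_two (g : SL(2, ℝ)) (i j : Fin 2) : (-g) i j = -g i j := by simp

/-- Elements of the same coset have the same lower rows, up to sign. -/
lemma IsScaling.lower_eq_or_neg (h : IsScaling Γ a σa) {γ δ : Γ} (hγ : γ * δ⁻¹ ∈ stab Γ a)
    (σb : SL(2, ℝ)) :
    ((σa⁻¹ * (γ : SL(2, ℝ)) * σb) 1 0 = (σa⁻¹ * (δ : SL(2, ℝ)) * σb) 1 0 ∧
      (σa⁻¹ * (γ : SL(2, ℝ)) * σb) 1 1 = (σa⁻¹ * (δ : SL(2, ℝ)) * σb) 1 1) ∨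
    ((σa⁻¹ * (γ : SL(2, ℝ)) * σb) 1 0 = -(σa⁻¹ * (δ : SL(2, ℝ)) * σb) 1 0 ∧
      (σa⁻¹ * (γ : SL(2, ℝ)) * σb) 1 1 = -(σa⁻¹ * (δ : SL(2, ℝ)) * σb) 1 1) := by
  obtain ⟨k, hk⟩ := h.exists_unip hγ
  obtain ⟨b1, b2, b3, b4⟩ := unip_apply k
  have h1 : σa⁻¹ * (γ : SL(2, ℝ)) * σb =
      (σa⁻¹ * ((γ * δ⁻¹ : Γ) : SL(2, ℝ)) * σa) * (σa⁻¹ * (δ : SL(2, ℝ)) * σb) := by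
    push_cast; group
  rw [h1]
  rcases hk with hk | hk <;> rw [hk] <;> simp only [mul_apply_two, neg_apply_two, b3, b4]
  · left; constructor <;> ring
  · right; constructor <;> ring

lemma IsScaling.mul_inv_mem_stab (h : IsScaling Γ a σa) {γ δ : Γ} (σb : SL(2, ℝ))
    (h0 : (σa⁻¹ * (γ : SL(2, ℝ)) * σb) 1 0 * (σa⁻¹ * (δ : SL(2, ℝ)) * σb) 1 1 -
      (σa⁻¹ * (γ : SL(2, ℝ)) * σb) 1 1 * (σa⁻¹ * (δ : SL(2, ℝ)) * σb) 1 0 = 0) :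
    γ * δ⁻¹ ∈ stab Γ a := by
  rw [mem_stab]
  refine h.smul_eq_of_lower_eq_zero ?_
  push_cast
  rw [lower_mul_inv _ _ σa σb, h0]

lemma IsScaling.one_le_abs_cross [DiscreteTopology Γ] (h : IsScaling Γ a σa) (γ δ : Γ)
    (σb : SL(2, ℝ))
    (h0 : (σa⁻¹ * (γ : SL(2, ℝ)) * σb) 1 0 * (σa⁻¹ * (δ : SL(2, ℝ)) * σb) 1 1 -
      (σa⁻¹ * (γ : SL(2, ℝ)) * σb) 1 1 * (σa⁻¹ * (δ : SL(2, ℝ)) * σb) 1 0 ≠ 0) :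
    1 ≤ |(σa⁻¹ * (γ : SL(2, ℝ)) * σb) 1 0 * (σa⁻¹ * (δ : SL(2, ℝ)) * σb) 1 1 -
      (σa⁻¹ * (γ : SL(2, ℝ)) * σb) 1 1 * (σa⁻¹ * (δ : SL(2, ℝ)) * σb) 1 0| := by
  rw [← lower_mul_inv _ _ σa σb] at h0 ⊢
  exact h.one_le_abs (Γ.mul_mem γ.2 (Γ.inv_mem δ.2)) h0

/-- The generator `σ n(1) σ⁻¹` of the stabilizer of a cusp. -/
def IsScaling.gen (h : IsScaling Γ a σ) : Γ :=
  ⟨σ * unip 1 * σ⁻¹, by simpa using (h.unip_mem 1).1⟩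

lemma IsScaling.gen_mem_stab (h : IsScaling Γ a σ) : h.gen ∈ stab Γ a := by
  rw [mem_stab]; simpa [IsScaling.gen] using (h.unip_mem 1).2

lemma unip_pow (n : ℕ) : unip 1 ^ n = unip n := by
  induction n with
  | zero => simp [unip_zero]
  | succ n ih => rw [pow_succ, ih, ← unip_add]; push_cast; rfl

lemma unip_zpow (n : ℤ) : unip 1 ^ n = unip n := by
  cases n with
  | ofNat n => simpa using unip_pow n
  | negSucc n => rw [zpow_negSucc, unip_pow, unip_inv]; push_cast; rfl

lemma IsScaling.coe_gen_zpow (h : IsScaling Γ a σ) (n : ℤ) :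
    ((h.gen ^ n : Γ) : SL(2, ℝ)) = σ * unip n * σ⁻¹ := by
  rw [Subgroup.coe_zpow, ← unip_zpow, ← conj_zpow]; rfl

lemma IsScaling.mul_gen_zpow (h : IsScaling Γ b σb) (σa : SL(2, ℝ)) (γ : Γ) (n : ℤ) :
    σa⁻¹ * ((γ * h.gen ^ n : Γ) : SL(2, ℝ)) * σb = (σa⁻¹ * (γ : SL(2, ℝ)) * σb) * unip n := by
  rw [Subgroup.coe_mul, h.coe_gen_zpow]; group

lemma IsScaling.mul_gen_zpow_lower (h : IsScaling Γ b σb) (σa : SL(2, ℝ)) (γ : Γ) (n : ℤ) :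
    (σa⁻¹ * ((γ * h.gen ^ n : Γ) : SL(2, ℝ)) * σb) 1 0 = (σa⁻¹ * (γ : SL(2, ℝ)) * σb) 1 0 ∧
    (σa⁻¹ * ((γ * h.gen ^ n : Γ) : SL(2, ℝ)) * σb) 1 1 =
      (σa⁻¹ * (γ : SL(2, ℝ)) * σb) 1 0 * n + (σa⁻¹ * (γ : SL(2, ℝ)) * σb) 1 1 := by
  obtain ⟨b1, b2, b3, b4⟩ := unip_apply n
  rw [h.mul_gen_zpow]
  constructor <;> rw [mul_apply_two] <;> simp only [b1, b2, b3, b4] <;> ring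

/-- The rows (c, d) and (c, c + d) both occur, and their determinant is c² up to sign. -/
lemma one_le_of_mem_moduli [DiscreteTopology Γ] (ha : IsScaling Γ a σa) (hb : IsScaling Γ b σb)
    {c : ℝ} (hc : c ∈ moduli Γ σa σb) : 1 ≤ c := by
  obtain ⟨h0, γ, hγ⟩ := hc
  obtain ⟨h1, h2⟩ := hb.mul_gen_zpow_lower σa γ 1
  have hcross := ha.one_le_abs_cross γ (γ * hb.gen ^ (1 : ℤ)) σb
  rw [h1, h2, hγ] at hcross
  have he : ∀ d : ℝ, c * (c * ((1 : ℤ) : ℝ) + d) - d * c = c ^ 2 := fun d ↦ by push_cast; ring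
  rw [he, abs_of_pos (by positivity)] at hcross
  have := hcross (by positivity)
  nlinarith

/-- The lower rows `(c, d)` with `c > 0` and `0 ≤ d < c` of elements of `σa⁻¹ Γ σb`. -/
abbrev LowerRow (Γ : Subgroup SL(2, ℝ)) (σa σb : SL(2, ℝ)) : Type :=
  Σ c : moduli Γ σa σb, residues Γ σa σb c

lemma omegaElt_lower {c : ℝ} (d : residues Γ σa σb c) :
    (σa⁻¹ * (omegaElt d : SL(2, ℝ)) * σb) 1 0 = c ∧
      (σa⁻¹ * (omegaElt d : SL(2, ℝ)) * σb) 1 1 = d :=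
  d.2.2.choose_spec

lemma LowerRow.ext_val {i j : LowerRow Γ σa σb} (h1 : (i.1 : ℝ) = j.1) (h2 : (i.2 : ℝ) = j.2) :
    i = j := by
  obtain ⟨⟨c, hc⟩, ⟨d, hd⟩⟩ := i
  obtain ⟨⟨c', hc'⟩, ⟨d', hd'⟩⟩ := j
  obtain rfl : c = c' := h1
  obtain rfl : d = d' := h2
  rfl

lemma lowerRow_eq (ha : IsScaling Γ a σa) {i j : LowerRow Γ σa σb}
    (h : (i.1 : ℝ) * j.2 - i.2 * j.1 = 0) : i = j := by
  obtain ⟨i1, i2⟩ := omegaElt_lower i.2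
  obtain ⟨j1, j2⟩ := omegaElt_lower j.2
  have h1 := ha.lower_eq_or_neg (ha.mul_inv_mem_stab (γ := omegaElt i.2) (δ := omegaElt j.2) σb
    (by rw [i1, i2, j1, j2, h])) σb
  rw [i1, i2, j1, j2] at h1
  rcases h1 with h1 | h1
  · exact LowerRow.ext_val h1.1 h1.2
  · have := i.1.2.1
    have := j.1.2.1
    linarith [h1.1]

/-- For c, c' ≤ R, distinct fractions d/c and d'/c' in [0, 1) differ by at least 1/(cc') ≥ R⁻².
Hence the integer part of R² d/c determines the row. -/
lemma card_lowerRow_le [DiscreteTopology Γ] (ha : IsScaling Γ a σa) (F : Finset (LowerRow Γ σa σb))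
    {R : ℝ} (hR : 1 ≤ R) (hF : ∀ i ∈ F, (i.1 : ℝ) ≤ R) : (F.card : ℝ) ≤ 2 * R ^ 2 := by
  let f : LowerRow Γ σa σb → ℕ := fun i ↦ ⌊R ^ 2 * ((i.2 : ℝ) / i.1)⌋₊
  have hpos : ∀ i : LowerRow Γ σa σb, 0 ≤ R ^ 2 * ((i.2 : ℝ) / i.1) := fun i ↦
    mul_nonneg (sq_nonneg _) (div_nonneg i.2.2.1.1 i.1.2.1.le)
  have hmaps : ∀ i ∈ F, f i ∈ Finset.range ⌈R ^ 2⌉₊ := by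
    intro i _
    rw [Finset.mem_range, Nat.floor_lt (hpos i)]
    have h1 : (i.2 : ℝ) / i.1 < 1 := (div_lt_one i.1.2.1).2 i.2.2.1.2
    exact (mul_lt_of_lt_one_right (by positivity) h1).trans_le (Nat.le_ceil _)
  have hinj : Set.InjOn f F := by
    intro i hi j hj hij
    by_contra hne
    obtain ⟨i1, i2⟩ := omegaElt_lower i.2
    obtain ⟨j1, j2⟩ := omegaElt_lower j.2
    have h1 := ha.one_le_abs_cross (omegaElt i.2) (omegaElt j.2) σb
    rw [i1, i2, j1, j2] at h1
    replace h1 := h1 fun h ↦ hne (lowerRow_eq ha h)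
    have hi0 := i.1.2.1
    have hj0 := j.1.2.1
    have h2 : |R ^ 2 * ((j.2 : ℝ) / j.1) - R ^ 2 * ((i.2 : ℝ) / i.1)| < 1 :=
      Int.abs_sub_lt_one_of_floor_eq_floor (by
        rw [← Int.natCast_floor_eq_floor (hpos i), ← Int.natCast_floor_eq_floor (hpos j)]
        exact_mod_cast hij.symm)
    have h3 : R ^ 2 * ((j.2 : ℝ) / j.1) - R ^ 2 * ((i.2 : ℝ) / i.1) =
        (R ^ 2 / (i.1 * j.1)) * (i.1 * j.2 - i.2 * j.1) := by
      field_simp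
    rw [h3, abs_mul] at h2
    have h4 : 1 ≤ R ^ 2 / ((i.1 : ℝ) * j.1) := by
      rw [one_le_div (by positivity)]
      nlinarith [hF i hi, hF j hj]
    rw [abs_of_pos (by linarith)] at h2
    nlinarith
  have h1 := Finset.card_le_card_of_injOn f hmaps hinj
  rw [Finset.card_range] at h1
  have h2 : (F.card : ℝ) ≤ (⌈R ^ 2⌉₊ : ℝ) := by exact_mod_cast h1
  have h3 := Nat.ceil_lt_add_one (sq_nonneg R)
  nlinarith

lemma finite_residues [DiscreteTopology Γ] (ha : IsScaling Γ a σa) (hb : IsScaling Γ b σb) {c : ℝ}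
    (hc : c ∈ moduli Γ σa σb) : (residues Γ σa σb c).Finite := by
  by_contra hinf
  have : Infinite (residues Γ σa σb c) := Set.infinite_coe_iff.2 hinf
  obtain ⟨F, hF⟩ := Infinite.exists_subset_card_eq (residues Γ σa σb c) (⌊2 * c ^ 2⌋₊ + 1)
  have h1 := card_lowerRow_le ha (F.map ⟨fun d ↦ (⟨⟨c, hc⟩, d⟩ : LowerRow Γ σa σb), fun d d' h ↦ by
    simpa using h⟩) (one_le_of_mem_moduli ha hb hc) (fun i hi ↦ by
      obtain ⟨d, -, rfl⟩ := Finset.mem_map.1 hi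
      exact le_rfl)
  rw [Finset.card_map, hF] at h1
  have := Nat.lt_floor_add_one (2 * c ^ 2)
  push_cast at h1
  linarith

/-- A Dirichlet series over a set of quadratic growth. -/
lemma summable_and_tsum_le_of_card_le {I : Type*} {c : I → ℝ} (h1 : ∀ i, 1 ≤ c i)
    (hcard : ∀ (F : Finset I) (R : ℝ), 1 ≤ R → (∀ i ∈ F, c i ≤ R) → (F.card : ℝ) ≤ 2 * R ^ 2)
    {τ : ℝ} (hτ : 1 < τ) :
    Summable (fun i ↦ c i ^ (-(2 * τ))) ∧ ∑' i, c i ^ (-(2 * τ)) ≤ 8 * (1 - 4 ^ (1 - τ))⁻¹ := by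
  have hr0 : (0 : ℝ) ≤ 4 ^ (1 - τ) := by positivity
  have hr1 : (4 : ℝ) ^ (1 - τ) < 1 := Real.rpow_lt_one_of_one_lt_of_neg (by norm_num) (by linarith)
  have hnn : ∀ i, 0 ≤ c i ^ (-(2 * τ)) := fun i ↦ Real.rpow_nonneg (by linarith [h1 i]) _
  have key : ∀ F : Finset I, ∑ i ∈ F, c i ^ (-(2 * τ)) ≤ 8 * (1 - 4 ^ (1 - τ))⁻¹ := by
    classical
    intro F
    let k : I → ℕ := fun i ↦ Nat.log 2 ⌊c i⌋₊
    have hk1 : ∀ i, (2 : ℝ) ^ k i ≤ c i := fun i ↦ by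
      have : 2 ^ k i ≤ ⌊c i⌋₊ := Nat.pow_log_le_self 2 (by
        have := Nat.le_floor (by exact_mod_cast h1 i : ((1 : ℕ) : ℝ) ≤ c i); omega)
      have h2 : ((2 ^ k i : ℕ) : ℝ) ≤ c i :=
        (Nat.cast_le.2 this).trans (Nat.floor_le (by linarith [h1 i]))
      exact_mod_cast h2
    have hk2 : ∀ i, c i ≤ (2 : ℝ) ^ (k i + 1) := fun i ↦ by
      have : ⌊c i⌋₊ + 1 ≤ 2 ^ (k i + 1) := Nat.lt_pow_succ_log_self (by norm_num) _
      have h2 : ((⌊c i⌋₊ + 1 : ℕ) : ℝ) ≤ ((2 ^ (k i + 1) : ℕ) : ℝ) := Nat.cast_le.2 this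
      push_cast at h2
      linarith [Nat.lt_floor_add_one (c i)]
    rw [← Finset.sum_fiberwise_of_maps_to (t := F.image k) (g := k)
      fun i hi ↦ Finset.mem_image_of_mem k hi]
    calc ∑ m ∈ F.image k, ∑ i ∈ F with k i = m, c i ^ (-(2 * τ))
        -- The dyadic block c ∈ [2^m, 2^(m+1)] has at most 2 · 4^(m+1) elements, each contributing
        -- at most 2^(-2τm).
        ≤ ∑ m ∈ F.image k, 8 * ((4 : ℝ) ^ (1 - τ)) ^ m := by
          refine Finset.sum_le_sum fun m _ ↦ ?_
          have hc1 : ((F.filter fun i ↦ k i = m).card : ℝ) ≤ 2 * ((2 : ℝ) ^ (m + 1)) ^ 2 := by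
            refine hcard _ _ (one_le_pow₀ (by norm_num)) fun i hi ↦ ?_
            rw [← (Finset.mem_filter.1 hi).2]
            exact hk2 i
          have hc2 : ∀ i ∈ F.filter (fun i ↦ k i = m), c i ^ (-(2 * τ)) ≤
              ((2 : ℝ) ^ m) ^ (-(2 * τ)) := fun i hi ↦ by
            rw [← (Finset.mem_filter.1 hi).2]
            exact Real.rpow_le_rpow_of_nonpos (by positivity) (hk1 i) (by linarith)
          refine (Finset.sum_le_card_nsmul _ _ _ hc2).trans ?_
          rw [nsmul_eq_mul]
          refine (mul_le_mul_of_nonneg_right hc1 (by positivity)).trans (le_of_eq ?_)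
          have e1 : ((2 : ℝ) ^ m) ^ (-(2 * τ)) = (2 : ℝ) ^ (-(2 * τ * m)) := by
            rw [← Real.rpow_natCast, ← Real.rpow_mul (by norm_num)]; congr 1; ring
          have e2 : ((4 : ℝ) ^ (1 - τ)) ^ m = (2 : ℝ) ^ (2 * (m : ℝ)) * (2 : ℝ) ^ (-(2 * τ * m)) := by
            rw [← Real.rpow_add (by norm_num), show (4 : ℝ) = 2 ^ (2 : ℝ) by norm_num,
              ← Real.rpow_natCast, ← Real.rpow_mul (by norm_num), ← Real.rpow_mul (by norm_num)]
            congr 1; ring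
          have e3 : (2 : ℝ) ^ (2 * (m : ℝ)) = ((2 : ℝ) ^ m) ^ 2 := by
            rw [← pow_mul, ← Real.rpow_natCast]; congr 1; push_cast; ring
          rw [e1, e2, e3, pow_succ]; ring
      _ ≤ ∑' m : ℕ, 8 * ((4 : ℝ) ^ (1 - τ)) ^ m :=
          ((summable_geometric_of_lt_one hr0 hr1).mul_left 8).sum_le_tsum _
            fun m _ ↦ by positivity
      _ = 8 * (1 - 4 ^ (1 - τ))⁻¹ := by
          rw [tsum_mul_left, tsum_geometric_of_lt_one hr0 hr1]
  exact ⟨summable_of_sum_le hnn key, Real.tsum_le_of_sum_le hnn key⟩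

lemma summable_lowerRow [DiscreteTopology Γ] (ha : IsScaling Γ a σa) (hb : IsScaling Γ b σb)
    {τ : ℝ} (hτ : 1 < τ) :
    Summable (fun i : LowerRow Γ σa σb ↦ (i.1 : ℝ) ^ (-(2 * τ))) ∧
      ∑' i : LowerRow Γ σa σb, (i.1 : ℝ) ^ (-(2 * τ)) ≤ 8 * (1 - 4 ^ (1 - τ))⁻¹ :=
  summable_and_tsum_le_of_card_le (fun i ↦ one_le_of_mem_moduli ha hb i.1.2)
    (fun F _ hR hF ↦ card_lowerRow_le ha F hR hF) hτ

end Rows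

/-! ### Growth of χ in terms of the lower left entry -/

section Growth

variable {V : Type*} [NormedAddCommGroup V] [InnerProductSpace ℂ V] {Γ : Subgroup SL(2, ℝ)}
  {χ : Γ →* (V →L[ℂ] V)} {a b : OnePoint ℝ} {σa σb : SL(2, ℝ)}

/-- Multiplication on the left by a power of the generator of Γ_a brings the upper left entry into
[0, c]. Then all entries are at most c in absolute value and μ is O(c²), while the power only
contributes a factor of norm at most 1 to χ(γ⁻¹). -/
lemma exists_norm_omegaElt_inv_le [DiscreteTopology Γ] (hχ : UnitaryAtCusps χ) (hca : Cusp Γ a)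
    (ha : IsScaling Γ a σa) (hb : IsScaling Γ b σb) {σ₀ : ℝ} (hσ₀ : 1 < σ₀)
    (hg : GrowthBound χ σ₀) :
    ∃ C : ℝ, 0 ≤ C ∧ ∀ i : LowerRow Γ σa σb, ‖χ (omegaElt i.2)⁻¹‖ ≤ C * (i.1 : ℝ) ^ (2 * (σ₀ - 1)) := by
  obtain ⟨C, hC⟩ := hg
  set K := mu σa * mu σb * 4 with hK
  have hK0 : 0 ≤ K := by have := mu_nonneg σa; have := mu_nonneg σb; positivity
  refine ⟨|C| * K ^ (σ₀ - 1), by positivity, fun i ↦ ?_⟩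
  obtain ⟨i1, i2⟩ := omegaElt_lower i.2
  have hc1 := one_le_of_mem_moduli ha hb i.1.2
  set γ := omegaElt i.2 with hγ
  set c : ℝ := (i.1 : ℝ) with hc
  have hc0 : 0 < c := by linarith
  set d : ℝ := (i.2 : ℝ) with hd
  have hd0 : 0 ≤ d := i.2.2.1.1
  have hdc : d < c := i.2.2.1.2
  set ω := σa⁻¹ * (γ : SL(2, ℝ)) * σb with hω
  set m : ℤ := -⌊ω 0 0 / c⌋ with hm
  set p := ω 0 0 + m * c with hp
  have hp' : p = c * Int.fract (ω 0 0 / c) := by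
    rw [hp, hm, Int.fract]; push_cast; field_simp; ring
  have hp0 : 0 ≤ p := by rw [hp']; exact mul_nonneg hc0.le (Int.fract_nonneg _)
  have hpc : p ≤ c := by
    rw [hp']; exact mul_le_of_le_one_right hc0.le (Int.fract_lt_one _).le
  set δ := ha.gen ^ m with hδ
  have hδs : δ ∈ stab Γ a := (stab Γ a).zpow_mem ha.gen_mem_stab m
  have hδγ : ((δ * γ : Γ) : SL(2, ℝ)) = σa * (unip m * ω) * σb⁻¹ := by
    rw [Subgroup.coe_mul, hδ, ha.coe_gen_zpow, hω]; group
  obtain ⟨u1, u2, u3, u4⟩ := unip_apply m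
  have hmu : mu (unip m * ω) ≤ 4 * c ^ 2 := by
    have hdet := det_eq (unip m * ω)
    have e1 : (unip m * ω) 0 0 = p := by rw [mul_apply_two, u1, u2, i1]; ring
    have e2 : (unip m * ω) 1 0 = c := by rw [mul_apply_two, u3, u4, i1]; ring
    have e3 : (unip m * ω) 1 1 = d := by rw [mul_apply_two, u3, u4, i2]; ring
    rw [e1, e2, e3] at hdet
    rw [mu, e1, e2, e3]
    set q := (unip m * ω) 0 1
    have hq1 : q * c ≤ c * c := by nlinarith
    have hq2 : -(c * c) ≤ q * c := by nlinarith [mul_nonneg hp0 hd0]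
    have hq3 : q ≤ c := le_of_mul_le_mul_right hq1 hc0
    have hq4 : -c ≤ q := le_of_mul_le_mul_right (by linarith) hc0
    nlinarith
  have hmu2 : mu ((δ * γ)⁻¹ : Γ) ≤ K * c ^ 2 := by
    rw [Subgroup.coe_inv, mu_inv, hδγ]
    refine (mu_mul_mul_le _ _ _).trans ?_
    rw [mu_inv, hK]
    have := mul_le_mul_of_nonneg_left hmu (mul_nonneg (mu_nonneg σa) (mu_nonneg σb))
    nlinarith
  have h1 : ‖χ γ⁻¹‖ ≤ ‖χ (δ * γ)⁻¹‖ := by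
    have h2 := norm_map_mul_le (χ := χ) (δ * γ)⁻¹ δ
    rw [show (δ * γ)⁻¹ * δ = γ⁻¹ by group] at h2
    exact h2.trans (mul_le_of_le_one_right (norm_nonneg _) (norm_le_one_of_mem_stab hχ hca hδs))
  calc ‖χ γ⁻¹‖ ≤ C * mu ((δ * γ)⁻¹ : Γ) ^ (σ₀ - 1) := h1.trans (hC _)
    _ ≤ |C| * (K * c ^ 2) ^ (σ₀ - 1) := by
      refine mul_le_mul (le_abs_self C) ?_ (Real.rpow_nonneg (mu_nonneg _) _) (abs_nonneg _)
      exact Real.rpow_le_rpow (mu_nonneg _) hmu2 (by linarith)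
    _ = |C| * K ^ (σ₀ - 1) * c ^ (2 * (σ₀ - 1)) := by
      rw [Real.mul_rpow hK0 (by positivity), Real.rpow_mul hc0.le, mul_assoc]
      norm_cast

end Growth

end TwistedEisenstein
end

/-! ### Bruhat decomposition of the cosets -/

noncomputable section

namespace TwistedEisenstein

section Cosets

variable {Γ : Subgroup SL(2, ℝ)} {a b : OnePoint ℝ} {σa σb : SL(2, ℝ)}

/-- The coset `Γ_a γ`. -/
def coset (a : OnePoint ℝ) (γ : Γ) : Cosets Γ a := Quotient.mk _ γ

lemma coset_eq_iff {γ δ : Γ} : coset a γ = coset a δ ↔ γ * δ⁻¹ ∈ stab Γ a := by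
  rw [coset, coset, Quotient.eq]
  rw [QuotientGroup.rightRel_apply, ← inv_mem_iff, mul_inv_rev, inv_inv]

lemma coset_out (q : Cosets Γ a) : coset a q.out = q := Quotient.out_eq q

/-- The coset of `ω_(c,d) n(n)`. -/
def rowCoset (a : OnePoint ℝ) (hb : IsScaling Γ b σb) (σa : SL(2, ℝ))
    (p : LowerRow Γ σa σb × ℤ) : Cosets Γ a :=
  coset a (omegaElt p.1.2 * hb.gen ^ p.2)

lemma rowCoset_lower (hb : IsScaling Γ b σb) (p : LowerRow Γ σa σb × ℤ) :
    (σa⁻¹ * ((omegaElt p.1.2 * hb.gen ^ p.2 : Γ) : SL(2, ℝ)) * σb) 1 0 = p.1.1 ∧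
    (σa⁻¹ * ((omegaElt p.1.2 * hb.gen ^ p.2 : Γ) : SL(2, ℝ)) * σb) 1 1 = p.1.1 * p.2 + p.1.2 := by
  obtain ⟨h1, h2⟩ := hb.mul_gen_zpow_lower σa (omegaElt p.1.2) p.2
  obtain ⟨i1, i2⟩ := omegaElt_lower p.1.2
  rw [h1, h2, i1, i2]
  exact ⟨rfl, rfl⟩

/-- A coset determines its lower row up to sign, and c > 0 fixes the sign. Then n is the integer
part of (cn + d)/c. -/
lemma rowCoset_injective (ha : IsScaling Γ a σa) (hb : IsScaling Γ b σb) :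
    Function.Injective (rowCoset a hb σa) := by
  intro p p' h
  obtain ⟨h1, h2⟩ := rowCoset_lower hb p
  obtain ⟨h1', h2'⟩ := rowCoset_lower hb p'
  have hrow := ha.lower_eq_or_neg (coset_eq_iff.1 h) σb
  rw [h1, h2, h1', h2'] at hrow
  have hc := p.1.1.2.1
  have hc' := p'.1.1.2.1
  rcases hrow with ⟨hr1, hr2⟩ | ⟨hr1, -⟩
  · obtain ⟨hd, hdc⟩ := p.1.2.2.1
    obtain ⟨hd', hdc'⟩ := p'.1.2.2.1
    replace hr2 : (p'.1.1 : ℝ) * p.2 + p.1.2 = p'.1.1 * p'.2 + p'.1.2 := by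
      linear_combination hr2 - (p.2 : ℝ) * hr1
    replace hdc : (p.1.2 : ℝ) < p'.1.1 := by linarith
    have hn : p.2 = p'.2 := by
      have e1 : ∀ (n : ℤ) (d : ℝ), 0 ≤ d → d < p'.1.1 →
          ⌊((p'.1.1 : ℝ) * n + d) / p'.1.1⌋ = n := fun n d h0 h1 ↦ by
        rw [Int.floor_eq_iff]
        constructor
        · rw [le_div_iff₀ hc']; linarith
        · rw [div_lt_iff₀ hc']; linarith
      rw [← e1 p.2 _ hd hdc, ← e1 p'.2 _ hd' hdc', hr2]
    rw [hn] at hr2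
    exact Prod.ext (LowerRow.ext_val hr1 (by linarith)) hn
  · linarith

lemma mem_range_rowCoset_of_pos (ha : IsScaling Γ a σa) (hb : IsScaling Γ b σb) {γ : Γ}
    (hc : 0 < (σa⁻¹ * (γ : SL(2, ℝ)) * σb) 1 0) : coset a γ ∈ Set.range (rowCoset a hb σa) := by
  set c := (σa⁻¹ * (γ : SL(2, ℝ)) * σb) 1 0 with hcdef
  set d := (σa⁻¹ * (γ : SL(2, ℝ)) * σb) 1 1 with hd
  obtain ⟨h1, h2⟩ := hb.mul_gen_zpow_lower σa γ (-⌊d / c⌋)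
  have hfr : c * ((-⌊d / c⌋ : ℤ) : ℝ) + d = c * Int.fract (d / c) := by
    rw [Int.fract]; push_cast; field_simp; ring
  rw [← hcdef] at h1
  rw [← hcdef, ← hd, hfr] at h2
  let i : LowerRow Γ σa σb := ⟨⟨c, hc, γ, rfl⟩, ⟨c * Int.fract (d / c),
    ⟨mul_nonneg hc.le (Int.fract_nonneg _), mul_lt_of_lt_one_right hc (Int.fract_lt_one _)⟩,
    _, h1, h2⟩⟩
  refine ⟨(i, ⌊d / c⌋), coset_eq_iff.2 (ha.mul_inv_mem_stab σb ?_)⟩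
  obtain ⟨r1, r2⟩ := rowCoset_lower hb (i, ⌊d / c⌋)
  rw [r1, r2, ← hcdef, ← hd]
  simp only [i, Int.fract]
  field_simp
  ring

lemma coset_neg (h1 : (-1 : SL(2, ℝ)) ∈ Γ) (ha : IsScaling Γ a σa) (γ : Γ) :
    coset a (⟨-1, h1⟩ * γ) = coset a γ := by
  rw [coset_eq_iff, mul_inv_cancel_right, mem_stab]
  refine ha.smul_eq_of_lower_eq_zero ?_
  simp

/-- Since -1 ∈ Γ fixes every cusp, the sign of c can be changed within a coset. -/
lemma mem_range_rowCoset (h1 : (-1 : SL(2, ℝ)) ∈ Γ) (ha : IsScaling Γ a σa)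
    (hb : IsScaling Γ b σb) {γ : Γ} (hc : (σa⁻¹ * (γ : SL(2, ℝ)) * σb) 1 0 ≠ 0) :
    coset a γ ∈ Set.range (rowCoset a hb σa) := by
  rcases lt_or_gt_of_ne hc with h | h
  · rw [← coset_neg h1 ha]
    refine mem_range_rowCoset_of_pos ha hb ?_
    have : (σa⁻¹ * ((⟨-1, h1⟩ * γ : Γ) : SL(2, ℝ)) * σb) = -(σa⁻¹ * (γ : SL(2, ℝ)) * σb) := by
      rw [Subgroup.coe_mul]; simp
    rw [this, neg_apply_two]
    linarith
  · exact mem_range_rowCoset_of_pos ha hb h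

lemma lower_eq_zero_of_notMem (h1 : (-1 : SL(2, ℝ)) ∈ Γ) (ha : IsScaling Γ a σa)
    (hb : IsScaling Γ b σb) {q : Cosets Γ a} (hq : q ∈ (Set.range (rowCoset a hb σa))ᶜ) :
    (σa⁻¹ * (q.out : SL(2, ℝ)) * σb) 1 0 = 0 := by
  by_contra h
  have := mem_range_rowCoset h1 ha hb h
  rw [coset_out] at this
  exact hq this

/-- Two rows of the form (0, d) have determinant 0, hence belong to the same coset. -/
lemma subsingleton_compl_range (h1 : (-1 : SL(2, ℝ)) ∈ Γ) (ha : IsScaling Γ a σa)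
    (hb : IsScaling Γ b σb) : ((Set.range (rowCoset a hb σa))ᶜ).Subsingleton := by
  intro q hq q' hq'
  rw [← coset_out q, ← coset_out q', coset_eq_iff]
  refine ha.mul_inv_mem_stab σb ?_
  rw [lower_eq_zero_of_notMem h1 ha hb hq, lower_eq_zero_of_notMem h1 ha hb hq']
  ring

lemma smul_eq_of_notMem (h1 : (-1 : SL(2, ℝ)) ∈ Γ) (ha : IsScaling Γ a σa)
    (hb : IsScaling Γ b σb) {q : Cosets Γ a} (hq : q ∈ (Set.range (rowCoset a hb σa))ᶜ) :
    slToGL (q.out : SL(2, ℝ)) • b = a := by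
  have h0 := lower_eq_zero_of_notMem h1 ha hb hq
  have h2 : slToGL (σa⁻¹ * (q.out : SL(2, ℝ)) * σb) • (OnePoint.infty : OnePoint ℝ) =
      OnePoint.infty := by
    rw [OnePoint.smul_infty_eq_self_iff]; exact h0
  rwa [map_mul, map_mul, mul_smul, mul_smul, hb.map_infty, map_inv, inv_smul_eq_iff,
    ha.map_infty] at h2

lemma compl_range_eq_singleton (ha : IsScaling Γ a σa) (h1 : (-1 : SL(2, ℝ)) ∈ Γ) :
    (Set.range (rowCoset a ha σa))ᶜ = {coset a (1 : Γ)} := by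
  refine Set.eq_singleton_iff_unique_mem.2 ⟨?_, fun q hq ↦ ?_⟩
  · rintro ⟨p, hp⟩
    obtain ⟨r1, r2⟩ := rowCoset_lower ha p
    have hrow := ha.lower_eq_or_neg (coset_eq_iff.1 hp) σa
    have hc := p.1.1.2.1
    obtain ⟨-, -, e3, -⟩ := one_apply_two
    rw [r1, OneMemClass.coe_one, mul_one, inv_mul_cancel, e3] at hrow
    rcases hrow with h | h <;> linarith [h.1]
  · rw [← coset_out q, coset_eq_iff, inv_one, mul_one, mem_stab]
    exact smul_eq_of_notMem h1 ha ha hq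

lemma compl_range_eq_empty (h1 : (-1 : SL(2, ℝ)) ∈ Γ) (ha : IsScaling Γ a σa)
    (hb : IsScaling Γ b σb) (hab : ∀ γ ∈ Γ, slToGL γ • a ≠ b) :
    (Set.range (rowCoset a hb σa))ᶜ = ∅ := by
  refine Set.eq_empty_of_forall_notMem fun q hq ↦ hab _ (Γ.inv_mem q.out.2) ?_
  rw [map_inv, inv_smul_eq_iff, smul_eq_of_notMem h1 ha hb hq]

end Cosets

/-! ### Terms of the Eisenstein series and absolute convergence -/

section Terms

variable {V : Type*} [NormedAddCommGroup V] [InnerProductSpace ℂ V] [FiniteDimensional ℂ V]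
  {Γ : Subgroup SL(2, ℝ)} {χ : Γ →* (V →L[ℂ] V)} {a b : OnePoint ℝ} {σ σa σb : SL(2, ℝ)}

lemma norm_proj_le (χ : Γ →* (V →L[ℂ] V)) (a : OnePoint ℝ) : ‖proj χ a‖ ≤ 1 :=
  Submodule.starProjection_norm_le _

lemma map_mul_proj {δ : Γ} (hδ : δ ∈ stab Γ a) : χ δ * proj χ a = proj χ a := by
  ext v
  have : proj χ a v ∈ fixedSpace χ a := Submodule.starProjection_apply_mem _ _
  exact this δ hδ

lemma unip_smul_im (t : ℝ) (w : ℍ) : (unip t • w).im = w.im ∧ (-unip t • w).im = w.im := by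
  obtain ⟨b1, b2, b3, b4⟩ := unip_apply t
  rw [smul_im, smul_im]
  simp only [neg_apply_two, b3, b4]
  constructor <;> norm_num

/-- This frees the series from the choice of `q.out`: the imaginary part is invariant under ±n(k),
and P_a absorbs χ of the stabilizer. -/
lemma eisTerm_congr (ha : IsScaling Γ a σa) (z : ℍ) (s : ℂ) {γ δ : Γ}
    (h : coset a γ = coset a δ) : eisTerm χ a σa z s γ = eisTerm χ a σa z s δ := by
  have hm := coset_eq_iff.1 h
  have him : ((σa⁻¹ * (γ : SL(2, ℝ))) • z).im = ((σa⁻¹ * (δ : SL(2, ℝ))) • z).im := by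
    have h1 : σa⁻¹ * (γ : SL(2, ℝ)) =
        (σa⁻¹ * ((γ * δ⁻¹ : Γ) : SL(2, ℝ)) * σa) * (σa⁻¹ * (δ : SL(2, ℝ))) := by
      push_cast; group
    obtain ⟨k, hk | hk⟩ := ha.exists_unip hm
    · rw [h1, mul_smul, hk, (unip_smul_im _ _).1]
    · rw [h1, mul_smul, hk, (unip_smul_im _ _).2]
  have hχ : χ γ⁻¹ * proj χ a = χ δ⁻¹ * proj χ a := by
    rw [show γ⁻¹ = δ⁻¹ * (γ * δ⁻¹)⁻¹ by group, map_mul, mul_assoc,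
      map_mul_proj ((stab Γ a).inv_mem hm)]
  rw [eisTerm, eisTerm, him]
  exact congrArg _ hχ

lemma eisTerm_out (ha : IsScaling Γ a σa) (z : ℍ) (s : ℂ) (γ : Γ) :
    eisTerm χ a σa z s (coset a γ).out = eisTerm χ a σa z s γ :=
  eisTerm_congr ha z s (coset_out _)

/-- The term of the Eisenstein series at the coset of `ω_(c,d) n(n)`, where `g` generates the
stabilizer of the second cusp. -/
def rowTerm (χ : Γ →* (V →L[ℂ] V)) (a : OnePoint ℝ) (σa σb : SL(2, ℝ)) (g : Γ) (z : ℍ) (s : ℂ)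
    (p : LowerRow Γ σa σb × ℤ) : V →L[ℂ] V :=
  ((z.im : ℂ) ^ s * ((p.1.1 : ℝ) : ℂ) ^ (-2 * s)) •
    (((((z.re + (p.1.2 : ℝ) / (p.1.1 : ℝ) + p.2) ^ 2 + z.im ^ 2 : ℝ) : ℂ) ^ (-s) •
      χ (g ^ (-p.2))) * (χ (omegaElt p.1.2)⁻¹ * proj χ a))

lemma cpow_mul_inv_sq_mul {y c k : ℝ} (hy : 0 < y) (hc : 0 < c) (hk : 0 < k) (s : ℂ) :
    ((y * (c ^ 2 * k)⁻¹ : ℝ) : ℂ) ^ s = (y : ℂ) ^ s * (c : ℂ) ^ (-2 * s) * (k : ℂ) ^ (-s) := by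
  have hpos : 0 < y * (c ^ 2 * k)⁻¹ := by positivity
  rw [Complex.cpow_def_of_ne_zero (by exact_mod_cast hpos.ne'),
    Complex.cpow_def_of_ne_zero (by exact_mod_cast hy.ne'),
    Complex.cpow_def_of_ne_zero (by exact_mod_cast hc.ne'),
    Complex.cpow_def_of_ne_zero (by exact_mod_cast hk.ne'), ← Complex.ofReal_log hpos.le,
    ← Complex.ofReal_log hy.le, ← Complex.ofReal_log hc.le, ← Complex.ofReal_log hk.le,
    Real.log_mul hy.ne' (by positivity), Real.log_inv, Real.log_mul (by positivity) hk.ne',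
    Real.log_pow, ← Complex.exp_add, ← Complex.exp_add]
  congr 1
  push_cast
  ring

lemma eisTerm_rowCoset (hb : IsScaling Γ b σb) (z : ℍ) (s : ℂ)
    (p : LowerRow Γ σa σb × ℤ) :
    eisTerm χ a σa (σb • z) s (omegaElt p.1.2 * hb.gen ^ p.2) =
      rowTerm χ a σa σb hb.gen z s p := by
  obtain ⟨r1, r2⟩ := rowCoset_lower hb p
  have hc := p.1.1.2.1
  have hy := z.im_pos
  have hk0 : 0 < (z.re + (p.1.2 : ℝ) / (p.1.1 : ℝ) + p.2) ^ 2 + z.im ^ 2 := by positivity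
  have him : ((σa⁻¹ * ((omegaElt p.1.2 * hb.gen ^ p.2 : Γ) : SL(2, ℝ))) • (σb • z)).im =
      z.im * ((p.1.1 : ℝ) ^ 2 * ((z.re + (p.1.2 : ℝ) / (p.1.1 : ℝ) + p.2) ^ 2 + z.im ^ 2))⁻¹ := by
    rw [← mul_smul, smul_im, r1, r2, div_eq_mul_inv]
    congr 2
    field_simp
    ring
  rw [eisTerm, rowTerm, him, cpow_mul_inv_sq_mul hy hc hk0, mul_inv_rev, map_mul, ← zpow_neg,
    smul_mul_assoc, smul_smul, ← mul_assoc]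
  rfl

/-- The powers c^(-2σ) and c^(2(σ₀-1)) combine to exponent -2(σ - σ₀ + 1), so the condition σ > σ₀
is convergence of the sum over rows. -/
lemma norm_rowTerm_le {g : Γ} (hu : ∀ v w : V, inner ℂ (χ g v) (χ g w) = inner ℂ v w) {C σ₀ : ℝ}
    (hC : ∀ i : LowerRow Γ σa σb, ‖χ (omegaElt i.2)⁻¹‖ ≤ C * (i.1 : ℝ) ^ (2 * (σ₀ - 1)))
    (z : ℍ) (s : ℂ) (p : LowerRow Γ σa σb × ℤ) :
    ‖rowTerm χ a σa σb g z s p‖ ≤ z.im ^ s.re * C * (p.1.1 : ℝ) ^ (-(2 * (s.re - σ₀ + 1))) *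
      ((z.re + (p.1.2 : ℝ) / (p.1.1 : ℝ) + p.2) ^ 2 + z.im ^ 2) ^ (-s.re) := by
  have hc := p.1.1.2.1
  have hy := z.im_pos
  have hk0 : 0 < (z.re + (p.1.2 : ℝ) / (p.1.1 : ℝ) + p.2) ^ 2 + z.im ^ 2 := by positivity
  have h1 : ‖χ (omegaElt p.1.2)⁻¹ * proj χ a‖ ≤ C * (p.1.1 : ℝ) ^ (2 * (σ₀ - 1)) :=
    (norm_mul_le _ _).trans ((mul_le_of_le_one_right (norm_nonneg _) (norm_proj_le χ a)).trans
      (hC p.1))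
  rw [rowTerm, norm_smul, norm_mul, smul_mul_assoc, norm_smul,
    Complex.norm_cpow_eq_rpow_re_of_pos hy, Complex.norm_cpow_eq_rpow_re_of_pos hc,
    Complex.norm_cpow_eq_rpow_re_of_pos hk0, Complex.neg_re]
  have h2 : ‖χ (g ^ (-p.2)) * (χ (omegaElt p.1.2)⁻¹ * proj χ a)‖ ≤
      C * (p.1.1 : ℝ) ^ (2 * (σ₀ - 1)) :=
    (norm_mul_le _ _).trans ((mul_le_of_le_one_left (norm_nonneg _) (norm_map_zpow_le hu _)).trans h1)
  have h3 : (p.1.1 : ℝ) ^ (-(2 * (s.re - σ₀ + 1))) =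
      (p.1.1 : ℝ) ^ (-2 * s).re * (p.1.1 : ℝ) ^ (2 * (σ₀ - 1)) := by
    rw [← Real.rpow_add hc]
    congr 1
    simp
    ring
  rw [h3]
  refine (mul_le_mul_of_nonneg_left (mul_le_mul_of_nonneg_left h2 (by positivity))
    (by positivity)).trans (le_of_eq ?_)
  ring

/-- The bound of the Dirichlet series over lower rows. -/
def rowBound (τ : ℝ) : ℝ := 8 * (1 - 4 ^ (1 - τ))⁻¹

lemma rowBound_nonneg {τ : ℝ} (hτ : 1 < τ) : 0 ≤ rowBound τ := by
  have : (4 : ℝ) ^ (1 - τ) < 1 := Real.rpow_lt_one_of_one_lt_of_neg (by norm_num) (by linarith)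
  have : 0 < 1 - (4 : ℝ) ^ (1 - τ) := by linarith
  rw [rowBound]; positivity

lemma summable_prod_mul_and_tsum_le {I J : Type*} {F : I → ℝ} {K : I → J → ℝ} {B D : ℝ}
    (hF0 : ∀ i, 0 ≤ F i) (hK0 : ∀ i j, 0 ≤ K i j) (hF : Summable F) (hFD : ∑' i, F i ≤ D)
    (hB : 0 ≤ B) (hK : ∀ i, Summable (K i) ∧ ∑' j, K i j ≤ B) :
    Summable (fun p : I × J ↦ F p.1 * K p.1 p.2) ∧ ∑' p : I × J, F p.1 * K p.1 p.2 ≤ D * B := by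
  have hrow : ∀ i, ∑' j, F i * K i j ≤ F i * B := fun i ↦ by
    rw [tsum_mul_left]
    exact mul_le_mul_of_nonneg_left (hK i).2 (hF0 i)
  have hrows : Summable fun i ↦ ∑' j, F i * K i j :=
    Summable.of_nonneg_of_le (fun i ↦ tsum_nonneg fun j ↦ mul_nonneg (hF0 i) (hK0 i j)) hrow
      (hF.mul_right B)
  have hN : Summable (fun p : I × J ↦ F p.1 * K p.1 p.2) := by
    rw [summable_prod_of_nonneg fun p ↦ mul_nonneg (hF0 _) (hK0 _ _)]
    exact ⟨fun i ↦ (hK i).1.mul_left (F i), hrows⟩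
  refine ⟨hN, ?_⟩
  rw [hN.tsum_prod]
  refine (Summable.tsum_le_tsum hrow hrows (hF.mul_right B)).trans ?_
  rw [tsum_mul_right]
  exact mul_le_mul_of_nonneg_right hFD hB

lemma summable_rowTerm [DiscreteTopology Γ] (ha : IsScaling Γ a σa) (hb : IsScaling Γ b σb) {g : Γ}
    (hu : ∀ v w : V, inner ℂ (χ g v) (χ g w) = inner ℂ v w) {C σ₀ : ℝ} (hσ₀ : 1 < σ₀)
    (hC0 : 0 ≤ C) (hC : ∀ i : LowerRow Γ σa σb, ‖χ (omegaElt i.2)⁻¹‖ ≤ C * (i.1 : ℝ) ^ (2 * (σ₀ - 1)))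
    (z : ℍ) {s : ℂ} (hs : σ₀ < s.re) :
    Summable (fun p ↦ ‖rowTerm χ a σa σb g z s p‖) ∧
      ∑' p, ‖rowTerm χ a σa σb g z s p‖ ≤ z.im ^ s.re * C * rowBound (s.re - σ₀ + 1) *
        ((z.im ^ 2) ^ (-s.re) + 4 ^ s.re * ∑' n : ℤ, |(n : ℝ)| ^ (-(2 * s.re))) := by
  have hy := z.im_pos
  have hy2 : 0 < z.im ^ 2 := by positivity
  set B := (z.im ^ 2) ^ (-s.re) + 4 ^ s.re * ∑' n : ℤ, |(n : ℝ)| ^ (-(2 * s.re)) with hB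
  have hB0 : 0 ≤ B := by positivity
  set F : LowerRow Γ σa σb → ℝ := fun i ↦
    z.im ^ s.re * C * (i.1 : ℝ) ^ (-(2 * (s.re - σ₀ + 1))) with hF
  have hF0 : ∀ i, 0 ≤ F i := fun i ↦ by
    have := i.1.2.1
    positivity
  obtain ⟨hsum, hle⟩ := summable_lowerRow ha hb (τ := s.re - σ₀ + 1) (by linarith)
  have hFs : Summable F := hsum.mul_left _
  have hFle : ∑' i, F i ≤ z.im ^ s.re * C * rowBound (s.re - σ₀ + 1) := by
    rw [tsum_mul_left]
    exact mul_le_mul_of_nonneg_left hle (by positivity)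
  obtain ⟨hNs, hNle⟩ := summable_prod_mul_and_tsum_le (K := fun (i : LowerRow Γ σa σb) (n : ℤ) ↦
    ((z.re + (i.2 : ℝ) / (i.1 : ℝ) + n) ^ 2 + z.im ^ 2) ^ (-s.re)) hF0 (fun i n ↦ by positivity)
    hFs hFle hB0 (fun i ↦ kernel_summable_and_le (by linarith) hy2 _)
  have hle' : ∀ p, ‖rowTerm χ a σa σb g z s p‖ ≤ F p.1 * ((z.re + (p.1.2 : ℝ) / (p.1.1 : ℝ) + p.2) ^ 2 + z.im ^ 2) ^ (-s.re) := fun p ↦ norm_rowTerm_le hu hC z s p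
  have h1 := Summable.of_nonneg_of_le (fun p ↦ norm_nonneg _) hle' hNs
  exact ⟨h1, (Summable.tsum_le_tsum hle' h1 hNs).trans hNle⟩

lemma summable_eisTerm_of_rowTerm (h1 : (-1 : SL(2, ℝ)) ∈ Γ) (ha : IsScaling Γ a σa)
    (hb : IsScaling Γ b σb) (z : ℍ) (s : ℂ)
    (hs : Summable fun p ↦ ‖rowTerm χ a σa σb hb.gen z s p‖) :
    Summable fun q : Cosets Γ a ↦ ‖eisTerm χ a σa (σb • z) s q.out‖ := by
  have hfin : Finite ((Set.range (rowCoset a hb σa))ᶜ : Set (Cosets Γ a)) :=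
    (subsingleton_compl_range h1 ha hb).finite
  rw [← summable_subtype_and_compl (s := Set.range (rowCoset a hb σa))]
  refine ⟨?_, Summable.of_finite⟩
  rw [← (Equiv.ofInjective _ (rowCoset_injective ha hb)).summable_iff]
  refine hs.congr fun p ↦ ?_
  rw [← eisTerm_rowCoset hb, ← eisTerm_out ha]
  rfl

lemma eisenstein_eq_add (h1 : (-1 : SL(2, ℝ)) ∈ Γ) (ha : IsScaling Γ a σa)
    (hb : IsScaling Γ b σb) (z : ℍ) (s : ℂ)
    (hs : Summable fun p ↦ ‖rowTerm χ a σa σb hb.gen z s p‖) :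
    eisenstein χ a σa (σb • z) s = ∑' p, rowTerm χ a σa σb hb.gen z s p +
      ∑' q : ((Set.range (rowCoset a hb σa))ᶜ : Set (Cosets Γ a)),
        eisTerm χ a σa (σb • z) s q.1.out := by
  have := FiniteDimensional.complete ℂ V
  have hsum := (summable_eisTerm_of_rowTerm h1 ha hb z s hs).of_norm
  rw [eisenstein, ← hsum.tsum_subtype_add_tsum_subtype_compl (Set.range (rowCoset a hb σa)),
    tsum_range (fun q : Cosets Γ a ↦ eisTerm χ a σa (σb • z) s q.out) (rowCoset_injective ha hb)]
  congr 1
  refine tsum_congr fun p ↦ ?_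
  rw [← eisTerm_rowCoset hb, rowCoset, eisTerm_out ha]

end Terms

end TwistedEisenstein
end

/-! ### Constant term and final estimates -/

noncomputable section

namespace TwistedEisenstein

variable {V : Type*} [NormedAddCommGroup V] [InnerProductSpace ℂ V]
  {Γ : Subgroup SL(2, ℝ)} {χ : Γ →* (V →L[ℂ] V)} {a b : OnePoint ℝ} {σa σb : SL(2, ℝ)}

/-- Up to sign the stabilizer consists of powers of the generator, and χ(-1) = 1. So P_b projects
onto the 1-eigenspace of χ(γ_b). -/
lemma mem_fixedSpace_iff (hχ1 : ∀ γ : Γ, (γ : SL(2, ℝ)) = -1 → χ γ = 1) (hb : IsScaling Γ b σb)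
    (v : V) : v ∈ fixedSpace χ b ↔ χ hb.gen v = v := by
  refine ⟨fun h ↦ h _ hb.gen_mem_stab, fun h γ hγ ↦ ?_⟩
  have hz : ∀ k : ℤ, χ (hb.gen ^ k) v = v := fun k ↦ by
    rw [map_zpow_apply_of_eigen one_ne_zero (by rw [h, one_smul]), one_zpow, one_smul]
  obtain ⟨k, hk⟩ := hb.exists_unip hγ
  have hc := hb.coe_gen_zpow k
  rcases hk with hk | hk
  · have : γ = hb.gen ^ k := Subtype.ext (by rw [hc, ← hk]; group)
    rw [this, hz]
  · have h2 : χ (γ * (hb.gen ^ k)⁻¹) = 1 := hχ1 _ (by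
      have hγ' : (γ : SL(2, ℝ)) = σb * (-unip k) * σb⁻¹ := by rw [← hk]; group
      rw [Subgroup.coe_mul, Subgroup.coe_inv, hc, hγ']
      simp [mul_assoc])
    rw [show γ = γ * (hb.gen ^ k)⁻¹ * hb.gen ^ k by group, map_mul, h2, one_mul, hz]

lemma norm_cpow_smul_le {C σ₀ : ℝ}
    (hC : ∀ i : LowerRow Γ σa σb, ‖χ (omegaElt i.2)⁻¹‖ ≤ C * (i.1 : ℝ) ^ (2 * (σ₀ - 1)))
    (s : ℂ) (i : LowerRow Γ σa σb) :
    ‖((i.1 : ℝ) : ℂ) ^ (-2 * s) • χ (omegaElt i.2)⁻¹‖ ≤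
      C * (i.1 : ℝ) ^ (-(2 * (s.re - σ₀ + 1))) := by
  have hc := i.1.2.1
  have h3 : (i.1 : ℝ) ^ (-(2 * (s.re - σ₀ + 1))) =
      (i.1 : ℝ) ^ (-2 * s).re * (i.1 : ℝ) ^ (2 * (σ₀ - 1)) := by
    rw [← Real.rpow_add hc]
    congr 1
    simp
    ring
  rw [norm_smul, Complex.norm_cpow_eq_rpow_re_of_pos hc, h3, mul_left_comm]
  exact mul_le_mul_of_nonneg_left (hC i) (by positivity)

lemma summable_norm_cpow_smul [DiscreteTopology Γ] (ha : IsScaling Γ a σa) (hb : IsScaling Γ b σb)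
    {C σ₀ : ℝ} (hC : ∀ i : LowerRow Γ σa σb, ‖χ (omegaElt i.2)⁻¹‖ ≤ C * (i.1 : ℝ) ^ (2 * (σ₀ - 1)))
    {s : ℂ} (hs : σ₀ < s.re) :
    Summable fun i : LowerRow Γ σa σb ↦ ‖((i.1 : ℝ) : ℂ) ^ (-2 * s) • χ (omegaElt i.2)⁻¹‖ :=
  Summable.of_nonneg_of_le (fun _ ↦ norm_nonneg _) (norm_cpow_smul_le hC s)
    ((summable_lowerRow ha hb (by linarith)).1.mul_left C)

/-- A sum `∑ᶠ` of infinite support is 0 by convention; finiteness of the residues makes it the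
actual sum. -/
lemma kloosterman_zero_eq_tsum [DiscreteTopology Γ] (χ : Γ →* (V →L[ℂ] V)) (ha : IsScaling Γ a σa)
    (hb : IsScaling Γ b σb) {c : ℝ} (hc : c ∈ moduli Γ σa σb) :
    kloosterman χ σa σb 0 c = ∑' d : residues Γ σa σb c, χ (omegaElt d)⁻¹ := by
  have : Finite (residues Γ σa σb c) := finite_residues ha hb hc
  rw [kloosterman, tsum_eq_finsum (Set.toFinite _)]
  refine finsum_congr fun d ↦ ?_
  simp [e]

lemma smul_kloosterman_eq_tsum [DiscreteTopology Γ] (χ : Γ →* (V →L[ℂ] V)) (ha : IsScaling Γ a σa)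
    (hb : IsScaling Γ b σb) (s : ℂ) (c : moduli Γ σa σb) :
    ((c : ℝ) : ℂ) ^ (-2 * s) • kloosterman χ σa σb 0 c =
      ∑' d : residues Γ σa σb c, ((c : ℝ) : ℂ) ^ (-2 * s) • χ (omegaElt d)⁻¹ := by
  have : Finite (residues Γ σa σb c) := finite_residues ha hb c.2
  rw [kloosterman_zero_eq_tsum χ ha hb c.2, Summable.tsum_const_smul _ Summable.of_finite]

lemma summable_kloosterman [DiscreteTopology Γ] (ha : IsScaling Γ a σa) (hb : IsScaling Γ b σb)
    {s : ℂ} (hs : Summable fun i : LowerRow Γ σa σb ↦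
      ‖((i.1 : ℝ) : ℂ) ^ (-2 * s) • χ (omegaElt i.2)⁻¹‖) :
    Summable fun c : moduli Γ σa σb ↦ ‖((c : ℝ) : ℂ) ^ (-2 * s) • kloosterman χ σa σb 0 c‖ := by
  refine Summable.of_nonneg_of_le (fun _ ↦ norm_nonneg _) (fun c ↦ ?_) hs.sigma
  have : Finite (residues Γ σa σb c) := finite_residues ha hb c.2
  rw [smul_kloosterman_eq_tsum χ ha hb]
  exact norm_tsum_le_tsum_norm Summable.of_finite

variable [FiniteDimensional ℂ V]

/-- The exceptional coset has lower row (0, d), so its term is a constant times y^s in norm. This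
includes distinct equivalent cusps, where it differs from the main term but still satisfies the
growth bound. -/
lemma exists_norm_tsum_compl_le (h1 : (-1 : SL(2, ℝ)) ∈ Γ) (χ : Γ →* (V →L[ℂ] V))
    (ha : IsScaling Γ a σa) (hb : IsScaling Γ b σb) :
    ∃ M : ℝ → ℝ, (∀ t, 0 ≤ M t) ∧ ∀ (s : ℂ) (z : ℍ),
      ‖∑' q : ((Set.range (rowCoset a hb σa))ᶜ : Set (Cosets Γ a)),
        eisTerm χ a σa (σb • z) s q.1.out‖ ≤ M s.re * z.im ^ s.re := by
  rcases (subsingleton_compl_range h1 ha hb).eq_empty_or_singleton with h | ⟨q, h⟩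
  · refine ⟨fun _ ↦ 0, fun _ ↦ le_rfl, fun s z ↦ ?_⟩
    rw [h, tsum_empty, norm_zero, zero_mul]
  · have h0 := lower_eq_zero_of_notMem h1 ha hb (h ▸ Set.mem_singleton q)
    set d := (σa⁻¹ * (q.out : SL(2, ℝ)) * σb) 1 1 with hd
    have hd0 : d ≠ 0 := fun hd0 ↦ by
      have := det_eq (σa⁻¹ * (q.out : SL(2, ℝ)) * σb)
      rw [h0, ← hd, hd0] at this
      norm_num at this
    refine ⟨fun t ↦ ((d ^ 2)⁻¹) ^ t * ‖χ q.out⁻¹ ∘L proj χ a‖, fun t ↦ by positivity, fun s z ↦ ?_⟩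
    have hy := z.im_pos
    have him : ((σa⁻¹ * (q.out : SL(2, ℝ))) • (σb • z)).im = z.im * (d ^ 2)⁻¹ := by
      rw [← mul_smul, smul_im, h0, ← hd, div_eq_mul_inv]
      congr 2
      ring
    rw [h, tsum_singleton q fun q ↦ eisTerm χ a σa (σb • z) s q.out, eisTerm, him, norm_smul,
      Complex.norm_cpow_eq_rpow_re_of_pos (by positivity), Real.mul_rpow hy.le (by positivity)]
    exact le_of_eq (by ring)

/-- A coset with c = 0 sends b to a. For a = b it is the coset of 1, and for inequivalent cusps
there is none. -/
lemma tsum_compl_eq_mainTerm (h1 : (-1 : SL(2, ℝ)) ∈ Γ) {σ : OnePoint ℝ → SL(2, ℝ)}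
    (ha : IsScaling Γ a (σ a)) (hb : IsScaling Γ b (σ b))
    (hab : a = b ∨ ∀ γ ∈ Γ, slToGL γ • a ≠ b) (s : ℂ) (z : ℍ) :
    ∑' q : ((Set.range (rowCoset a hb (σ a)))ᶜ : Set (Cosets Γ a)),
      eisTerm χ a (σ a) (σ b • z) s q.1.out = mainTerm χ a b z.im s := by
  rcases hab with rfl | hab
  · rw [compl_range_eq_singleton hb h1,
      tsum_singleton (coset a (1 : Γ)) fun q ↦ eisTerm χ a (σ a) (σ a • z) s q.out, eisTerm_out ha,
      mainTerm, if_pos rfl, eisTerm, inv_one, map_one, ← mul_smul, OneMemClass.coe_one, mul_one,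
      inv_mul_cancel, one_smul]
    rfl
  · have hne : a ≠ b := by simpa using hab 1 Γ.one_mem
    rw [compl_range_eq_empty h1 ha hb hab, tsum_empty, mainTerm, if_neg hne]

/-- The factor `π^(1/2) Γ(s - 1/2) / Γ(s)`. -/
def gammaFactor (s : ℂ) : ℂ := (√Real.pi : ℂ) * Complex.Gamma (s - 1 / 2) / Complex.Gamma s

lemma phi_eq [DiscreteTopology Γ] (ha : IsScaling Γ a σa) (hb : IsScaling Γ b σb)
    {s : ℂ} (hs : Summable fun i : LowerRow Γ σa σb ↦
      ‖((i.1 : ℝ) : ℂ) ^ (-2 * s) • χ (omegaElt i.2)⁻¹‖) :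
    phi χ a b σa σb s = gammaFactor s • (proj χ b *
      ((∑' i : LowerRow Γ σa σb, ((i.1 : ℝ) : ℂ) ^ (-2 * s) • χ (omegaElt i.2)⁻¹) * proj χ a)) := by
  have := FiniteDimensional.complete ℂ V
  rw [hs.of_norm.tsum_sigma, phi, gammaFactor, tsum_congr (smul_kloosterman_eq_tsum χ ha hb s)]
  rfl

lemma tsum_rowTerm_eq {g : Γ} (hu : ∀ v w : V, inner ℂ (χ g v) (χ g w) = inner ℂ v w) (z : ℍ)
    {s : ℂ} (hs1 : 1 / 2 < s.re) (hs : Summable fun p ↦ ‖rowTerm χ a σa σb g z s p‖) :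
    ∑' p, rowTerm χ a σa σb g z s p = ∑' i : LowerRow Γ σa σb,
      ((z.im : ℂ) ^ s * ((i.1 : ℝ) : ℂ) ^ (-2 * s)) •
        ((∑' n : ℤ, (((z.re + (i.2 : ℝ) / (i.1 : ℝ) + n) ^ 2 + z.im ^ 2 : ℝ) : ℂ) ^ (-s) •
          χ (g ^ (-n))) * (χ (omegaElt i.2)⁻¹ * proj χ a)) := by
  have := FiniteDimensional.complete ℂ V
  rw [hs.of_norm.tsum_prod]
  refine tsum_congr fun i ↦ ?_
  have h1 := (summable_kernel_smul hu hs1 (z.re + (i.2 : ℝ) / (i.1 : ℝ)) z.im_pos).of_norm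
  rw [← h1.tsum_mul_right, ← Summable.tsum_const_smul _ (h1.mul_right _)]
  rfl

/-- The part of the Eisenstein series that comes from elements with nonzero lower left entry. -/
lemma tsum_rowTerm_sub_phi [DiscreteTopology Γ] (ha : IsScaling Γ a σa) (hb : IsScaling Γ b σb)
    (hu : ∀ v w : V, inner ℂ (χ hb.gen v) (χ hb.gen w) = inner ℂ v w) (z : ℍ)
    {s : ℂ} (hs1 : 1 / 2 < s.re) (hs : Summable fun p ↦ ‖rowTerm χ a σa σb hb.gen z s p‖)
    (hs' : Summable fun i : LowerRow Γ σa σb ↦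
      ‖((i.1 : ℝ) : ℂ) ^ (-2 * s) • χ (omegaElt i.2)⁻¹‖) :
    ∑' p, rowTerm χ a σa σb hb.gen z s p - (z.im : ℂ) ^ (1 - s) • phi χ a b σa σb s =
      ∑' i : LowerRow Γ σa σb, ((z.im : ℂ) ^ s * ((i.1 : ℝ) : ℂ) ^ (-2 * s)) •
        (kernelDefect χ hb.gen (fixedSpace χ b) s (z.re + (i.2 : ℝ) / (i.1 : ℝ)) z.im *
          (χ (omegaElt i.2)⁻¹ * proj χ a)) := by
  have := FiniteDimensional.complete ℂ V
  have hz0 : (z.im : ℂ) ≠ 0 := by exact_mod_cast z.im_pos.ne'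
  -- The zero frequency y^(1-2s) of the inner sum meets the factor y^s in front.
  have hpow : (z.im : ℂ) ^ (1 - s) = (z.im : ℂ) ^ s * (z.im : ℂ) ^ (1 - 2 * s) := by
    rw [← Complex.cpow_add _ _ hz0]; congr 1; ring
  have h1 : Summable fun i : LowerRow Γ σa σb ↦ ((z.im : ℂ) ^ (1 - s) * gammaFactor s) • (proj χ b *
      ((((i.1 : ℝ) : ℂ) ^ (-2 * s) • χ (omegaElt i.2)⁻¹) * proj χ a)) :=
    ((hs'.of_norm.mul_right _).mul_left _).const_smul _
  have h2 : (z.im : ℂ) ^ (1 - s) • phi χ a b σa σb s = ∑' i : LowerRow Γ σa σb,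
      ((z.im : ℂ) ^ (1 - s) * gammaFactor s) • (proj χ b *
        ((((i.1 : ℝ) : ℂ) ^ (-2 * s) • χ (omegaElt i.2)⁻¹) * proj χ a)) := by
    rw [phi_eq ha hb hs', Summable.tsum_const_smul _ ((hs'.of_norm.mul_right _).mul_left _),
      (hs'.of_norm.mul_right _).tsum_mul_left, hs'.of_norm.tsum_mul_right, smul_smul]
  have h3 : Summable fun i : LowerRow Γ σa σb ↦
      ((z.im : ℂ) ^ s * ((i.1 : ℝ) : ℂ) ^ (-2 * s)) •
        ((∑' n : ℤ, (((z.re + (i.2 : ℝ) / (i.1 : ℝ) + n) ^ 2 + z.im ^ 2 : ℝ) : ℂ) ^ (-s) •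
          χ (hb.gen ^ (-n))) * (χ (omegaElt i.2)⁻¹ * proj χ a)) := by
    refine hs.of_norm.prod.congr fun i ↦ ?_
    have h1 := (summable_kernel_smul hu hs1 (z.re + (i.2 : ℝ) / (i.1 : ℝ)) z.im_pos).of_norm
    rw [← h1.tsum_mul_right, ← Summable.tsum_const_smul _ (h1.mul_right _)]
    rfl
  rw [tsum_rowTerm_eq hu z hs1 hs, h2, ← h3.tsum_sub h1]
  refine tsum_congr fun i ↦ ?_
  rw [kernelDefect, ← gammaFactor, ← proj, sub_mul, smul_sub, hpow]
  simp only [smul_mul_assoc, mul_smul_comm, smul_smul]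
  congr 2
  ring

/-- The bound D has to be uniform in x, because each row shifts the real part by d/c. -/
lemma norm_tsum_rowTerm_sub_phi_le [DiscreteTopology Γ] (ha : IsScaling Γ a σa)
    (hb : IsScaling Γ b σb)
    (hu : ∀ v w : V, inner ℂ (χ hb.gen v) (χ hb.gen w) = inner ℂ v w) {C σ₀ : ℝ}
    (hσ₀ : 1 < σ₀) (hC0 : 0 ≤ C)
    (hC : ∀ i : LowerRow Γ σa σb, ‖χ (omegaElt i.2)⁻¹‖ ≤ C * (i.1 : ℝ) ^ (2 * (σ₀ - 1)))
    (z : ℍ) {s : ℂ} (hs : σ₀ < s.re) {D : ℝ}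
    (hD : ∀ x, ‖kernelDefect χ hb.gen (fixedSpace χ b) s x z.im‖ ≤ D) :
    ‖∑' p, rowTerm χ a σa σb hb.gen z s p - (z.im : ℂ) ^ (1 - s) • phi χ a b σa σb s‖ ≤
      z.im ^ s.re * D * C * rowBound (s.re - σ₀ + 1) := by
  have hy := z.im_pos
  have hD0 : 0 ≤ D := (norm_nonneg _).trans (hD 0)
  have hsum := summable_norm_cpow_smul ha hb hC hs
  obtain ⟨hrow, hle⟩ := summable_lowerRow ha hb (τ := s.re - σ₀ + 1) (by linarith)
  rw [tsum_rowTerm_sub_phi ha hb hu z (by linarith) (summable_rowTerm ha hb hu hσ₀ hC0 hC z hs).1 hsum]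
  have hb' : ∀ i : LowerRow Γ σa σb, ‖((z.im : ℂ) ^ s * ((i.1 : ℝ) : ℂ) ^ (-2 * s)) •
        (kernelDefect χ hb.gen (fixedSpace χ b) s (z.re + (i.2 : ℝ) / (i.1 : ℝ)) z.im *
          (χ (omegaElt i.2)⁻¹ * proj χ a))‖ ≤
      z.im ^ s.re * D * C * (i.1 : ℝ) ^ (-(2 * (s.re - σ₀ + 1))) := fun i ↦ by
    have h1 := norm_cpow_smul_le hC s i
    rw [norm_smul] at h1
    rw [norm_smul, norm_mul, Complex.norm_cpow_eq_rpow_re_of_pos hy]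
    have h2 : ‖kernelDefect χ hb.gen (fixedSpace χ b) s (z.re + (i.2 : ℝ) / (i.1 : ℝ)) z.im *
          (χ (omegaElt i.2)⁻¹ * proj χ a)‖ ≤ D * ‖χ (omegaElt i.2)⁻¹‖ :=
      (norm_mul_le _ _).trans (mul_le_mul (hD _) ((norm_mul_le _ _).trans
        (mul_le_of_le_one_right (norm_nonneg _) (norm_proj_le χ a))) (norm_nonneg _) hD0)
    calc _ ≤ z.im ^ s.re * ‖((i.1 : ℝ) : ℂ) ^ (-2 * s)‖ * (D * ‖χ (omegaElt i.2)⁻¹‖) :=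
          mul_le_mul_of_nonneg_left h2 (by positivity)
      _ = z.im ^ s.re * D * (‖((i.1 : ℝ) : ℂ) ^ (-2 * s)‖ * ‖χ (omegaElt i.2)⁻¹‖) := by ring
      _ ≤ z.im ^ s.re * D * (C * (i.1 : ℝ) ^ (-(2 * (s.re - σ₀ + 1)))) :=
          mul_le_mul_of_nonneg_left h1 (by positivity)
      _ = _ := by ring
  refine (tsum_of_norm_bounded (hrow.mul_left _).hasSum hb').trans ?_
  rw [tsum_mul_left]
  exact mul_le_mul_of_nonneg_left hle (by positivity)

lemma rpow_mul_exp_neg_le {t κ y : ℝ} (ht : 0 < t) (hκ : 0 < κ) (hy : 0 < y) :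
    y ^ t * Real.exp (-κ * y) ≤ (t / κ) ^ t := by
  have h1 : κ * y / t ≤ Real.exp (κ * y / t) := by
    linarith [Real.add_one_le_exp (κ * y / t)]
  have h2 : (κ * y / t) ^ t ≤ Real.exp (κ * y) := by
    refine (Real.rpow_le_rpow (by positivity) h1 ht.le).trans (le_of_eq ?_)
    rw [← Real.exp_mul]; congr 1; field_simp
  have h3 : y ^ t = (t / κ) ^ t * (κ * y / t) ^ t := by
    rw [← Real.mul_rpow (by positivity) (by positivity)]; congr 1; field_simp
  rw [h3, neg_mul, Real.exp_neg, ← div_eq_mul_inv, div_le_iff₀ (Real.exp_pos _)]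
  exact mul_le_mul_of_nonneg_left h2 (by positivity)

lemma e_injOn : Set.InjOn e (Set.Ioo 0 1) := by
  intro x hx y hy h
  rw [e, e, Complex.exp_eq_exp_iff_exists_int] at h
  obtain ⟨n, hn⟩ := h
  have h2 : (x : ℂ) = y + n := by
    refine mul_left_cancel₀ Complex.two_pi_I_ne_zero ?_
    rw [hn]; ring
  have h3 : x = y + n := by exact_mod_cast h2
  have h4 : -1 < (n : ℝ) := by linarith [hx.1, hy.2]
  have h5 : (n : ℝ) < 1 := by linarith [hx.2, hy.1]
  have h6 : -1 < n := by exact_mod_cast h4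
  have h7 : n < 1 := by exact_mod_cast h5
  have h8 : n = 0 := by omega
  rw [h3, h8]; simp

/-- The strict inequalities that define a decay rate are preserved by a small increase. -/
lemma exists_larger_decayRate {T : Module.End ℂ V} {β : ℝ} (hβ1 : β < 2 * Real.pi)
    (hβν : ∀ ν : ℝ, 0 < ν → ν < 1 → T.HasEigenvalue (e ν) →
      β < 2 * Real.pi * ν ∧ β < 2 * Real.pi * (1 - ν)) :
    ∃ β', β < β' ∧ β' < 2 * Real.pi ∧ ∀ ν : ℝ, 0 < ν → ν < 1 → T.HasEigenvalue (e ν) →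
      β' < 2 * Real.pi * ν ∧ β' < 2 * Real.pi * (1 - ν) := by
  have hfin : {ν | ν ∈ Set.Ioo (0 : ℝ) 1 ∧ T.HasEigenvalue (e ν)}.Finite := by
    refine Set.Finite.of_finite_image (f := e) ((Module.End.finite_hasEigenvalue T).subset ?_)
      (e_injOn.mono fun ν h ↦ h.1)
    rintro _ ⟨ν, hν, rfl⟩
    exact hν.2
  have h1 : ∀ᶠ β' in nhdsWithin β (Set.Ioi β), ∀ ν ∈ {ν | ν ∈ Set.Ioo (0 : ℝ) 1 ∧ T.HasEigenvalue (e ν)},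
      β' < 2 * Real.pi * ν ∧ β' < 2 * Real.pi * (1 - ν) := by
    rw [Filter.eventually_all_finite hfin]
    rintro ν ⟨hν, hev⟩
    obtain ⟨h2, h3⟩ := hβν ν hν.1 hν.2 hev
    exact nhdsWithin_le_nhds ((eventually_lt_nhds h2).and (eventually_lt_nhds h3))
  have h2 : ∀ᶠ β' in nhdsWithin β (Set.Ioi β), β' < 2 * Real.pi :=
    nhdsWithin_le_nhds (eventually_lt_nhds hβ1)
  obtain ⟨β', ⟨h3, h4⟩, h5⟩ := ((h1.and h2).and self_mem_nhdsWithin).exists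
  exact ⟨β', h5, h4, fun ν h6 h7 h8 ↦ h3 ν ⟨⟨h6, h7⟩, h8⟩⟩

/-- The constant term of the Eisenstein series, up to an exponentially small error. -/
lemma exists_norm_tsum_rowTerm_sub_phi_le [DiscreteTopology Γ]
    (hχ1 : ∀ γ : Γ, (γ : SL(2, ℝ)) = -1 → χ γ = 1) (ha : IsScaling Γ a σa)
    (hb : IsScaling Γ b σb)
    (hu : ∀ v w : V, inner ℂ (χ hb.gen v) (χ hb.gen w) = inner ℂ v w) {C σ₀ : ℝ}
    (hσ₀ : 1 < σ₀) (hC0 : 0 ≤ C)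
    (hC : ∀ i : LowerRow Γ σa σb, ‖χ (omegaElt i.2)⁻¹‖ ≤ C * (i.1 : ℝ) ^ (2 * (σ₀ - 1)))
    {β Y : ℝ} (hβ : 0 < β) (hrate : DecayRate χ σb β) (hY : 0 < Y) :
    ∃ K : ℂ → ℝ, ContinuousOn K {s | σ₀ < s.re} ∧ ∀ s : ℂ, σ₀ < s.re → ∀ z : ℍ, Y ≤ z.im →
      ‖∑' p, rowTerm χ a σa σb hb.gen z s p - (z.im : ℂ) ^ (1 - s) • phi χ a b σa σb s‖ ≤
        K s * Real.exp (-β * z.im) := by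
  -- The margin between β and β' absorbs the factor y^σ, which is unbounded as y grows.
  obtain ⟨β', hββ', hβ1, hβν⟩ := exists_larger_decayRate hrate.1 (hrate.2 hb.gen rfl)
  obtain ⟨D, hDc, hD⟩ := exists_norm_kernelDefect_le hu (mem_fixedSpace_iff hχ1 hb)
    (hβ.trans hββ') hβ1 hβν hY
  have hκ : 0 < β' - β := by linarith
  refine ⟨fun s ↦ (s.re / (β' - β)) ^ s.re * D s * C * rowBound (s.re - σ₀ + 1), ?_,
    fun s hs z hz ↦ ?_⟩
  · have h1 : ContinuousOn (fun s : ℂ ↦ (s.re / (β' - β)) ^ s.re) {s | σ₀ < s.re} :=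
      ContinuousOn.rpow (by fun_prop) (by fun_prop) fun s hs ↦ Or.inl (by
        have : σ₀ < s.re := hs
        exact (div_pos (by linarith) hκ).ne')
    have h2 : ContinuousOn (fun s : ℂ ↦ rowBound (s.re - σ₀ + 1)) {s | σ₀ < s.re} := by
      unfold rowBound
      refine continuousOn_const.mul (ContinuousOn.inv₀ (continuousOn_const.sub
        (ContinuousOn.rpow continuousOn_const (by fun_prop) fun s _ ↦ Or.inl (by norm_num)))
        fun s hs ↦ ?_)
      have h3 : σ₀ < s.re := hs
      have : (4 : ℝ) ^ (1 - (s.re - σ₀ + 1)) < 1 :=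
        Real.rpow_lt_one_of_one_lt_of_neg (by norm_num) (by linarith)
      linarith
    exact ((h1.mul (hDc.mono fun s hs ↦ hσ₀.trans hs)).mul continuousOn_const).mul h2
  · have hs' : σ₀ < s.re := hs
    have hD0 : 0 ≤ D s := by
      have := (norm_nonneg _).trans (hD s (hσ₀.trans hs) 0 Y le_rfl)
      exact nonneg_of_mul_nonneg_left this (Real.exp_pos _)
    refine (norm_tsum_rowTerm_sub_phi_le ha hb hu hσ₀ hC0 hC z hs fun x ↦
      hD s (hσ₀.trans hs) x z.im hz).trans ?_
    have h1 := rpow_mul_exp_neg_le (t := s.re) (by linarith) hκ z.im_pos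
    have h2 : Real.exp (-β' * z.im) = Real.exp (-(β' - β) * z.im) * Real.exp (-β * z.im) := by
      rw [← Real.exp_add]; congr 1; ring
    have h3 := rowBound_nonneg (τ := s.re - σ₀ + 1) (by linarith)
    calc z.im ^ s.re * (D s * Real.exp (-β' * z.im)) * C * rowBound (s.re - σ₀ + 1)
        = (z.im ^ s.re * Real.exp (-(β' - β) * z.im)) *
          (D s * C * rowBound (s.re - σ₀ + 1) * Real.exp (-β * z.im)) := by rw [h2]; ring
      _ ≤ (s.re / (β' - β)) ^ s.re *
          (D s * C * rowBound (s.re - σ₀ + 1) * Real.exp (-β * z.im)) :=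
        mul_le_mul_of_nonneg_right h1 (by positivity)
      _ = _ := by ring

/-- The sum over n is O(y^(-2σ) + 1), and the factor y^σ in front turns this into y^(-σ) + y^σ. The
exceptional coset contributes another multiple of y^σ. -/
lemma exists_norm_eisenstein_le [DiscreteTopology Γ] (h1 : (-1 : SL(2, ℝ)) ∈ Γ)
    (ha : IsScaling Γ a σa) (hb : IsScaling Γ b σb)
    (hu : ∀ v w : V, inner ℂ (χ hb.gen v) (χ hb.gen w) = inner ℂ v w) {C σ₀ : ℝ}
    (hσ₀ : 1 < σ₀) (hC0 : 0 ≤ C)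
    (hC : ∀ i : LowerRow Γ σa σb, ‖χ (omegaElt i.2)⁻¹‖ ≤ C * (i.1 : ℝ) ^ (2 * (σ₀ - 1))) :
    ∃ K : ℝ → ℝ, ∀ s : ℂ, σ₀ < s.re → ∀ z : ℍ,
      ‖eisenstein χ a σa (σb • z) s‖ ≤ K s.re * (z.im ^ s.re + z.im ^ (-s.re)) := by
  obtain ⟨M, hM0, hM⟩ := exists_norm_tsum_compl_le h1 χ ha hb
  set W : ℝ → ℝ := fun t ↦ 4 ^ t * ∑' n : ℤ, |(n : ℝ)| ^ (-(2 * t)) with hW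
  have hW0 : ∀ t, 0 ≤ W t := fun t ↦ by positivity
  refine ⟨fun t ↦ M t + C * rowBound (t - σ₀ + 1) * (1 + W t), fun s hs z ↦ ?_⟩
  have hy := z.im_pos
  obtain ⟨hsum, hle⟩ := summable_rowTerm ha hb hu hσ₀ hC0 hC z hs
  rw [eisenstein_eq_add h1 ha hb z s hsum]
  have hR := rowBound_nonneg (τ := s.re - σ₀ + 1) (by linarith)
  have hp : z.im ^ s.re * (z.im ^ 2) ^ (-s.re) = z.im ^ (-s.re) := by
    rw [← Real.rpow_natCast, ← Real.rpow_mul hy.le, ← Real.rpow_add hy]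
    congr 1; push_cast; ring
  have h2 := (norm_tsum_le_tsum_norm hsum).trans hle
  have h3 := (norm_add_le _ _).trans (add_le_add h2 (hM s z))
  refine h3.trans ?_
  set A := z.im ^ s.re with hA
  set B := z.im ^ (-s.re) with hB
  have hA0 : 0 ≤ A := by positivity
  have hB0 : 0 ≤ B := by positivity
  have hM0' := hM0 s.re
  have hW0' := hW0 s.re
  have e1 : A * C * rowBound (s.re - σ₀ + 1) * ((z.im ^ 2) ^ (-s.re) + W s.re) + M s.re * A =
      C * rowBound (s.re - σ₀ + 1) * (B + W s.re * A) + M s.re * A := by rw [← hp]; ring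
  refine (le_of_eq e1).trans ?_
  have e2 : (M s.re + C * rowBound (s.re - σ₀ + 1) * (1 + W s.re)) * (A + B) =
      C * rowBound (s.re - σ₀ + 1) * (B + W s.re * A) + M s.re * A +
        (M s.re * B + C * rowBound (s.re - σ₀ + 1) * (A + W s.re * B)) := by ring
  rw [e2]
  exact le_add_of_nonneg_right (by positivity)

end TwistedEisenstein
end

theorem proposition3p7 {V : Type*} [NormedAddCommGroup V] [InnerProductSpace ℂ V]
    [FiniteDimensional ℂ V] (Γ : Subgroup SL(2, ℝ))
    (hΓ : TwistedEisenstein.IsCuspidalLattice Γ)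
    (χ : Γ →* (V →L[ℂ] V))
    -- `χ` is a representation of the image of `Γ` in `PSL(2, ℝ)`
    (hχ1 : ∀ γ : Γ, (γ : SL(2, ℝ)) = -1 → χ γ = 1)
    (hχ : TwistedEisenstein.UnitaryAtCusps χ)
    (σ : OnePoint ℝ → SL(2, ℝ))
    (hσ : ∀ a, TwistedEisenstein.Cusp Γ a → TwistedEisenstein.IsScaling Γ a (σ a)) :
    (∃ σ₀ : ℝ, 1 < σ₀ ∧ TwistedEisenstein.GrowthBound χ σ₀) ∧
    ∀ σ₀ : ℝ, 1 < σ₀ → TwistedEisenstein.GrowthBound χ σ₀ →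
    ∀ a b : OnePoint ℝ, TwistedEisenstein.Cusp Γ a → TwistedEisenstein.Cusp Γ b →
      -- absolute convergence of the Eisenstein series
      (∀ s : ℂ, σ₀ < s.re → ∀ z : ℍ, Summable fun q : TwistedEisenstein.Cosets Γ a =>
        ‖TwistedEisenstein.eisTerm χ a (σ a) z s q.out‖) ∧
      -- the asymptotic expansion, for equal or inequivalent cusps
      ((a = b ∨ ∀ γ ∈ Γ, TwistedEisenstein.slToGL γ • a ≠ b) →
        (∀ c ∈ TwistedEisenstein.moduli Γ (σ a) (σ b),
          (TwistedEisenstein.residues Γ (σ a) (σ b) c).Finite) ∧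
        (∀ s : ℂ, σ₀ < s.re → Summable fun c : TwistedEisenstein.moduli Γ (σ a) (σ b) =>
          ‖((c : ℝ) : ℂ) ^ (-2 * s) • TwistedEisenstein.kloosterman χ (σ a) (σ b) 0 c‖) ∧
        ∀ β : ℝ, 0 < β → TwistedEisenstein.DecayRate χ (σ b) β → ∀ Y : ℝ, 0 < Y →
          ∃ C : ℂ → ℝ, ContinuousOn C {s | σ₀ < s.re} ∧
            ∀ s : ℂ, σ₀ < s.re → ∀ z : ℍ, Y ≤ z.im →
              ‖TwistedEisenstein.eisenstein χ a (σ a) (σ b • z) s -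
                  (TwistedEisenstein.mainTerm χ a b z.im s +
                    (z.im : ℂ) ^ (1 - s) • TwistedEisenstein.phi χ a b (σ a) (σ b) s)‖
                ≤ C s * Real.exp (-β * z.im)) ∧
      -- the growth bound, with a constant that depends on `s` only through its real part
      ∃ C : ℝ → ℝ, ∀ s : ℂ, σ₀ < s.re → ∀ z : ℍ,
        ‖TwistedEisenstein.eisenstein χ a (σ a) (σ b • z) s‖
          ≤ C s.re * (z.im ^ s.re + z.im ^ (-s.re)) := by
  have := hΓ.discrete
  refine ⟨TwistedEisenstein.exists_growthBound hΓ hχ hσ, fun σ₀ hσ₀ hg a b hca hcb ↦ ?_⟩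
  have ha := hσ a hca
  have hb := hσ b hcb
  have hu : ∀ v w : V, inner ℂ (χ hb.gen v) (χ hb.gen w) = inner ℂ v w :=
    hχ b hcb _ hb.gen_mem_stab
  obtain ⟨C, hC0, hC⟩ := TwistedEisenstein.exists_norm_omegaElt_inv_le hχ hca ha hb hσ₀ hg
  have hrow := fun (z : ℍ) {s : ℂ} (hs : σ₀ < s.re) ↦
    (TwistedEisenstein.summable_rowTerm ha hb hu hσ₀ hC0 hC z hs).1
  have hcoef := fun {s : ℂ} (hs : σ₀ < s.re) ↦
    TwistedEisenstein.summable_norm_cpow_smul ha hb hC hs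
  refine ⟨fun s hs z ↦ ?_, fun hab ↦ ⟨fun c hc ↦ TwistedEisenstein.finite_residues ha hb hc,
    fun s hs ↦ TwistedEisenstein.summable_kloosterman ha hb (hcoef hs), fun β hβ hrate Y hY ↦ ?_⟩,
    TwistedEisenstein.exists_norm_eisenstein_le hΓ.neg_one_mem ha hb hu hσ₀ hC0 hC⟩
  -- Convergence is known at points written as σ_b w; here w = σ_b⁻¹ z.
  · have h := TwistedEisenstein.summable_eisTerm_of_rowTerm hΓ.neg_one_mem ha hb ((σ b)⁻¹ • z) s
      (hrow _ hs)
    rwa [smul_inv_smul] at h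
  · obtain ⟨K, hK, hK'⟩ := TwistedEisenstein.exists_norm_tsum_rowTerm_sub_phi_le hχ1 ha hb hu hσ₀
      hC0 hC hβ hrate hY
    refine ⟨K, hK, fun s hs z hz ↦ ?_⟩
    rw [TwistedEisenstein.eisenstein_eq_add hΓ.neg_one_mem ha hb z s (hrow z hs),
      TwistedEisenstein.tsum_compl_eq_mainTerm hΓ.neg_one_mem ha hb hab, add_comm,
      add_sub_add_left_eq_sub]
    exact hK' s hs z hz
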